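/- **Setting.** Let $\Gamma$ be a finite graph cellularly embedded in a closed surface, all of whose vertices have even degree greater than $2$, and whose faces are properly $2$-colored, $\mathsf F(\Gamma)=F_a\sqcup F_b$ (i.e. the dual graph $\Gamma^*$ is bipartite). Let $\Gamma_2$ be the $2$-colex obtained from the dual of the medial graph of $\Gamma$ by splitting every edge and expanding every vertex into a face. Its $v$-faces come from the vertices and from the faces of $\Gamma$, its (4-sided) $e$-faces from the corners of $\Gamma$, and its $f$-faces from the edges of $\Gamma$. Color an edge of $\Gamma_2$ red if it separates an $e$-face and an $f$-face, green if it separates a $v$-face and an $e$-face, and blue if it separates a $v$-face and an $f$-face. Inside every $v$-face coming from a vertex $v$ of $\Gamma$ insert an inner face with $\deg v$ vertices, promote each blue edge of that $v$-face to a blue rank-3 edge by adding one vertex of the inner face, without crossings, and color the edges of the inner face alternately red and green. The *generalized five-squares code* has one qubit per vertex of the resulting hypergraph. Edge operators are products of $X$ (red), $Y$ (green), $Z$ (blue) over the vertices of the edge. The gauge group $\mathcal G$ is generated by the edge operators of the rank-2 edges and by $Z_uZ_v$ for $u,v$ in a common rank-3 edge; the stabilizer is $S=\mathcal G\cap C(\mathcal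 G)$. Everything is modulo phases. The following cycle operators are used. - (S1), for a face $f$ of $\Gamma$: the boundary in $\Gamma_2$ of the $v$-face coming from $f$. - (S2), for a vertex $v$ of $\Gamma$: the rank-3 and green edges on the $v$-face coming from $v$, and the green edges of its inner face. - (S3), for a face $f$ of $\Gamma$: the rank-3 edges belonging to the edges of $f$, the green edge and the inner-face edge at each corner of $f$ in the unit cells around $f$, and, on the far side of each edge of $f$, the two red edges and the blue edge. - (S4), for a vertex $v$ of $\Gamma$: the inner face of $v$. - (S5), for an $e$-face of $\Gamma_2$: its boundary. The surface code on $\Gamma^*$ has its qubits on the edges of $\Gamma^*$, vertex operators $\prod X_e$ and plaquette operators $\prod Z_e$. A *($Z$-)decoder* for it is any map that sends the vertex-operator syndrome of any $Z$ error to a $Z$ error with the same syndrome. **Algorithm** (input: the syndrome of an error $E$ for S1–S5). Start with $\hat E=I$. (1) For each $e$-face and each inner face, if its S5 or S4 syndrome is $1$, multiply $\hat E$ by $X_q$ for one chosen qubit $q$ of that face. (2) For each vertex $v$ of $\Gamma$, if the S2 syndrome of $E\hat E$ is $1$, multiply $\hat E$ by $Z_q$ for one chosen qubit $q$ of the $v$-face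 of $v$ in $\Gamma_2$ (it lies on a rank-3 edge). Denote the result by $\hat E_{\rm loc}$. (3) Let $s_1$ be the syndrome on the vertices of $\Gamma^*$ (the faces of $\Gamma$) consisting of the S1 syndromes of $E\hat E_{\rm loc}$ on $F_a$ and the S3 syndromes on $F_b$, and let $s_2$ consist of the S3 syndromes on $F_a$ and the S1 syndromes on $F_b$. Apply decoders $D_1,D_2$ for the surface code on $\Gamma^*$, and return $\hat E=\hat E_{\rm loc}\cdot L(D_1(s_1),D_2(s_2))$. Here the lift $L$ puts a $Z$, for every edge $e$ in the first (second) estimate, on a chosen one of the two qubits that lie on the edge $e$ of the $v$-face of $\Gamma_2$ coming from the face in $F_a$ (in $F_b$) incident to $e$. **Theorem.** Generalized five-squares codes can be efficiently decoded by this algorithm. Precisely: 1. *(Correctness.)* For every such code and all choices of qubits in the algorithm, the operators S1–S5 belong to $S$, and for every Pauli error $E$ there are $Z$ errors $E_1,E_2$ on two copies of the surface code on $\Gamma^*$, with syndromes $s_1$ and $s_2$, such that $E\hat E_{\rm loc}$ is equivalent to $L(E_1,E_2)$ modulo $\mathcal G$, and such that for all decoders $D_1,D_2$: $E\hat E$ commutes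 with every element of $S$ (so $\hat E$ has the same syndrome as $E$), and $E\hat E\in\mathcal G$ if and only if both $E_1D_1(s_1)$ and $E_2D_2(s_2)$ lie in the stabilizer of the surface code. 2. *(Efficiency.)* If $D_1$ and $D_2$ can be computed, from an embedded graph and the syndrome of a $Z$ error, in time polynomial in the number of edges for all $\Gamma^*$ in some class of embedded graphs, then the whole algorithm can be carried out by one program, from the code, the choices and the syndrome of an error, in time polynomial in the number of qubits, for all codes whose $\Gamma^*$ is in that class. 3. There is a decoder for the surface codes on all finite graphs cellularly embedded in closed surfaces that can be computed in time polynomial in the number of edges; with it, the whole algorithm runs in polynomial time. Time is the number of steps of a while program on binary trees (unit cost per operation); graphs are given by tables of their flag involutions. -/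

import Mathlib

/-! ### Graphs cellularly embedded in closed surfaces -/

/-- A graph cellularly embedded in a closed surface, given by its flags (mutually incident triples
vertex, edge, face).  The involution `t0` changes the vertex of a flag, `t1` its edge and `t2` its
face, the other two members of the triple being kept.  Loops, multiple edges, several components
and nonorientable surfaces are allowed. -/
structure SurfaceMap (Φ : Type) where
  t0 : Φ → Φ
  t1 : Φ → Φ
  t2 : Φ → Φ
  t0_t0 : ∀ x, t0 (t0 x) = x
  t1_t1 : ∀ x, t1 (t1 x) = x
  t2_t2 : ∀ x, t2 (t2 x) = x
  t0_ne : ∀ x, t0 x ≠ x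
  t1_ne : ∀ x, t1 x ≠ x
  t2_ne : ∀ x, t2 x ≠ x
  t0_t2 : ∀ x, t0 (t2 x) = t2 (t0 x)
  t0_t2_ne : ∀ x, t0 (t2 x) ≠ x

namespace SurfaceMap

variable {Φ : Type} (M : SurfaceMap Φ)

/-- Vertices: flags up to changing the edge and the face. -/
def Vertex : Type := Quot (fun x y : Φ => y = M.t2 x ∨ y = M.t1 x)
/-- Edges: flags up to changing the vertex and the face. -/
def Edge : Type := Quot (fun x y : Φ => y = M.t0 x ∨ y = M.t2 x)
/-- Faces: flags up to changing the vertex and the edge. -/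
def Face : Type := Quot (fun x y : Φ => y = M.t0 x ∨ y = M.t1 x)
/-- Half-edges: a vertex together with one end of an edge at that vertex. -/
def HalfEdge : Type := Quot (fun x y : Φ => y = M.t2 x)
/-- Sides: a face together with one edge occurrence in its boundary walk. -/
def Side : Type := Quot (fun x y : Φ => y = M.t0 x)
/-- Corners: a vertex together with one of its occurrences in the boundary walk of a face. -/
def Corner : Type := Quot (fun x y : Φ => y = M.t1 x)

def vertexOf (x : Φ) : M.Vertex := Quot.mk _ x
def edgeOf (x : Φ) : M.Edge := Quot.mk _ x
def faceOf (x : Φ) : M.Face := Quot.mk _ x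
def halfEdgeOf (x : Φ) : M.HalfEdge := Quot.mk _ x
def sideOf (x : Φ) : M.Side := Quot.mk _ x
def cornerOf (x : Φ) : M.Corner := Quot.mk _ x

instance [Finite Φ] : Finite M.Vertex := inferInstanceAs (Finite (Quot _))
instance [Finite Φ] : Finite M.Edge := inferInstanceAs (Finite (Quot _))
instance [Finite Φ] : Finite M.Face := inferInstanceAs (Finite (Quot _))
instance [Finite Φ] : Finite M.HalfEdge := inferInstanceAs (Finite (Quot _))
instance [Finite Φ] : Finite M.Side := inferInstanceAs (Finite (Quot _))
instance [Finite Φ] : Finite M.Corner := inferInstanceAs (Finite (Quot _))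

noncomputable instance [Finite Φ] : Fintype M.Vertex := Fintype.ofFinite _
noncomputable instance [Finite Φ] : Fintype M.Edge := Fintype.ofFinite _
noncomputable instance [Finite Φ] : Fintype M.Face := Fintype.ofFinite _
noncomputable instance [Finite Φ] : Fintype M.HalfEdge := Fintype.ofFinite _
noncomputable instance [Finite Φ] : Fintype M.Side := Fintype.ofFinite _
noncomputable instance [Finite Φ] : Fintype M.Corner := Fintype.ofFinite _

/-- The vertex at which a half-edge is attached. -/
def HalfEdge.vertex {M : SurfaceMap Φ} : M.HalfEdge → M.Vertex :=
  Quot.lift M.vertexOf (fun _ _ h => Quot.sound (Or.inl h))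
/-- The edge to which a half-edge belongs. -/
def HalfEdge.edge {M : SurfaceMap Φ} : M.HalfEdge → M.Edge :=
  Quot.lift M.edgeOf (fun _ _ h => Quot.sound (Or.inr h))
/-- The face to which a side belongs. -/
def Side.face {M : SurfaceMap Φ} : M.Side → M.Face :=
  Quot.lift M.faceOf (fun _ _ h => Quot.sound (Or.inl h))
/-- The edge to which a side belongs. -/
def Side.edge {M : SurfaceMap Φ} : M.Side → M.Edge :=
  Quot.lift M.edgeOf (fun _ _ h => Quot.sound (Or.inl h))

/-- The degree of a vertex (a loop counts twice). -/
noncomputable def degree (v : M.Vertex) : ℕ := Nat.card {h : M.HalfEdge // h.vertex = v}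

/-- The dual embedded graph: vertices and faces are exchanged. -/
def dual : SurfaceMap Φ where
  t0 := M.t2
  t1 := M.t1
  t2 := M.t0
  t0_t0 := M.t2_t2
  t1_t1 := M.t1_t1
  t2_t2 := M.t0_t0
  t0_ne := M.t2_ne
  t1_ne := M.t1_ne
  t2_ne := M.t0_ne
  t0_t2 := fun x => (M.t0_t2 x).symm
  t0_t2_ne := fun x => by rw [← M.t0_t2]; exact M.t0_t2_ne x

/-- The medial graph.  Its vertices are the edges of `M`, its edges are the corners of `M`, and its
faces are the vertices and the faces of `M`.  The flag `(x, true)` of the medial graph consists of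
the edge, the corner and the vertex of `x`; the flag `(x, false)` consists of the edge, the corner
and the face of `x`. -/
def medial : SurfaceMap (Φ × Bool) where
  t0 := fun p => (M.t1 p.1, p.2)
  t1 := fun p => (if p.2 = true then M.t2 p.1 else M.t0 p.1, p.2)
  t2 := fun p => (p.1, !p.2)
  t0_t0 := fun p => by simp [M.t1_t1]
  t1_t1 := fun p => by rcases p with ⟨x, _ | _⟩ <;> simp [M.t0_t0, M.t2_t2]
  t2_t2 := fun p => by simp
  t0_ne := fun p h => M.t1_ne p.1 (congrArg Prod.fst h)
  t1_ne := fun p h => by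
    rcases p with ⟨x, _ | _⟩
    · exact M.t0_ne x (by simpa using congrArg Prod.fst h)
    · exact M.t2_ne x (by simpa using congrArg Prod.fst h)
  t2_ne := fun p h => by simpa using congrArg Prod.snd h
  t0_t2 := fun _ => rfl
  t0_t2_ne := fun p h => by simpa using congrArg Prod.snd h

end SurfaceMap

/-! ### Pauli operators, subsystem codes -/

/-- The Pauli group on the qubits `Q` modulo phases: `p.1` is the `X` part and `p.2` the `Z` part,
so that `(1, 0)`, `(1, 1)`, `(0, 1)` at a qubit stand for `X`, `Y`, `Z`.  Multiplication of
operators is addition. -/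
abbrev Pauli (Q : Type) : Type := (Q → ZMod 2) × (Q → ZMod 2)

namespace Pauli

variable {Q : Type}

open Classical in
/-- The single-qubit operator `X_q`. -/
noncomputable def X (q : Q) : Pauli Q := (Pi.single q 1, 0)

open Classical in
/-- The single-qubit operator `Z_q`. -/
noncomputable def Z (q : Q) : Pauli Q := (0, Pi.single q 1)

/-- `0` if the two Pauli operators commute and `1` if they anticommute. -/
def comm [Fintype Q] (p r : Pauli Q) : ZMod 2 := ∑ q, (p.1 q * r.2 q + p.2 q * r.1 q)

/-- The centralizer of a group of Pauli operators (modulo phases). -/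
def centralizer [Fintype Q] (G : AddSubgroup (Pauli Q)) : AddSubgroup (Pauli Q) where
  carrier := {p | ∀ g ∈ G, comm g p = 0}
  zero_mem' := fun g _ => by simp [comm]
  add_mem' := fun {a b} ha hb g hg => by
    have h : comm g (a + b) = comm g a + comm g b := by
      simp only [comm, Prod.fst_add, Prod.snd_add, Pi.add_apply, ← Finset.sum_add_distrib]
      exact Finset.sum_congr rfl fun q _ => by ring
    rw [h, ha g hg, hb g hg, add_zero]
  neg_mem' := fun {a} ha g hg => by
    have h : comm g (-a) = - comm g a := by
      simp only [comm, Prod.fst_neg, Prod.snd_neg, Pi.neg_apply, ← Finset.sum_neg_distrib]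
      exact Finset.sum_congr rfl fun q _ => by ring
    rw [h, ha g hg, neg_zero]

end Pauli

/-- The colors of the edges of a hypergraph. -/
inductive Color where
  | red
  | green
  | blue

/-- An edge of a 3-edge-colored hypergraph with vertex set `Q`: its set of vertices and its
color. -/
abbrev ColoredEdge (Q : Type) : Type := Finset Q × Color

open Classical in
/-- The edge operator `K_e`: the product over the vertices of `e` of `X` if `e` is red, of `Y` if
`e` is green, and of `Z` if `e` is blue. -/
noncomputable def edgeOperator {Q : Type} (e : ColoredEdge Q) : Pauli Q :=
  (fun q => if q ∈ e.1 ∧ e.2 ≠ Color.blue then 1 else 0,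
   fun q => if q ∈ e.1 ∧ e.2 ≠ Color.red then 1 else 0)

/-- The cycle operator of a collection of edges: the product of the edge operators. -/
noncomputable def cycleOperator {Q : Type} (σ : Finset (ColoredEdge Q)) : Pauli Q :=
  ∑ e ∈ σ, edgeOperator e

/-- The gauge group of a hypergraph with edges of rank 2 and 3.  It is generated by the link
operators: the edge operators of the rank-2 edges, and `Z_u Z_v` for any two vertices of a rank-3
edge. -/
def gaugeGroup {Q : Type} (E : Set (ColoredEdge Q)) : AddSubgroup (Pauli Q) :=
  AddSubgroup.closure
    ({p | ∃ e ∈ E, e.1.card = 2 ∧ p = edgeOperator e} ∪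
     {p | ∃ e ∈ E, e.1.card = 3 ∧ ∃ u ∈ e.1, ∃ v ∈ e.1, u ≠ v ∧ p = Pauli.Z u + Pauli.Z v})

/-- The stabilizer of the subsystem code with gauge group `G`: the center of `G` (modulo phases). -/
def stabilizerGroup {Q : Type} [Fintype Q] (G : AddSubgroup (Pauli Q)) : AddSubgroup (Pauli Q) :=
  G ⊓ Pauli.centralizer G

/-! ### Surface codes -/

namespace SurfaceMap

variable {Φ : Type} [Finite Φ] (M : SurfaceMap Φ)

open Classical in
/-- The vertex operator `A_v` of the surface code on `M`, whose qubits are the edges of `M`. -/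
noncomputable def vertexOperator (v : M.Vertex) : Pauli M.Edge :=
  ∑ h : M.HalfEdge with h.vertex = v, Pauli.X h.edge

open Classical in
/-- The plaquette operator `B_f` of the surface code on `M`. -/
noncomputable def plaquetteOperator (f : M.Face) : Pauli M.Edge :=
  ∑ s : M.Side with s.face = f, Pauli.Z s.edge

/-- The stabilizer of the surface code on `M`. -/
def surfaceStabilizer : AddSubgroup (Pauli M.Edge) :=
  AddSubgroup.closure (Set.range M.vertexOperator ∪ Set.range M.plaquetteOperator)

/-- The `Z` error on the surface code on `M` supported on the edges where `c` is `1`. -/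
def zError (c : M.Edge → ZMod 2) : Pauli M.Edge := (0, c)

/-- The syndrome of a `Z` error with respect to the vertex operators. -/
noncomputable def zSyndrome (c : M.Edge → ZMod 2) : M.Vertex → ZMod 2 :=
  fun v => Pauli.comm (M.vertexOperator v) (M.zError c)

/-- A decoder for the `Z` errors on the surface code on `M`: for the syndrome of any `Z` error it
returns a `Z` error with that syndrome. -/
def IsZDecoder (D : (M.Vertex → ZMod 2) → (M.Edge → ZMod 2)) : Prop :=
  ∀ c : M.Edge → ZMod 2, M.zSyndrome (D (M.zSyndrome c)) = M.zSyndrome c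

end SurfaceMap

/-! ### Generalized five-squares codes -/

/-- The data from which a generalized five-squares code is built: an embedded graph `Γ` all of
whose vertices have even degree greater than 2, a proper coloring `side` of its faces with two
colors (`true` for the faces in `F_a`, `false` for those in `F_b`), and, for every vertex of `Γ`, an
alternating coloring of the new rank-2 edges around that vertex (which correspond to its corners):
green where `innerGreen` is `true`, red elsewhere. -/
structure FiveSquares (Φ : Type) where
  Γ : SurfaceMap Φ
  even_degree : ∀ v, Even (Γ.degree v)
  two_lt_degree : ∀ v, 2 < Γ.degree v
  side : Γ.Face → Bool
  side_ne : ∀ x, side (Γ.faceOf (Γ.t2 x)) ≠ side (Γ.faceOf x)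
  innerGreen : Γ.Corner → Bool
  innerGreen_ne : ∀ x, innerGreen (Γ.cornerOf (Γ.t2 x)) ≠ innerGreen (Γ.cornerOf x)

namespace FiveSquares

variable {Φ : Type} (C : FiveSquares Φ)

/-- The dual of the medial graph of `Γ`.  Splitting its edges and expanding its vertices gives the
2-colex `Γ₂`: the vertices of `Γ₂` are the flags of `C.base`, and its edges are the pairs
`{p, t0 p}`, `{p, t1 p}`, `{p, t2 p}`.  The vertices, edges and faces of `C.base` are the
`v`-faces, `e`-faces and `f`-faces of `Γ₂`; so an edge `{p, t0 p}` separates an `e`-face and an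
`f`-face (red), an edge `{p, t1 p}` separates a `v`-face and an `f`-face (blue), and an edge
`{p, t2 p}` separates a `v`-face and an `e`-face (green).  A vertex `(x, true)` of `Γ₂` lies on
the `v`-face that comes from the vertex of `x` in `Γ`, and `(x, false)` on the `v`-face that comes
from the face of `x` in `Γ`. -/
def base : SurfaceMap (Φ × Bool) := C.Γ.medial.dual

/-- The qubits: the vertices of `Γ₂`, and one new vertex for every promoted edge
`{(x, true), (t2 x, true)}`; the promoted edges correspond to the half-edges of `Γ`. -/
abbrev Qubit : Type := (Φ × Bool) ⊕ C.Γ.HalfEdge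

open Classical in
/-- The red edge of `Γ₂` at `p`. -/
noncomputable def redEdge (p : Φ × Bool) : ColoredEdge C.Qubit :=
  ({Sum.inl p, Sum.inl (C.base.t0 p)}, Color.red)

open Classical in
/-- The green edge of `Γ₂` at `p`. -/
noncomputable def greenEdge (p : Φ × Bool) : ColoredEdge C.Qubit :=
  ({Sum.inl p, Sum.inl (C.base.t2 p)}, Color.green)

open Classical in
/-- The blue edge of `Γ₂` at `(x, false)`, which is not promoted. -/
noncomputable def blueEdge (x : Φ) : ColoredEdge C.Qubit :=
  ({Sum.inl (x, false), Sum.inl (C.base.t1 (x, false))}, Color.blue)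

open Classical in
/-- The rank-3 edge to which the blue edge of `Γ₂` at `(x, true)` is promoted. -/
noncomputable def tripleEdge (x : Φ) : ColoredEdge C.Qubit :=
  ({Sum.inl (x, true), Sum.inl (C.base.t1 (x, true)), Sum.inr (C.Γ.halfEdgeOf x)}, Color.blue)

open Classical in
/-- The edge of the inner face that belongs to the corner of `x`. -/
noncomputable def innerEdge (x : Φ) : ColoredEdge C.Qubit :=
  ({Sum.inr (C.Γ.halfEdgeOf x), Sum.inr (C.Γ.halfEdgeOf (C.Γ.t1 x))},
    if C.innerGreen (C.Γ.cornerOf x) = true then Color.green else Color.red)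

/-- The edges of the hypergraph. -/
def edges : Set (ColoredEdge C.Qubit) :=
  Set.range C.redEdge ∪ Set.range C.greenEdge ∪ Set.range C.blueEdge ∪
    Set.range C.tripleEdge ∪ Set.range C.innerEdge

/-- The gauge group of the generalized five-squares code. -/
def gauge : AddSubgroup (Pauli C.Qubit) := gaugeGroup C.edges

/-- The stabilizer of the generalized five-squares code. -/
noncomputable def stabilizer [Fintype Φ] : AddSubgroup (Pauli C.Qubit) := stabilizerGroup C.gauge

/-- The measured stabilizers.  Types 1 and 3 are indexed by the faces of `Γ`, types 2 and 4 by its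
vertices, and type 5 by the `e`-faces of `Γ₂`. -/
inductive Check where
  | s1 (f : C.Γ.Face)
  | s2 (v : C.Γ.Vertex)
  | s3 (f : C.Γ.Face)
  | s4 (v : C.Γ.Vertex)
  | s5 (c : C.base.Edge)

/-- The arbitrary choices that the algorithm makes: the qubit on which the `X` error of each
`e`-face and of each inner face is corrected; the qubit on which the `Z` error of each `v`-face in
`F_v` is corrected (the flag `x` stands for the qubit `(x, true)`); and, for each edge of `Γ*` and
each of the two copies of the surface code, the qubit that corresponds to it (the flag `x` stands
for the qubit `(x, false)`; it lies on an `F_a` face for the first copy and on an `F_b` face for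
the second). -/
structure Choices where
  eQubit : C.base.Edge → Φ × Bool
  eQubit_mem : ∀ c, C.base.edgeOf (eQubit c) = c
  innerQubit : C.Γ.Vertex → C.Γ.HalfEdge
  innerQubit_mem : ∀ v, (innerQubit v).vertex = v
  vQubit : C.Γ.Vertex → Φ
  vQubit_mem : ∀ v, C.Γ.vertexOf (vQubit v) = v
  qubitA : C.Γ.dual.Edge → Φ
  qubitA_mem : ∀ e, C.Γ.dual.edgeOf (qubitA e) = e
  qubitA_side : ∀ e, C.side (C.Γ.faceOf (qubitA e)) = true
  qubitB : C.Γ.dual.Edge → Φ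
  qubitB_mem : ∀ e, C.Γ.dual.edgeOf (qubitB e) = e
  qubitB_side : ∀ e, C.side (C.Γ.faceOf (qubitB e)) = false

variable [Fintype Φ]

open Classical in
/-- The cycles of the five types of stabilizers.
* `s1 f`: the boundary in `Γ₂` of the `v`-face that comes from `f`.
* `s2 v`: the rank-3 and green edges on the outer boundary of the unit cell of `v`, and the green
  edges of its inner face.
* `s3 f`: for each unit cell around `f`, the rank-3 edges, the green edge and the inner edge on the
  side of `f`; and for each edge of `f`, the two red edges and the blue edge beyond it.
* `s4 v`: the inner face of the unit cell of `v`.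
* `s5 c`: the boundary of the `e`-face `c`. -/
noncomputable def cycle : C.Check → Finset (ColoredEdge C.Qubit)
  | Check.s1 f =>
      (Finset.univ.filter fun x => C.Γ.faceOf x = f).image (fun x => C.greenEdge (x, false)) ∪
      (Finset.univ.filter fun x => C.Γ.faceOf x = f).image C.blueEdge
  | Check.s2 v =>
      (Finset.univ.filter fun x => C.Γ.vertexOf x = v).image C.tripleEdge ∪
      (Finset.univ.filter fun x => C.Γ.vertexOf x = v).image (fun x => C.greenEdge (x, true)) ∪
      (Finset.univ.filter fun x => C.Γ.vertexOf x = v ∧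
        C.innerGreen (C.Γ.cornerOf x) = true).image C.innerEdge
  | Check.s3 f =>
      (Finset.univ.filter fun x => C.Γ.faceOf x = f).image C.tripleEdge ∪
      (Finset.univ.filter fun x => C.Γ.faceOf x = f).image (fun x => C.greenEdge (x, true)) ∪
      (Finset.univ.filter fun x => C.Γ.faceOf x = f).image C.innerEdge ∪
      (Finset.univ.filter fun x => C.Γ.faceOf x = f).image
        (fun x => C.redEdge (C.Γ.t2 x, true)) ∪
      (Finset.univ.filter fun x => C.Γ.faceOf x = f).image (fun x => C.blueEdge (C.Γ.t2 x))
  | Check.s4 v => (Finset.univ.filter fun x => C.Γ.vertexOf x = v).image C.innerEdge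
  | Check.s5 c =>
      (Finset.univ.filter fun p => C.base.edgeOf p = c).image C.redEdge ∪
      (Finset.univ.filter fun p => C.base.edgeOf p = c).image C.greenEdge

/-- The measured stabilizer operators. -/
noncomputable def checkOperator (g : C.Check) : Pauli C.Qubit := cycleOperator (C.cycle g)

/-- The syndrome of an error. -/
noncomputable def syndrome (E : Pauli C.Qubit) : C.Check → ZMod 2 :=
  fun g => Pauli.comm (C.checkOperator g) E

/-! ### The decoding algorithm -/

variable {C} (ch : C.Choices)

/-- First loop: local correction of the `X` errors on the `e`-faces and on the inner faces. -/
noncomputable def correctX (s : C.Check → ZMod 2) : Pauli C.Qubit :=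
  (∑ c : C.base.Edge, s (Check.s5 c) • Pauli.X (Sum.inl (ch.eQubit c))) +
  ∑ v : C.Γ.Vertex, s (Check.s4 v) • Pauli.X (Sum.inr (ch.innerQubit v))

/-- The syndrome that is measured once the correction `F` has been applied, if it was `s`
before. -/
noncomputable def updated (s : C.Check → ZMod 2) (F : Pauli C.Qubit) : C.Check → ZMod 2 :=
  fun g => s g + C.syndrome F g

/-- Second loop: local correction of a `Z` error on a rank-3 edge of each unit cell.  The value is
the estimate after the first two loops. -/
noncomputable def correctLocal (s : C.Check → ZMod 2) : Pauli C.Qubit :=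
  correctX ch s + ∑ v : C.Γ.Vertex,
    updated s (correctX ch s) (Check.s2 v) • Pauli.Z (Sum.inl (ch.vQubit v, true))

/-- The syndrome on the vertices of the first copy of `Γ*`: types 1 on `F_a` and 3 on `F_b`. -/
noncomputable def projectA (s : C.Check → ZMod 2) : C.Γ.dual.Vertex → ZMod 2 :=
  fun f => if C.side f = true then updated s (correctLocal ch s) (Check.s1 f)
    else updated s (correctLocal ch s) (Check.s3 f)

/-- The syndrome on the vertices of the second copy of `Γ*`: types 3 on `F_a` and 1 on `F_b`. -/
noncomputable def projectB (s : C.Check → ZMod 2) : C.Γ.dual.Vertex → ZMod 2 :=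
  fun f => if C.side f = true then updated s (correctLocal ch s) (Check.s3 f)
    else updated s (correctLocal ch s) (Check.s1 f)

/-- The `Z` error on the code that corresponds to `Z` errors `a`, `b` on the two surface codes. -/
noncomputable def lift (a b : C.Γ.dual.Edge → ZMod 2) : Pauli C.Qubit :=
  (∑ e : C.Γ.dual.Edge, a e • Pauli.Z (Sum.inl (ch.qubitA e, false))) +
  ∑ e : C.Γ.dual.Edge, b e • Pauli.Z (Sum.inl (ch.qubitB e, false))

/-- The decoding algorithm: the error estimate for the syndrome `s`, with the decoders `D₁`, `D₂`
used on the two copies of the surface code on `Γ*`. -/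
noncomputable def decode
    (D₁ D₂ : (C.Γ.dual.Vertex → ZMod 2) → (C.Γ.dual.Edge → ZMod 2))
    (s : C.Check → ZMod 2) : Pauli C.Qubit :=
  correctLocal ch s + lift ch (D₁ (projectA ch s)) (D₂ (projectB ch s))

end FiveSquares

/-! ### The machine model: while programs on binary trees, with unit cost -/

/-- Binary trees: the data on which programs work. -/
inductive Data where
  | nil
  | cons (a b : Data)

namespace Data

/-- Lists are right-nested trees. -/
def ofList : List Data → Data
  | [] => nil
  | a :: l => cons a (ofList l)

/-- Natural numbers are written in unary. -/
def ofNat (n : ℕ) : Data := ofList (List.replicate n nil)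

open Classical in
/-- A truth value. -/
noncomputable def ofProp (p : Prop) : Data := if p then cons nil nil else nil

/-- A table indexed by `Fin N`. -/
def table {N : ℕ} (f : Fin N → Data) : Data := ofList (List.ofFn f)

/-- The table of a bit string. -/
noncomputable def bits {N : ℕ} (f : Fin N → ZMod 2) : Data := table fun x => ofProp (f x = 1)

/-- The table of a predicate. -/
noncomputable def marks {N : ℕ} (p : Fin N → Prop) : Data := table fun x => ofProp (p x)

end Data

/-- Programs.  Each maps an input tree to an output tree. -/
inductive Prog where
  | id
  | nil
  | hd
  | tl
  | cons (p q : Prog)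
  | comp (q p : Prog)
  | ite (c p q : Prog)
  | loop (c p : Prog)

/-- `Run p x y t`: on the input `x` the program `p` halts with output `y` after `t` steps.
The program `loop c p` is the while loop: as long as the value of `c` is not `nil`, the current
tree is replaced by the value of `p`. -/
inductive Run : Prog → Data → Data → ℕ → Prop where
  | id (x) : Run Prog.id x x 1
  | nil (x) : Run Prog.nil x Data.nil 1
  | hd_nil : Run Prog.hd Data.nil Data.nil 1
  | hd_cons (a b) : Run Prog.hd (Data.cons a b) a 1
  | tl_nil : Run Prog.tl Data.nil Data.nil 1
  | tl_cons (a b) : Run Prog.tl (Data.cons a b) b 1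
  | cons {p q x y z s t} : Run p x y s → Run q x z t →
      Run (Prog.cons p q) x (Data.cons y z) (s + t + 1)
  | comp {p q x y z s t} : Run p x y s → Run q y z t → Run (Prog.comp q p) x z (s + t + 1)
  | ite_then {c p q x a b y s t} : Run c x (Data.cons a b) s → Run p x y t →
      Run (Prog.ite c p q) x y (s + t + 1)
  | ite_else {c p q x y s t} : Run c x Data.nil s → Run q x y t →
      Run (Prog.ite c p q) x y (s + t + 1)
  | loop_stop {c p x s} : Run c x Data.nil s → Run (Prog.loop c p) x x (s + 1)
  | loop_step {c p x a b y z s t u} : Run c x (Data.cons a b) s → Run p x y t →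
      Run (Prog.loop c p) y z u → Run (Prog.loop c p) x z (s + t + u + 1)

/-- The program `p` maps the input `inp i` to the output `out i` in a number of steps that is
bounded by a polynomial in `size i`, for every instance `i` that satisfies `ok`. -/
def RunsInPolyTime {ι : Type} (p : Prog) (ok : ι → Prop) (size : ι → ℕ) (inp out : ι → Data) :
    Prop :=
  ∃ K k : ℕ, ∀ i, ok i → ∃ t ≤ K * (size i + 1) ^ k, Run p (inp i) (out i) t

/-! ### Efficient decoding -/

/-- An embedded graph on the flags `Fin N`, as a tree. -/
def SurfaceMap.encode {N : ℕ} (M : SurfaceMap (Fin N)) : Data :=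
  Data.ofList [Data.table fun x => Data.ofNat (M.t0 x), Data.table fun x => Data.ofNat (M.t1 x),
    Data.table fun x => Data.ofNat (M.t2 x)]

/-- An embedded graph with a syndrome on its vertices, as a tree. -/
noncomputable def SurfaceMap.encodeSyndrome {N : ℕ} (M : SurfaceMap (Fin N))
    (s : M.Vertex → ZMod 2) : Data :=
  Data.ofList [M.encode, Data.bits fun x => s (M.vertexOf x)]

/-- A `Z` error on the surface code on an embedded graph, as a tree. -/
noncomputable def SurfaceMap.encodeError {N : ℕ} (M : SurfaceMap (Fin N))
    (c : M.Edge → ZMod 2) : Data :=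
  Data.bits fun x => c (M.edgeOf x)

/-- A rule that proposes, for every surface code and every syndrome of its vertex operators, a
`Z` error. -/
def ZRule : Type :=
  ∀ (N : ℕ) (M : SurfaceMap (Fin N)), (M.Vertex → ZMod 2) → (M.Edge → ZMod 2)

/-- The rule `D` is computed by a program, given the embedded graph and the syndrome of a `Z`
error, in time polynomial in the number of qubits, for all graphs in the class `𝒦`. -/
def ZRule.IsEfficientOn (D : ZRule) (𝒦 : ∀ N : ℕ, Set (SurfaceMap (Fin N))) : Prop :=
  ∃ p : Prog, RunsInPolyTime
    (ι := Σ (N : ℕ) (M : SurfaceMap (Fin N)), (M.Edge → ZMod 2)) p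
    (fun i => i.2.1 ∈ 𝒦 i.1)
    (fun i => Nat.card i.2.1.Edge)
    (fun i => i.2.1.encodeSyndrome (i.2.1.zSyndrome i.2.2))
    (fun i => i.2.1.encodeError (D i.1 i.2.1 (i.2.1.zSyndrome i.2.2)))

namespace FiveSquares

variable {N : ℕ} (C : FiveSquares (Fin N))

/-- The input of the decoding algorithm, as a tree: the data of the code, the choices, and the
syndrome of the five types of stabilizers. -/
noncomputable def encodeInput (ch : C.Choices) (s : C.Check → ZMod 2) : Data :=
  Data.ofList [
    C.Γ.encode,
    Data.marks fun x => C.side (C.Γ.faceOf x) = true,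
    Data.marks fun x => C.innerGreen (C.Γ.cornerOf x) = true,
    Data.marks fun x => ch.eQubit (C.base.edgeOf (x, true)) = (x, true),
    Data.marks fun x => ch.eQubit (C.base.edgeOf (x, false)) = (x, false),
    Data.marks fun x => ch.innerQubit (C.Γ.vertexOf x) = C.Γ.halfEdgeOf x,
    Data.marks fun x => ch.vQubit (C.Γ.vertexOf x) = x,
    Data.marks fun x => ch.qubitA (C.Γ.dual.edgeOf x) = x,
    Data.marks fun x => ch.qubitB (C.Γ.dual.edgeOf x) = x,
    Data.bits fun x => s (Check.s1 (C.Γ.faceOf x)),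
    Data.bits fun x => s (Check.s2 (C.Γ.vertexOf x)),
    Data.bits fun x => s (Check.s3 (C.Γ.faceOf x)),
    Data.bits fun x => s (Check.s4 (C.Γ.vertexOf x)),
    Data.bits fun x => s (Check.s5 (C.base.edgeOf (x, true)))]

/-- The output of the decoding algorithm, as a tree. -/
noncomputable def encodeOutput (E : Pauli C.Qubit) : Data :=
  Data.ofList [
    Data.bits fun x => E.1 (Sum.inl (x, true)),
    Data.bits fun x => E.1 (Sum.inl (x, false)),
    Data.bits fun x => E.1 (Sum.inr (C.Γ.halfEdgeOf x)),
    Data.bits fun x => E.2 (Sum.inl (x, true)),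
    Data.bits fun x => E.2 (Sum.inl (x, false)),
    Data.bits fun x => E.2 (Sum.inr (C.Γ.halfEdgeOf x))]

end FiveSquares

/-- With the rules `D₁` and `D₂` for the two surface codes, the decoding algorithm is carried out by
a program, given the code, the choices and the syndrome of an error, in time polynomial in the
number of qubits, for all codes built from graphs whose duals are in the class `𝒦`. -/
def DecodesEfficientlyOn (D₁ D₂ : ZRule) (𝒦 : ∀ N : ℕ, Set (SurfaceMap (Fin N))) : Prop :=
  ∃ p : Prog, RunsInPolyTime
    (ι := Σ (N : ℕ) (C : FiveSquares (Fin N)), C.Choices × Pauli C.Qubit) p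
    (fun i => i.2.1.Γ.dual ∈ 𝒦 i.1)
    (fun i => Nat.card i.2.1.Qubit)
    (fun i => i.2.1.encodeInput i.2.2.1 (i.2.1.syndrome i.2.2.2))
    (fun i => i.2.1.encodeOutput
      (FiveSquares.decode i.2.2.1 (D₁ i.1 i.2.1.Γ.dual) (D₂ i.1 i.2.1.Γ.dual)
        (i.2.1.syndrome i.2.2.2)))

/-! ### Pauli operators -/

namespace Pauli

variable {Q : Type}

/-! Pauli operators modulo phases form a symplectic space over `ZMod 2`, in which every subgroup is
its own double centralizer (`Pauli.mem_of_comm_eq_zero`). The qubits of `Γ₂` are flags of `Γ` with a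
Boolean, so everything becomes linear equations between functions on flags. Two descriptions carry
the correctness. The gauge group is parametrized by multiplicities of link operators
(`exists_isForm`, `IsForm.mem_gauge`). Its centralizer is cut out by local equations (`IsCentral`).

S2 is a product of `X` over one unit cell, while S4 and S5 are products of `Z` over disjoint faces.
Hence each of these bits can be cleared by one Pauli at a chosen qubit, and after two loops all of
them vanish. An operator that commutes with the gauge group and with all lifts has no `X` part on
the qubits `(x, false)`, and the local equations then make it a product of S2, S4 and S5. By the
double centralizer theorem the remaining error is a lift modulo the gauge group (`exists_lift`).

On the qubits `(x, false)`, the `X` part of S1 at `f` lives on the flags of `f`, that of S3 on the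
flags across an edge from `f`. So S1 on `F_a` and S3 on `F_b` together measure the boundary in `Γ*`
of the error on the `F_a` qubits, and the other half measures the second copy (`syndrome_lift_s1`,
`syndrome_lift_s3`). The two decoders therefore leave a lift of two cycles of `Γ*`. Such a lift
commutes with all of `S`: seen from the flags of one color, the `X` part of a stabilizer on these
qubits is a coboundary on `Γ*`, which pairs to zero with cycles (`lift_mem_centralizer`). It is a
gauge element exactly when both cycles are sums of plaquettes, that is, coboundaries of functions on
the vertices of `Γ`; these functions can be read off the multiplicities in the normal form
(`lift_mem_gauge`).

For the running time, `PolyTime` is closed under composition, branching and folds. With unit cost, a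
loop whose body has a time bound depending on the size parameter alone stays polynomial, however
large the accumulator is (`PolyTime.foldl`). Vertices, edges and faces are orbits of flags and are
compared through labels obtained by merging classes (`orbitLabel`). With the S3 update written as a
sum over flags, the whole algorithm is a composition of such programs (`PolyTime.decode`). An
efficient surface code decoder is Gaussian elimination on syndromes, with the error carried along in
each row. -/

theorem X_fst [DecidableEq Q] (q r : Q) : (X q).1 r = if r = q then 1 else 0 := by
  simp only [X, Pi.single_apply]; congr

@[simp] theorem X_snd (q : Q) : (X q).2 = 0 := rfl

@[simp] theorem Z_fst (q : Q) : (Z q).1 = 0 := rfl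

theorem Z_snd [DecidableEq Q] (q r : Q) : (Z q).2 r = if r = q then 1 else 0 := by
  simp only [Z, Pi.single_apply]; congr

theorem neg_eq (p : Pauli Q) : -p = p := by
  ext q <;> simp [ZMod.neg_eq_self_mod_two]

theorem add_self (p : Pauli Q) : p + p = 0 := by
  nth_rewrite 2 [← neg_eq p]; exact add_neg_cancel p

theorem fst_sum {ι : Type*} (s : Finset ι) (f : ι → Pauli Q) (q : Q) :
    (∑ i ∈ s, f i).1 q = ∑ i ∈ s, (f i).1 q := by
  simp [Prod.fst_sum]

theorem snd_sum {ι : Type*} (s : Finset ι) (f : ι → Pauli Q) (q : Q) :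
    (∑ i ∈ s, f i).2 q = ∑ i ∈ s, (f i).2 q := by
  simp [Prod.snd_sum]

variable [Fintype Q]

theorem comm_add_right (p r s : Pauli Q) : comm p (r + s) = comm p r + comm p s := by
  simp only [comm, Prod.fst_add, Prod.snd_add, Pi.add_apply, ← Finset.sum_add_distrib]
  exact Finset.sum_congr rfl fun q _ => by ring

theorem comm_symm (p r : Pauli Q) : comm p r = comm r p :=
  Finset.sum_congr rfl fun q _ => by ring

theorem comm_add_left (p r s : Pauli Q) : comm (p + r) s = comm p s + comm r s := by
  rw [comm_symm, comm_add_right, comm_symm s p, comm_symm s r]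

@[simp] theorem comm_zero_right (p : Pauli Q) : comm p 0 = 0 := by simp [comm]

@[simp] theorem comm_zero_left (p : Pauli Q) : comm 0 p = 0 := by simp [comm]

theorem comm_smul_right (c : ZMod 2) (p r : Pauli Q) : comm p (c • r) = c * comm p r := by
  simp only [comm, Finset.mul_sum, Prod.smul_fst, Prod.smul_snd, Pi.smul_apply, smul_eq_mul]
  exact Finset.sum_congr rfl fun q _ => by ring

theorem comm_sum_right {ι : Type*} (p : Pauli Q) (s : Finset ι) (f : ι → Pauli Q) :
    comm p (∑ i ∈ s, f i) = ∑ i ∈ s, comm p (f i) := by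
  classical
  induction s using Finset.induction_on with
  | empty => simp
  | insert a s ha ih => rw [Finset.sum_insert ha, Finset.sum_insert ha, comm_add_right, ih]

@[simp] theorem comm_X (p : Pauli Q) (q : Q) : comm p (X q) = p.2 q := by
  classical
  simp [comm, X_fst]

@[simp] theorem comm_Z (p : Pauli Q) (q : Q) : comm p (Z q) = p.1 q := by
  classical
  simp [comm, Z_snd]

theorem eq_sum_X_Z (p : Pauli Q) : p = ∑ q, (p.1 q • X q + p.2 q • Z q) := by
  classical
  ext r
  · simp [fst_sum, X_fst]
  · simp [snd_sum, Z_snd]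

theorem mem_centralizer_closure {S : Set (Pauli Q)} {p : Pauli Q} (h : ∀ g ∈ S, comm g p = 0) :
    p ∈ centralizer (AddSubgroup.closure S) := by
  intro g hg
  induction hg using AddSubgroup.closure_induction with
  | mem g hg => exact h g hg
  | zero => simp
  | add a b _ _ ha hb => rw [comm_add_left, ha, hb, add_zero]
  | neg a _ ha => rw [neg_eq, ha]

/-- The double centralizer theorem. -/
theorem mem_of_comm_eq_zero {G : AddSubgroup (Pauli Q)} {p : Pauli Q}
    (h : ∀ r ∈ centralizer G, comm r p = 0) : p ∈ G := by
  by_contra hp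
  obtain ⟨f, hfp, hf⟩ := Submodule.exists_le_ker_of_notMem
    (p := AddSubgroup.toZModSubmodule 2 G) (v := p) hp
  -- The form `comm` is nondegenerate: the functional `f` that separates `p` from `G` is pairing
  -- with the operator whose components are the values of `f` at the `Z_q` and the `X_q`.
  have hfr : ∀ s : Pauli Q, comm (fun q => f (Z q), fun q => f (X q)) s = f s := by
    intro s
    conv_rhs => rw [eq_sum_X_Z s]
    simp only [comm, map_sum, map_add, map_smul, smul_eq_mul]
    exact Finset.sum_congr rfl fun q _ => by ring
  refine hfp ?_
  rw [← hfr]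
  refine h _ fun g hg => ?_
  rw [comm_symm, hfr]
  exact hf hg

end Pauli

theorem edgeOperator_fst {Q : Type} (e : ColoredEdge Q) (q : Q) [Decidable (q ∈ e.1 ∧ e.2 ≠ .blue)] :
    (edgeOperator e).1 q = if q ∈ e.1 ∧ e.2 ≠ Color.blue then 1 else 0 := by
  simp only [edgeOperator]; congr

theorem edgeOperator_snd {Q : Type} (e : ColoredEdge Q) (q : Q) [Decidable (q ∈ e.1 ∧ e.2 ≠ .red)] :
    (edgeOperator e).2 q = if q ∈ e.1 ∧ e.2 ≠ Color.red then 1 else 0 := by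
  simp only [edgeOperator]; congr

/-! ### Involutions -/

theorem Quot.mk_eq_iff_of_involutive {α : Type*} {t : α → α} (ht : ∀ x, t (t x) = x) {x y : α} :
    Quot.mk (fun x y => y = t x) x = Quot.mk (fun x y => y = t x) y ↔ y = x ∨ y = t x := by
  constructor
  · intro h
    have h2 := Quot.eqvGen_exact h
    clear h
    induction h2 with
    | rel a b h => exact Or.inr h
    | refl a => exact Or.inl rfl
    | symm a b _ ih =>
      rcases ih with h | h
      · exact Or.inl h.symm
      · exact Or.inr (by rw [h, ht])
    | trans a b c _ _ ih1 ih2 =>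
      rcases ih1 with h | h <;> rcases ih2 with h' | h' <;> subst h <;> subst h' <;>
      simp [ht]
  · rintro (h | h)
    · rw [h]
    · exact Quot.sound h

/-- Each orbit has exactly two elements; the whole value of `g` is put on one of them. This turns a
multiplicity per edge, seen as an invariant function on flags, into coefficients for which a sum
over all flags counts each edge once. -/
theorem exists_split_of_involutive {α : Type*} {t : α → α} (ht : ∀ x, t (t x) = x)
    (hne : ∀ x, t x ≠ x) {g : α → ZMod 2} (hg : ∀ x, g (t x) = g x) :
    ∃ u : α → ZMod 2, ∀ x, g x = u x + u (t x) := by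
  classical
  let m : α → Quot (fun x y : α => y = t x) := Quot.mk _
  refine ⟨fun x => if (m x).out = x then g x else 0, fun x => ?_⟩
  have h1 : m (t x) = m x := ((Quot.mk_eq_iff_of_involutive ht).2 (Or.inr rfl)).symm
  have h2 : (m x).out = x ∨ (m x).out = t x := by
    have : m x = m (m x).out := (Quot.out_eq (m x)).symm
    exact (Quot.mk_eq_iff_of_involutive ht).1 this
  simp only [h1, hg]
  rcases h2 with h | h
  · rw [if_pos h, if_neg (by rw [h]; exact (hne x).symm), add_zero]
  · rw [if_neg (by rw [h]; exact hne x), if_pos h, zero_add]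

namespace SurfaceMap

variable {Φ : Type} (M : SurfaceMap Φ)

theorem halfEdgeOf_eq {x y : Φ} : M.halfEdgeOf x = M.halfEdgeOf y ↔ y = x ∨ y = M.t2 x :=
  Quot.mk_eq_iff_of_involutive M.t2_t2

theorem edgeOf_eq {x y : Φ} : M.edgeOf x = M.edgeOf y ↔
    y = x ∨ y = M.t0 x ∨ y = M.t2 x ∨ y = M.t0 (M.t2 x) := by
  constructor
  · intro h
    have h2 := Quot.eqvGen_exact h
    clear h
    induction h2 with
    | rel a b h => tauto
    | refl a => exact Or.inl rfl
    | symm a b _ ih => rcases ih with h | h | h | h <;> subst h <;> simp [M.t0_t0, M.t2_t2, M.t0_t2]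
    | trans a b c _ _ ih1 ih2 =>
      rcases ih1 with h | h | h | h <;> subst h <;> rcases ih2 with h | h | h | h <;> subst h <;>
        simp [M.t0_t0, M.t2_t2, M.t0_t2]
  · have h0 : ∀ z, M.edgeOf (M.t0 z) = M.edgeOf z := fun z => by
      symm; apply Quot.sound; exact (Or.inl rfl)
    have h2 : ∀ z, M.edgeOf (M.t2 z) = M.edgeOf z := fun z => by
      symm; apply Quot.sound; exact (Or.inr rfl)
    rintro (h | h | h | h) <;> subst h <;> simp only [h0, h2]

@[simp] theorem edgeOf_t0 (x : Φ) : M.edgeOf (M.t0 x) = M.edgeOf x := by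
  symm; apply Quot.sound; exact (Or.inl rfl)
@[simp] theorem edgeOf_t2 (x : Φ) : M.edgeOf (M.t2 x) = M.edgeOf x := by
  symm; apply Quot.sound; exact (Or.inr rfl)
@[simp] theorem vertexOf_t1 (x : Φ) : M.vertexOf (M.t1 x) = M.vertexOf x := by
  symm; apply Quot.sound; exact (Or.inr rfl)
@[simp] theorem vertexOf_t2 (x : Φ) : M.vertexOf (M.t2 x) = M.vertexOf x := by
  symm; apply Quot.sound; exact (Or.inl rfl)
@[simp] theorem faceOf_t0 (x : Φ) : M.faceOf (M.t0 x) = M.faceOf x := by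
  symm; apply Quot.sound; exact (Or.inl rfl)
@[simp] theorem faceOf_t1 (x : Φ) : M.faceOf (M.t1 x) = M.faceOf x := by
  symm; apply Quot.sound; exact (Or.inr rfl)
@[simp] theorem halfEdgeOf_t2 (x : Φ) : M.halfEdgeOf (M.t2 x) = M.halfEdgeOf x := by
  symm; apply Quot.sound; exact rfl
@[simp] theorem cornerOf_t1 (x : Φ) : M.cornerOf (M.t1 x) = M.cornerOf x := by
  symm; apply Quot.sound; exact rfl
@[simp] theorem dual_t0 : M.dual.t0 = M.t2 := rfl
@[simp] theorem dual_t1 : M.dual.t1 = M.t1 := rfl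
@[simp] theorem dual_t2 : M.dual.t2 = M.t0 := rfl
@[simp] theorem dual_edgeOf_t0 (x : Φ) : M.dual.edgeOf (M.t0 x) = M.dual.edgeOf x :=
  M.dual.edgeOf_t2 x
@[simp] theorem dual_edgeOf_t2 (x : Φ) : M.dual.edgeOf (M.t2 x) = M.dual.edgeOf x :=
  M.dual.edgeOf_t0 x

theorem vertexOf_lift {α : Type*} {f : Φ → α} (h1 : ∀ x, f (M.t1 x) = f x)
    (h2 : ∀ x, f (M.t2 x) = f x) : ∃ F : M.Vertex → α, ∀ x, F (M.vertexOf x) = f x :=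
  ⟨Quot.lift f (by rintro x y (rfl | rfl) <;> simp [h1, h2]), fun _ => rfl⟩

theorem faceOf_lift {α : Type*} {f : Φ → α} (h0 : ∀ x, f (M.t0 x) = f x)
    (h1 : ∀ x, f (M.t1 x) = f x) : ∃ F : M.Face → α, ∀ x, F (M.faceOf x) = f x :=
  ⟨Quot.lift f (by rintro x y (rfl | rfl) <;> simp [h0, h1]), fun _ => rfl⟩

theorem edgeOf_lift {α : Type*} {f : Φ → α} (h0 : ∀ x, f (M.t0 x) = f x)
    (h2 : ∀ x, f (M.t2 x) = f x) : ∃ F : M.Edge → α, ∀ x, F (M.edgeOf x) = f x :=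
  ⟨Quot.lift f (by rintro x y (rfl | rfl) <;> simp [h0, h2]), fun _ => rfl⟩

theorem t0_ne_t2 (x : Φ) : M.t0 x ≠ M.t2 x := fun h =>
  M.t0_t2_ne (M.t2 x) (by rw [M.t2_t2, h])

end SurfaceMap

namespace FiveSquares

variable {Φ : Type} (C : FiveSquares Φ)

/-! ### The edges of the hypergraph -/

theorem base_t0 (p : Φ × Bool) : C.base.t0 p = (p.1, !p.2) := rfl
theorem base_t1_true (x : Φ) : C.base.t1 (x, true) = (C.Γ.t2 x, true) := rfl
theorem base_t1_false (x : Φ) : C.base.t1 (x, false) = (C.Γ.t0 x, false) := rfl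
theorem base_t2 (p : Φ × Bool) : C.base.t2 p = (C.Γ.t1 p.1, p.2) := rfl

theorem t1_ne_t2 (x : Φ) : C.Γ.t1 x ≠ C.Γ.t2 x := by
  intro h
  apply C.innerGreen_ne x
  rw [← h, C.Γ.cornerOf_t1]

theorem halfEdgeOf_t1_ne (x : Φ) : C.Γ.halfEdgeOf (C.Γ.t1 x) ≠ C.Γ.halfEdgeOf x := by
  intro h
  rcases C.Γ.halfEdgeOf_eq.1 h.symm with h | h
  · exact C.Γ.t1_ne x h
  · exact C.t1_ne_t2 x h

theorem mem_redEdge {p : Φ × Bool} {q : C.Qubit} :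
    q ∈ (C.redEdge p).1 ↔ q = Sum.inl p ∨ q = Sum.inl (p.1, !p.2) := by
  simp [redEdge, base_t0]

theorem mem_greenEdge {p : Φ × Bool} {q : C.Qubit} :
    q ∈ (C.greenEdge p).1 ↔ q = Sum.inl p ∨ q = Sum.inl (C.Γ.t1 p.1, p.2) := by
  simp [greenEdge, base_t2]

theorem mem_blueEdge {x : Φ} {q : C.Qubit} :
    q ∈ (C.blueEdge x).1 ↔ q = Sum.inl (x, false) ∨ q = Sum.inl (C.Γ.t0 x, false) := by
  simp [blueEdge, base_t1_false]

theorem mem_tripleEdge {x : Φ} {q : C.Qubit} :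
    q ∈ (C.tripleEdge x).1 ↔
      q = Sum.inl (x, true) ∨ q = Sum.inl (C.Γ.t2 x, true) ∨ q = Sum.inr (C.Γ.halfEdgeOf x) := by
  simp [tripleEdge, base_t1_true]

theorem mem_innerEdge {x : Φ} {q : C.Qubit} :
    q ∈ (C.innerEdge x).1 ↔
      q = Sum.inr (C.Γ.halfEdgeOf x) ∨ q = Sum.inr (C.Γ.halfEdgeOf (C.Γ.t1 x)) := by
  simp [innerEdge]

theorem redEdge_eq {p q : Φ × Bool} :
    C.redEdge p = C.redEdge q ↔ q = p ∨ q = (p.1, !p.2) := by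
  constructor
  · intro h
    have h1 : Sum.inl q ∈ (C.redEdge p).1 := by rw [h, mem_redEdge]; simp
    simpa [mem_redEdge] using h1
  · rintro (rfl | rfl)
    · rfl
    · refine Prod.ext (Finset.ext fun r => ?_) rfl
      simp [mem_redEdge, or_comm]

theorem greenEdge_eq {p q : Φ × Bool} :
    C.greenEdge p = C.greenEdge q ↔ q = p ∨ q = (C.Γ.t1 p.1, p.2) := by
  constructor
  · intro h
    have h1 : Sum.inl q ∈ (C.greenEdge p).1 := by rw [h, mem_greenEdge]; simp
    simpa [mem_greenEdge] using h1
  · rintro (rfl | rfl)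
    · rfl
    · refine Prod.ext (Finset.ext fun r => ?_) rfl
      simp [mem_greenEdge, or_comm, C.Γ.t1_t1]

theorem blueEdge_eq {x y : Φ} :
    C.blueEdge x = C.blueEdge y ↔ y = x ∨ y = C.Γ.t0 x := by
  constructor
  · intro h
    have h1 : Sum.inl (y, false) ∈ (C.blueEdge x).1 := by rw [h, mem_blueEdge]; simp
    simpa [mem_blueEdge] using h1
  · rintro (rfl | rfl)
    · rfl
    · refine Prod.ext (Finset.ext fun r => ?_) rfl
      simp [mem_blueEdge, or_comm, C.Γ.t0_t0]

theorem tripleEdge_eq {x y : Φ} :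
    C.tripleEdge x = C.tripleEdge y ↔ y = x ∨ y = C.Γ.t2 x := by
  constructor
  · intro h
    have h1 : Sum.inl (y, true) ∈ (C.tripleEdge x).1 := by rw [h, mem_tripleEdge]; simp
    simpa [mem_tripleEdge] using h1
  · rintro (rfl | rfl)
    · rfl
    · refine Prod.ext (Finset.ext fun r => ?_) rfl
      simp only [mem_tripleEdge, C.Γ.t2_t2, C.Γ.halfEdgeOf_t2]
      tauto

/-- The endpoints alone would also allow `y = t2 x` and `y = t2 (t1 x)`. These flags lie at the
neighboring corners, whose inner edges have the other color. -/
theorem innerEdge_eq {x y : Φ} :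
    C.innerEdge x = C.innerEdge y ↔ y = x ∨ y = C.Γ.t1 x := by
  constructor
  · intro h
    have h1 : Sum.inr (C.Γ.halfEdgeOf y) ∈ (C.innerEdge x).1 := by rw [h, mem_innerEdge]; simp
    have h2 : C.innerGreen (C.Γ.cornerOf x) = C.innerGreen (C.Γ.cornerOf y) := by
      have := congrArg Prod.snd h
      simp only [innerEdge] at this
      cases hx : C.innerGreen (C.Γ.cornerOf x) <;> cases hy : C.innerGreen (C.Γ.cornerOf y) <;>
        simp [hx, hy] at this ⊢
    have h3 := C.innerGreen_ne x
    have h4 := C.innerGreen_ne (C.Γ.t1 x)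
    rw [C.Γ.cornerOf_t1] at h4
    simp only [mem_innerEdge, Sum.inr.injEq] at h1
    rcases h1 with h1 | h1 <;> rcases C.Γ.halfEdgeOf_eq.1 h1.symm with h1 | h1 <;> subst h1 <;>
      simp_all
  · rintro (rfl | rfl)
    · rfl
    · refine Prod.ext (Finset.ext fun r => ?_) ?_
      · simp [mem_innerEdge, or_comm, C.Γ.t1_t1]
      · simp [innerEdge]

theorem card_two_of_mem {Q : Type} {s : Finset Q} {u v : Q} (huv : u ≠ v)
    (h : ∀ q, q ∈ s ↔ q = u ∨ q = v) : s.card = 2 := by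
  classical
  rw [show s = {u, v} from Finset.ext fun q => by simp [h], Finset.card_pair huv]

theorem redEdge_card (p : Φ × Bool) : (C.redEdge p).1.card = 2 :=
  card_two_of_mem (by rcases p with ⟨x, _ | _⟩ <;> simp) fun _ => C.mem_redEdge

theorem greenEdge_card (p : Φ × Bool) : (C.greenEdge p).1.card = 2 :=
  card_two_of_mem (by
    intro h
    exact C.Γ.t1_ne p.1 (congrArg Prod.fst (Sum.inl.inj h)).symm) fun _ => C.mem_greenEdge

theorem blueEdge_card (x : Φ) : (C.blueEdge x).1.card = 2 :=
  card_two_of_mem (by simpa using (C.Γ.t0_ne x).symm) fun _ => C.mem_blueEdge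

theorem innerEdge_card (x : Φ) : (C.innerEdge x).1.card = 2 :=
  card_two_of_mem (by simpa using (C.halfEdgeOf_t1_ne x).symm) fun _ => C.mem_innerEdge

theorem tripleEdge_card (x : Φ) : (C.tripleEdge x).1.card = 3 := by
  classical
  have h : (C.tripleEdge x).1 = {Sum.inl (x, true), Sum.inl (C.Γ.t2 x, true),
      Sum.inr (C.Γ.halfEdgeOf x)} := Finset.ext fun q => by simp [mem_tripleEdge]
  rw [h]
  apply Finset.card_eq_three.2 ⟨_, _, _, _, _, _, rfl⟩ <;> simp [(C.Γ.t2_ne x).symm]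

/-! ### Generators of the gauge group -/

/-- The edge operator of the edge of an inner face at the corner of `x`. -/
noncomputable def innerOperator (x : Φ) : Pauli C.Qubit := edgeOperator (C.innerEdge x)

open Classical in
theorem edgeOperator_pair {Q : Type} {e : ColoredEdge Q} {u v : Q} (huv : u ≠ v)
    (h : ∀ q, q ∈ e.1 ↔ q = u ∨ q = v) :
    edgeOperator e = ((if e.2 ≠ Color.blue then 1 else 0 : ZMod 2) • (Pauli.X u + Pauli.X v)) +
      ((if e.2 ≠ Color.red then 1 else 0 : ZMod 2) • (Pauli.Z u + Pauli.Z v)) := by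
  have key : ∀ q, ((if q = u then 1 else 0 : ZMod 2) + if q = v then 1 else 0) =
      if q ∈ e.1 then 1 else 0 := by
    intro q
    by_cases h1 : q = u
    · subst h1; simp [h, huv]
    · simp [h, h1]
  refine Prod.ext (funext fun q => ?_) (funext fun q => ?_)
  · rw [edgeOperator_fst]
    cases h1 : e.2 <;> simp [Pauli.X_fst, key]
  · rw [edgeOperator_snd]
    cases h1 : e.2 <;> simp [Pauli.Z_snd, key]

theorem edgeOperator_redEdge (p : Φ × Bool) : edgeOperator (C.redEdge p) =
    Pauli.X (Sum.inl p) + Pauli.X (Sum.inl (p.1, !p.2)) := by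
  rw [edgeOperator_pair (by rcases p with ⟨x, _ | _⟩ <;> simp) fun _ => C.mem_redEdge]
  simp [redEdge]

theorem edgeOperator_greenEdge (p : Φ × Bool) : edgeOperator (C.greenEdge p) =
    (Pauli.X (Sum.inl p) + Pauli.X (Sum.inl (C.Γ.t1 p.1, p.2))) +
    (Pauli.Z (Sum.inl p) + Pauli.Z (Sum.inl (C.Γ.t1 p.1, p.2))) := by
  rw [edgeOperator_pair (by
    intro h
    exact C.Γ.t1_ne p.1 (congrArg Prod.fst (Sum.inl.inj h)).symm) fun _ => C.mem_greenEdge]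
  simp [greenEdge]

theorem edgeOperator_blueEdge (x : Φ) : edgeOperator (C.blueEdge x) =
    Pauli.Z (Sum.inl (x, false)) + Pauli.Z (Sum.inl (C.Γ.t0 x, false)) := by
  rw [edgeOperator_pair (by simpa using (C.Γ.t0_ne x).symm) fun _ => C.mem_blueEdge]
  simp [blueEdge]

theorem innerOperator_eq (x : Φ) : C.innerOperator x =
    (Pauli.X (Sum.inr (C.Γ.halfEdgeOf x)) + Pauli.X (Sum.inr (C.Γ.halfEdgeOf (C.Γ.t1 x)))) +
    (if C.innerGreen (C.Γ.cornerOf x) = true then 1 else 0 : ZMod 2) •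
    (Pauli.Z (Sum.inr (C.Γ.halfEdgeOf x)) + Pauli.Z (Sum.inr (C.Γ.halfEdgeOf (C.Γ.t1 x)))) := by
  rw [innerOperator, edgeOperator_pair (by simpa using (C.halfEdgeOf_t1_ne x).symm)
    fun _ => C.mem_innerEdge]
  by_cases h : C.innerGreen (C.Γ.cornerOf x) = true <;> simp [innerEdge, h]

/-- A set of generators of the gauge group. -/
inductive IsGenerator : Pauli C.Qubit → Prop
  | red (x : Φ) : IsGenerator (Pauli.X (Sum.inl (x, true)) + Pauli.X (Sum.inl (x, false)))
  | green (p : Φ × Bool) : IsGenerator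
      ((Pauli.X (Sum.inl p) + Pauli.X (Sum.inl (C.Γ.t1 p.1, p.2))) +
      (Pauli.Z (Sum.inl p) + Pauli.Z (Sum.inl (C.Γ.t1 p.1, p.2))))
  | blue (x : Φ) : IsGenerator
      (Pauli.Z (Sum.inl (x, false)) + Pauli.Z (Sum.inl (C.Γ.t0 x, false)))
  | outer (x : Φ) : IsGenerator
      (Pauli.Z (Sum.inl (x, true)) + Pauli.Z (Sum.inl (C.Γ.t2 x, true)))
  | spoke (x : Φ) : IsGenerator
      (Pauli.Z (Sum.inl (x, true)) + Pauli.Z (Sum.inr (C.Γ.halfEdgeOf x)))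
  | inner (x : Φ) : IsGenerator (C.innerOperator x)

theorem redEdge_mem (p : Φ × Bool) : C.redEdge p ∈ C.edges :=
  Or.inl (Or.inl (Or.inl (Or.inl ⟨p, rfl⟩)))
theorem greenEdge_mem (p : Φ × Bool) : C.greenEdge p ∈ C.edges :=
  Or.inl (Or.inl (Or.inl (Or.inr ⟨p, rfl⟩)))
theorem blueEdge_mem (x : Φ) : C.blueEdge x ∈ C.edges := Or.inl (Or.inl (Or.inr ⟨x, rfl⟩))
theorem tripleEdge_mem (x : Φ) : C.tripleEdge x ∈ C.edges := Or.inl (Or.inr ⟨x, rfl⟩)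
theorem innerEdge_mem (x : Φ) : C.innerEdge x ∈ C.edges := Or.inr ⟨x, rfl⟩

theorem gauge_eq : C.gauge = AddSubgroup.closure {p | C.IsGenerator p} := by
  apply le_antisymm
  · rw [gauge, gaugeGroup, AddSubgroup.closure_le]
    have hg : ∀ {p}, C.IsGenerator p → p ∈ AddSubgroup.closure {p | C.IsGenerator p} :=
      fun h => AddSubgroup.subset_closure h
    rintro p (⟨e, he, hc, rfl⟩ | ⟨e, he, hc, u, hu, v, hv, huv, rfl⟩)
    · rcases he with (((⟨⟨x, b⟩, rfl⟩ | ⟨p, rfl⟩) | ⟨x, rfl⟩) | ⟨x, rfl⟩) | ⟨x, rfl⟩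
      · rw [edgeOperator_redEdge]
        cases b
        · rw [add_comm]; exact hg (.red x)
        · exact hg (.red x)
      · rw [edgeOperator_greenEdge]; exact hg (.green p)
      · rw [edgeOperator_blueEdge]; exact hg (.blue x)
      · rw [tripleEdge_card] at hc; omega
      · exact hg (.inner x)
    · rcases he with (((⟨p, rfl⟩ | ⟨p, rfl⟩) | ⟨x, rfl⟩) | ⟨x, rfl⟩) | ⟨x, rfl⟩
      · rw [redEdge_card] at hc; omega
      · rw [greenEdge_card] at hc; omega
      · rw [blueEdge_card] at hc; omega
      -- The pairs that contain the qubit `(x, true)` generate all pairs of the rank-3 edge, because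
      -- `Z` at `(x, true)` cancels in a product of two of them.
      · have key : ∀ q ∈ (C.tripleEdge x).1, Pauli.Z (Sum.inl (x, true)) + Pauli.Z q ∈
            AddSubgroup.closure {p | C.IsGenerator p} := by
          intro q hq
          rcases C.mem_tripleEdge.1 hq with rfl | rfl | rfl
          · rw [Pauli.add_self]; exact zero_mem _
          · exact hg (.outer x)
          · exact hg (.spoke x)
        have h := add_mem (key u hu) (key v hv)
        rwa [add_add_add_comm, Pauli.add_self, zero_add] at h
      · rw [innerEdge_card] at hc; omega
  · rw [AddSubgroup.closure_le]
    have h2 : ∀ e ∈ C.edges, e.1.card = 2 → edgeOperator e ∈ C.gauge := fun e he hc =>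
      AddSubgroup.subset_closure (Or.inl ⟨e, he, hc, rfl⟩)
    have h3 : ∀ x, ∀ u ∈ (C.tripleEdge x).1, ∀ v ∈ (C.tripleEdge x).1, u ≠ v →
        Pauli.Z u + Pauli.Z v ∈ C.gauge := fun x u hu v hv huv =>
      AddSubgroup.subset_closure
        (Or.inr ⟨_, C.tripleEdge_mem x, C.tripleEdge_card x, u, hu, v, hv, huv, rfl⟩)
    rintro p (x | p | x | x | x | x)
    · have := h2 _ (C.redEdge_mem (x, true)) (C.redEdge_card _)
      rwa [edgeOperator_redEdge] at this
    · have := h2 _ (C.greenEdge_mem p) (C.greenEdge_card _)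
      rwa [edgeOperator_greenEdge] at this
    · have := h2 _ (C.blueEdge_mem x) (C.blueEdge_card _)
      rwa [edgeOperator_blueEdge] at this
    · exact h3 x _ (C.mem_tripleEdge.2 (by simp)) _ (C.mem_tripleEdge.2 (by simp))
        (by simpa using (C.Γ.t2_ne x).symm)
    · exact h3 x _ (C.mem_tripleEdge.2 (by simp)) _ (C.mem_tripleEdge.2 (by simp)) (by simp)
    · exact h2 _ (C.innerEdge_mem x) (C.innerEdge_card _)

end FiveSquares

theorem ZMod.two_add_self (a : ZMod 2) : a + a = 0 := CharTwo.add_self_eq_zero a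

theorem ZMod.two_eq_iff_add_eq_zero {a b : ZMod 2} : a = b ↔ a + b = 0 := by
  rw [CharTwo.add_eq_zero]

namespace FiveSquares

variable {Φ : Type} (C : FiveSquares Φ)

/-! ### Normal form of the elements of the gauge group -/

/-- The Pauli operator `p` is the product of the link operators with multiplicities `r` (red edges),
`gT` and `gF` (green edges), `b` (blue edges), `k` (spokes of rank-3 edges) and `i` (inner edges),
up to redundancy. -/
structure IsForm (p : Pauli C.Qubit) (r gT gF b k i : Φ → ZMod 2) : Prop where
  gT_t1 : ∀ x, gT (C.Γ.t1 x) = gT x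
  gF_t1 : ∀ x, gF (C.Γ.t1 x) = gF x
  b_t0 : ∀ x, b (C.Γ.t0 x) = b x
  i_t1 : ∀ x, i (C.Γ.t1 x) = i x
  fst_true : ∀ x, p.1 (Sum.inl (x, true)) = r x + gT x
  fst_false : ∀ x, p.1 (Sum.inl (x, false)) = r x + gF x
  fst_inr : ∀ x, p.1 (Sum.inr (C.Γ.halfEdgeOf x)) = i x + i (C.Γ.t2 x)
  snd_true : ∀ x, p.2 (Sum.inl (x, true)) = gT x + k x
  snd_false : ∀ x, p.2 (Sum.inl (x, false)) = gF x + b x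
  snd_inr : ∀ x, p.2 (Sum.inr (C.Γ.halfEdgeOf x)) = k x + k (C.Γ.t2 x) +
    if C.innerGreen (C.Γ.cornerOf x) = true then i x else i (C.Γ.t2 x)

variable {C}

theorem IsForm.add {p p' : Pauli C.Qubit} {r gT gF b k i r' gT' gF' b' k' i' : Φ → ZMod 2}
    (h : C.IsForm p r gT gF b k i) (h' : C.IsForm p' r' gT' gF' b' k' i') :
    C.IsForm (p + p') (r + r') (gT + gT') (gF + gF') (b + b') (k + k') (i + i') where
  gT_t1 x := by simp [h.gT_t1, h'.gT_t1]
  gF_t1 x := by simp [h.gF_t1, h'.gF_t1]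
  b_t0 x := by simp [h.b_t0, h'.b_t0]
  i_t1 x := by simp [h.i_t1, h'.i_t1]
  fst_true x := by simp [h.fst_true, h'.fst_true]; ring
  fst_false x := by simp [h.fst_false, h'.fst_false]; ring
  fst_inr x := by simp [h.fst_inr, h'.fst_inr]; ring
  snd_true x := by simp [h.snd_true, h'.snd_true]; ring
  snd_false x := by simp [h.snd_false, h'.snd_false]; ring
  snd_inr x := by simp [h.snd_inr, h'.snd_inr]; split_ifs <;> ring

variable (C)

open Classical in
theorem ite_halfEdgeOf_eq (x y : Φ) :
    (if C.Γ.halfEdgeOf x = C.Γ.halfEdgeOf y then 1 else 0 : ZMod 2) =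
      (if x = y then 1 else 0) + if C.Γ.t2 x = y then 1 else 0 := by
  by_cases h1 : x = y
  · subst h1; simp [C.Γ.t2_ne]
  · by_cases h2 : C.Γ.t2 x = y
    · subst h2; simp [h1]
    · rw [if_neg h1, if_neg h2, if_neg, add_zero]
      rw [C.Γ.halfEdgeOf_eq]
      exact fun h => h.elim (fun h => h1 h.symm) (fun h => h2 h.symm)

open Classical in
theorem innerOperator_fst (x : Φ) (q : C.Qubit) : (C.innerOperator x).1 q =
    (if q = Sum.inr (C.Γ.halfEdgeOf x) then 1 else 0) +
      if q = Sum.inr (C.Γ.halfEdgeOf (C.Γ.t1 x)) then 1 else 0 := by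
  rw [innerOperator_eq]
  simp only [Prod.fst_add, Prod.smul_fst, Pauli.Z_fst, Pi.add_apply, Pi.zero_apply,
    add_zero, smul_zero, Pauli.X_fst]

open Classical in
theorem innerOperator_snd (x : Φ) (q : C.Qubit) : (C.innerOperator x).2 q =
    (if C.innerGreen (C.Γ.cornerOf x) = true then 1 else 0) *
    ((if q = Sum.inr (C.Γ.halfEdgeOf x) then 1 else 0) +
      if q = Sum.inr (C.Γ.halfEdgeOf (C.Γ.t1 x)) then 1 else 0) := by
  rw [innerOperator_eq]
  simp only [Prod.snd_add, Prod.smul_snd, Pauli.X_snd, Pi.add_apply, Pi.smul_apply, Pi.zero_apply,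
    zero_add, Pauli.Z_snd, smul_eq_mul]

theorem IsGenerator.isForm {p : Pauli C.Qubit} (hp : C.IsGenerator p) :
    ∃ r gT gF b k i, C.IsForm p r gT gF b k i := by
  classical
  have t0 : ∀ x y, C.Γ.t0 x = y ↔ x = C.Γ.t0 y := fun x y =>
    ⟨fun h => by rw [← h, C.Γ.t0_t0], fun h => by rw [h, C.Γ.t0_t0]⟩
  have t1 : ∀ x y, C.Γ.t1 x = y ↔ x = C.Γ.t1 y := fun x y =>
    ⟨fun h => by rw [← h, C.Γ.t1_t1], fun h => by rw [h, C.Γ.t1_t1]⟩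
  have t2 : ∀ x y, C.Γ.t2 x = y ↔ x = C.Γ.t2 y := fun x y =>
    ⟨fun h => by rw [← h, C.Γ.t2_t2], fun h => by rw [h, C.Γ.t2_t2]⟩
  rcases hp with y | ⟨y, b⟩ | y | y | y | y
  · refine ⟨fun x => if x = y then 1 else 0, 0, 0, 0, 0, 0, ?_, ?_, ?_, ?_, ?_, ?_, ?_, ?_, ?_, ?_⟩
      <;> intro x <;> simp [Pauli.X_fst]
  · cases b
    · refine ⟨0, 0, fun x => (if x = y then 1 else 0) + if x = C.Γ.t1 y then 1 else 0, 0, 0, 0,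
        ?_, ?_, ?_, ?_, ?_, ?_, ?_, ?_, ?_, ?_⟩
        <;> intro x <;> simp [Pauli.X_fst, Pauli.Z_snd, t1, C.Γ.t1_t1, add_comm]
    · refine ⟨0, fun x => (if x = y then 1 else 0) + if x = C.Γ.t1 y then 1 else 0, 0, 0, 0, 0,
        ?_, ?_, ?_, ?_, ?_, ?_, ?_, ?_, ?_, ?_⟩
        <;> intro x <;> simp [Pauli.X_fst, Pauli.Z_snd, t1, C.Γ.t1_t1, add_comm]
  · refine ⟨0, 0, 0, fun x => (if x = y then 1 else 0) + if x = C.Γ.t0 y then 1 else 0, 0, 0,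
        ?_, ?_, ?_, ?_, ?_, ?_, ?_, ?_, ?_, ?_⟩
        <;> intro x <;> simp [Pauli.Z_snd, t0, C.Γ.t0_t0, add_comm]
  -- The spokes at `y` and `t2 y` share their inner qubit, so their product is the outer pair; no
  -- separate multiplicity for outer pairs is needed.
  · refine ⟨0, 0, 0, 0, fun x => (if x = y then 1 else 0) + if x = C.Γ.t2 y then 1 else 0, 0,
        ?_, ?_, ?_, ?_, ?_, ?_, ?_, ?_, ?_, ?_⟩
        <;> intro x <;> simp [Pauli.Z_snd, t2, C.Γ.t2_t2]
    rw [add_comm (if x = C.Γ.t2 y then (1 : ZMod 2) else 0), ZMod.two_add_self]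
  · refine ⟨0, 0, 0, 0, fun x => (if x = y then 1 else 0), 0,
        ?_, ?_, ?_, ?_, ?_, ?_, ?_, ?_, ?_, ?_⟩
        <;> intro x <;> simp [Pauli.Z_snd, ite_halfEdgeOf_eq]
  · refine ⟨0, 0, 0, 0, 0, fun x => (if x = y then 1 else 0) + if x = C.Γ.t1 y then 1 else 0,
        ?_, ?_, ?_, ?_, ?_, ?_, ?_, ?_, ?_, ?_⟩
        <;> intro x <;> try simp [innerOperator_fst, innerOperator_snd]
    · simp [t1, C.Γ.t1_t1, add_comm]
    · rw [ite_halfEdgeOf_eq, ite_halfEdgeOf_eq]; ring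
    -- Of the two inner edges at an inner qubit only the green one has a `Z` part. Flags whose
    -- corners differ in color are distinct, which kills the terms of the wrong color.
    · have key : ∀ z w, C.innerGreen (C.Γ.cornerOf z) ≠ C.innerGreen (C.Γ.cornerOf w) → z ≠ w :=
        fun z w h e => h (by rw [e])
      have h2 := C.innerGreen_ne x
      have hy := C.Γ.cornerOf_t1 y
      by_cases hx : C.innerGreen (C.Γ.cornerOf x) = true <;>
        by_cases hy' : C.innerGreen (C.Γ.cornerOf y) = true <;>
        simp only [ite_halfEdgeOf_eq, hx, hy', if_true, if_false,
          Bool.false_eq_true]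
      · rw [if_neg (key (C.Γ.t2 x) y (by simp_all)),
          if_neg (key (C.Γ.t2 x) (C.Γ.t1 y) (by simp_all))]; simp
      · rw [if_neg (key x y (by simp_all)), if_neg (key x (C.Γ.t1 y) (by simp_all))]; simp
      · rw [if_neg (key x y (by simp_all)), if_neg (key x (C.Γ.t1 y) (by simp_all))]; simp
      · rw [if_neg (key (C.Γ.t2 x) y (by simp_all)),
          if_neg (key (C.Γ.t2 x) (C.Γ.t1 y) (by simp_all))]; simp

theorem exists_isForm {p : Pauli C.Qubit} (hp : p ∈ C.gauge) :
    ∃ r gT gF b k i, C.IsForm p r gT gF b k i := by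
  rw [gauge_eq] at hp
  induction hp using AddSubgroup.closure_induction with
  | mem p hp => exact IsGenerator.isForm C hp
  | zero =>
    refine ⟨0, 0, 0, 0, 0, 0, ?_, ?_, ?_, ?_, ?_, ?_, ?_, ?_, ?_, ?_⟩ <;> simp
  | add p q _ _ hp hq =>
    obtain ⟨_, _, _, _, _, _, h⟩ := hp
    obtain ⟨_, _, _, _, _, _, h'⟩ := hq
    exact ⟨_, _, _, _, _, _, h.add h'⟩
  | neg p _ hp => rwa [Pauli.neg_eq]

variable {C}

/-- The multiplicities are spread over flags by `exists_split_of_involutive`; the resulting sum of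
generators agrees with `p` at every qubit. -/
theorem IsForm.mem_gauge [Fintype Φ] {p : Pauli C.Qubit} {r gT gF b k i : Φ → ZMod 2}
    (h : C.IsForm p r gT gF b k i) : p ∈ C.gauge := by
  classical
  obtain ⟨uT, huT⟩ := exists_split_of_involutive C.Γ.t1_t1 C.Γ.t1_ne h.gT_t1
  obtain ⟨uF, huF⟩ := exists_split_of_involutive C.Γ.t1_t1 C.Γ.t1_ne h.gF_t1
  obtain ⟨ub, hub⟩ := exists_split_of_involutive C.Γ.t0_t0 C.Γ.t0_ne h.b_t0
  obtain ⟨ui, hui⟩ := exists_split_of_involutive C.Γ.t1_t1 C.Γ.t1_ne h.i_t1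
  have t0 : ∀ x y, x = C.Γ.t0 y ↔ C.Γ.t0 x = y := fun x y =>
    ⟨fun h => by rw [h, C.Γ.t0_t0], fun h => by rw [← h, C.Γ.t0_t0]⟩
  have t1 : ∀ x y, x = C.Γ.t1 y ↔ C.Γ.t1 x = y := fun x y =>
    ⟨fun h => by rw [h, C.Γ.t1_t1], fun h => by rw [← h, C.Γ.t1_t1]⟩
  have t2 : ∀ x y, x = C.Γ.t2 y ↔ C.Γ.t2 x = y := fun x y =>
    ⟨fun h => by rw [h, C.Γ.t2_t2], fun h => by rw [← h, C.Γ.t2_t2]⟩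
  have hg : ∀ (c : ZMod 2) {q}, C.IsGenerator q → c • q ∈ C.gauge := by
    intro c q hq
    have hc : c = 0 ∨ c = 1 := by revert c; decide
    rw [gauge_eq]
    rcases hc with rfl | rfl
    · rw [zero_smul]; exact zero_mem _
    · rw [one_smul]; exact AddSubgroup.subset_closure hq
  have key : p = ∑ x, (r x • (Pauli.X (Sum.inl (x, true)) + Pauli.X (Sum.inl (x, false))) +
      uT x • ((Pauli.X (Sum.inl (x, true)) + Pauli.X (Sum.inl (C.Γ.t1 x, true))) +
        (Pauli.Z (Sum.inl (x, true)) + Pauli.Z (Sum.inl (C.Γ.t1 x, true)))) +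
      uF x • ((Pauli.X (Sum.inl (x, false)) + Pauli.X (Sum.inl (C.Γ.t1 x, false))) +
        (Pauli.Z (Sum.inl (x, false)) + Pauli.Z (Sum.inl (C.Γ.t1 x, false)))) +
      ub x • (Pauli.Z (Sum.inl (x, false)) + Pauli.Z (Sum.inl (C.Γ.t0 x, false))) +
      k x • (Pauli.Z (Sum.inl (x, true)) + Pauli.Z (Sum.inr (C.Γ.halfEdgeOf x))) +
      ui x • C.innerOperator x) := by
    refine Prod.ext (funext fun q => ?_) (funext fun q => ?_)
    · rw [Pauli.fst_sum]
      rcases q with ⟨y, b⟩ | q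
      · cases b
        · simp [h.fst_false, huF, innerOperator_fst, Pauli.X_fst, Finset.sum_add_distrib,
            t1]
        · simp [h.fst_true, huT, innerOperator_fst, Pauli.X_fst, Finset.sum_add_distrib,
            t1]
      · obtain ⟨y, rfl⟩ : ∃ y, C.Γ.halfEdgeOf y = q := Quot.exists_rep q
        simp [h.fst_inr, hui, innerOperator_fst, Pauli.X_fst, Finset.sum_add_distrib, mul_add,
            t1, ite_halfEdgeOf_eq]
        ring
    · rw [Pauli.snd_sum]
      rcases q with ⟨y, b⟩ | q
      · cases b
        · simp [h.snd_false, huF, hub, innerOperator_snd, Pauli.Z_snd, Finset.sum_add_distrib,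
            t1, t0]
        · simp [h.snd_true, huT, innerOperator_snd, Pauli.Z_snd, Finset.sum_add_distrib,
            t1]
      · obtain ⟨y, rfl⟩ : ∃ y, C.Γ.halfEdgeOf y = q := Quot.exists_rep q
        have h2 := C.innerGreen_ne y
        simp only [h.snd_inr, hui, innerOperator_snd, Pauli.Z_snd, Finset.sum_add_distrib, mul_add,
            t1, ite_halfEdgeOf_eq, Prod.snd_add, Prod.smul_snd, Pauli.X_snd, Pi.add_apply,
            Pi.smul_apply, smul_eq_mul, smul_zero, reduceCtorEq, if_false, Sum.inr.injEq, mul_zero,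
            mul_ite, mul_one, Finset.sum_ite_eq, Finset.mem_univ, if_true,
            add_zero, zero_add, C.Γ.cornerOf_t1]
        cases hy : C.innerGreen (C.Γ.cornerOf y) <;> rw [hy] at h2 <;> simp at h2 <;> simp [h2]
  rw [key]
  refine sum_mem fun x _ => ?_
  exact add_mem (add_mem (add_mem (add_mem (add_mem (hg _ (.red x)) (hg _ (.green (x, true))))
    (hg _ (.green (x, false)))) (hg _ (.blue x))) (hg _ (.spoke x))) (hg _ (.inner x))

/-! ### The centralizer of the gauge group -/

/-- The conditions for a Pauli operator to commute with the gauge group. -/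
structure IsCentral (p : Pauli C.Qubit) : Prop where
  red : ∀ x, p.2 (Sum.inl (x, true)) = p.2 (Sum.inl (x, false))
  green : ∀ x b, p.1 (Sum.inl (C.Γ.t1 x, b)) + p.2 (Sum.inl (C.Γ.t1 x, b)) =
    p.1 (Sum.inl (x, b)) + p.2 (Sum.inl (x, b))
  blue : ∀ x, p.1 (Sum.inl (C.Γ.t0 x, false)) = p.1 (Sum.inl (x, false))
  spoke : ∀ x, p.1 (Sum.inr (C.Γ.halfEdgeOf x)) = p.1 (Sum.inl (x, true))
  innerRed : ∀ x, C.innerGreen (C.Γ.cornerOf x) = false →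
    p.2 (Sum.inr (C.Γ.halfEdgeOf (C.Γ.t1 x))) = p.2 (Sum.inr (C.Γ.halfEdgeOf x))
  innerGreen : ∀ x, C.innerGreen (C.Γ.cornerOf x) = true →
    p.1 (Sum.inr (C.Γ.halfEdgeOf (C.Γ.t1 x))) + p.2 (Sum.inr (C.Γ.halfEdgeOf (C.Γ.t1 x))) =
      p.1 (Sum.inr (C.Γ.halfEdgeOf x)) + p.2 (Sum.inr (C.Γ.halfEdgeOf x))

theorem IsCentral.outer {p : Pauli C.Qubit} (h : IsCentral p) (x : Φ) :
    p.1 (Sum.inl (C.Γ.t2 x, true)) = p.1 (Sum.inl (x, true)) := by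
  rw [← h.spoke, ← h.spoke, C.Γ.halfEdgeOf_t2]

variable [Fintype Φ]

/-- By bilinearity only the generators matter, and pairing with `X_q` or `Z_q` reads off the other
component at `q`. The outer pairs give nothing new, since two flags of a half-edge share the inner
qubit of their spokes. -/
theorem mem_centralizer_gauge {p : Pauli C.Qubit} :
    p ∈ Pauli.centralizer C.gauge ↔ IsCentral p := by
  constructor
  · intro h
    have hg : ∀ {q}, C.IsGenerator q → Pauli.comm p q = 0 := fun {q} hq => by
      rw [Pauli.comm_symm]
      refine h q ?_
      rw [gauge_eq]; exact AddSubgroup.subset_closure hq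
    constructor
    · intro x
      simpa [Pauli.comm_add_right, CharTwo.add_eq_zero] using hg (.red x)
    · intro x b
      have := hg (.green (x, b))
      simp only [Pauli.comm_add_right, Pauli.comm_X, Pauli.comm_Z] at this
      rw [ZMod.two_eq_iff_add_eq_zero, ← this]; ring
    · intro x
      have := hg (.blue x)
      simp only [Pauli.comm_add_right, Pauli.comm_Z] at this
      rw [ZMod.two_eq_iff_add_eq_zero, ← this]; ring
    · intro x
      have := hg (.spoke x)
      simp only [Pauli.comm_add_right, Pauli.comm_Z] at this
      rw [ZMod.two_eq_iff_add_eq_zero, ← this]; ring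
    · intro x hx
      have := hg (.inner x)
      simp only [innerOperator_eq, hx, Pauli.comm_add_right, Pauli.comm_X, Pauli.comm_Z,
        Pauli.comm_smul_right] at this
      rw [ZMod.two_eq_iff_add_eq_zero, ← this]; simp; ring
    · intro x hx
      have := hg (.inner x)
      simp only [innerOperator_eq, hx, Pauli.comm_add_right, Pauli.comm_X, Pauli.comm_Z,
        Pauli.comm_smul_right] at this
      rw [ZMod.two_eq_iff_add_eq_zero, ← this]; simp; ring
  · intro h
    rw [gauge_eq]
    refine Pauli.mem_centralizer_closure ?_
    rintro q (x | ⟨x, b⟩ | x | x | x | x) <;> rw [Pauli.comm_symm]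
    · simp [Pauli.comm_add_right, h.red, ZMod.two_add_self]
    · simp only [Pauli.comm_add_right, Pauli.comm_X, Pauli.comm_Z]
      have := ZMod.two_eq_iff_add_eq_zero.1 (h.green x b)
      rw [← this]; ring
    · simp [Pauli.comm_add_right, h.blue, ZMod.two_add_self]
    · simp [Pauli.comm_add_right, h.outer, ZMod.two_add_self]
    · simp [Pauli.comm_add_right, h.spoke, ZMod.two_add_self]
    · rw [innerOperator_eq]
      cases hx : C.innerGreen (C.Γ.cornerOf x)
      · simp [Pauli.comm_add_right, h.innerRed x hx, ZMod.two_add_self]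
      · simp only [Pauli.comm_add_right, Pauli.comm_smul_right, Pauli.comm_X, Pauli.comm_Z]
        have := ZMod.two_eq_iff_add_eq_zero.1 (h.innerGreen x hx)
        rw [← this]; simp; ring

end FiveSquares

theorem Finset.sum_boole_eq {α : Type*} (s : Finset α) (a : α) [∀ i, Decidable (i = a)]
    [Decidable (a ∈ s)] : (∑ i ∈ s, if i = a then 1 else 0 : ZMod 2) = if a ∈ s then 1 else 0 := by
  classical
  convert Finset.sum_ite_eq' s a fun _ => (1 : ZMod 2)

namespace FiveSquares

variable {Φ : Type} (C : FiveSquares Φ)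

/-! ### Cycle operators, qubit by qubit -/

theorem redEdge_ne_greenEdge (p q : Φ × Bool) : C.redEdge p ≠ C.greenEdge q := fun h => by
  simpa [redEdge, greenEdge] using congrArg Prod.snd h

theorem redEdge_ne_blueEdge (p : Φ × Bool) (x : Φ) : C.redEdge p ≠ C.blueEdge x := fun h => by
  simpa [redEdge, blueEdge] using congrArg Prod.snd h

theorem redEdge_ne_tripleEdge (p : Φ × Bool) (x : Φ) : C.redEdge p ≠ C.tripleEdge x := fun h => by
  simpa [redEdge, tripleEdge] using congrArg Prod.snd h

theorem greenEdge_ne_blueEdge (p : Φ × Bool) (x : Φ) : C.greenEdge p ≠ C.blueEdge x := fun h => by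
  simpa [greenEdge, blueEdge] using congrArg Prod.snd h

theorem greenEdge_ne_tripleEdge (p : Φ × Bool) (x : Φ) : C.greenEdge p ≠ C.tripleEdge x :=
  fun h => by simpa [greenEdge, tripleEdge] using congrArg Prod.snd h

theorem blueEdge_ne_tripleEdge (x y : Φ) : C.blueEdge x ≠ C.tripleEdge y := fun h => by
  have := C.blueEdge_card x
  rw [h, C.tripleEdge_card] at this
  omega

theorem innerEdge_snd_ne_blue (x : Φ) : (C.innerEdge x).2 ≠ Color.blue := by
  simp only [innerEdge]; split_ifs <;> simp

theorem innerEdge_ne_of_mem {x : Φ} {e : ColoredEdge C.Qubit} {p : Φ × Bool}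
    (h : Sum.inl p ∈ e.1) : C.innerEdge x ≠ e := by
  rintro rfl
  simp [mem_innerEdge] at h

theorem innerEdge_ne_redEdge (x : Φ) (p : Φ × Bool) : C.innerEdge x ≠ C.redEdge p :=
  C.innerEdge_ne_of_mem (p := p) (C.mem_redEdge.2 (Or.inl rfl))

theorem innerEdge_ne_greenEdge (x : Φ) (p : Φ × Bool) : C.innerEdge x ≠ C.greenEdge p :=
  C.innerEdge_ne_of_mem (p := p) (C.mem_greenEdge.2 (Or.inl rfl))

theorem innerEdge_ne_blueEdge (x y : Φ) : C.innerEdge x ≠ C.blueEdge y :=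
  C.innerEdge_ne_of_mem (p := (y, false)) (C.mem_blueEdge.2 (Or.inl rfl))

theorem innerEdge_ne_tripleEdge (x y : Φ) : C.innerEdge x ≠ C.tripleEdge y :=
  C.innerEdge_ne_of_mem (p := (y, true)) (C.mem_tripleEdge.2 (Or.inl rfl))

/-- A vertex of `Γ₂` lies on exactly one edge of each color, so incidence is an equality of edges.
This reduces the sums in the cycle operators to single indicator terms. -/
theorem inl_mem_redEdge (p q : Φ × Bool) :
    Sum.inl p ∈ (C.redEdge q).1 ↔ C.redEdge q = C.redEdge p := by
  simp [mem_redEdge, redEdge_eq]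

theorem inl_mem_greenEdge (p q : Φ × Bool) :
    Sum.inl p ∈ (C.greenEdge q).1 ↔ C.greenEdge q = C.greenEdge p := by
  simp [mem_greenEdge, greenEdge_eq]

theorem inl_mem_blueEdge (p : Φ × Bool) (y : Φ) :
    Sum.inl p ∈ (C.blueEdge y).1 ↔ p.2 = false ∧ C.blueEdge y = C.blueEdge p.1 := by
  rcases p with ⟨x, _ | _⟩ <;> simp [mem_blueEdge, blueEdge_eq]

theorem inl_mem_tripleEdge (p : Φ × Bool) (y : Φ) :
    Sum.inl p ∈ (C.tripleEdge y).1 ↔ p.2 = true ∧ C.tripleEdge y = C.tripleEdge p.1 := by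
  rcases p with ⟨x, _ | _⟩ <;> simp [mem_tripleEdge, tripleEdge_eq]

theorem inr_mem_tripleEdge (x y : Φ) :
    Sum.inr (C.Γ.halfEdgeOf x) ∈ (C.tripleEdge y).1 ↔ C.tripleEdge y = C.tripleEdge x := by
  simp only [mem_tripleEdge, tripleEdge_eq, reduceCtorEq, false_or, Sum.inr.injEq]
  rw [eq_comm, C.Γ.halfEdgeOf_eq]

theorem inr_mem_innerEdge (x y : Φ) :
    Sum.inr (C.Γ.halfEdgeOf x) ∈ (C.innerEdge y).1 ↔
      C.innerEdge y = C.innerEdge x ∨ C.innerEdge y = C.innerEdge (C.Γ.t2 x) := by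
  simp only [mem_innerEdge, innerEdge_eq, Sum.inr.injEq]
  rw [C.Γ.halfEdgeOf_eq, C.Γ.halfEdgeOf_eq]
  constructor
  · rintro ((h | h) | (h | h))
    · simp [h]
    · simp [h]
    · simp [← h]
    · simp [← h]
  · rintro ((h | h) | (h | h))
    · simp [h]
    · simp [h]
    · simp [← h]
    · simp [h]

theorem innerEdge_ne_innerEdge_t2 (x : Φ) : C.innerEdge x ≠ C.innerEdge (C.Γ.t2 x) := by
  rw [Ne, innerEdge_eq]
  rintro (h | h)
  · exact C.Γ.t2_ne x h
  · exact C.t1_ne_t2 x h.symm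

variable {C}

section

variable {σ : Finset (ColoredEdge C.Qubit)} (hσ : ∀ e ∈ σ, e ∈ C.edges)
include hσ

open Classical in
-- Only red (`X`) and green (`Y`) edges have an `X` part, and one of each passes through the qubit.
-- The companion formulas follow the same pattern, with green and blue edges for the `Z` part.
theorem cycleOperator_fst_inl (p : Φ × Bool) : (cycleOperator σ).1 (Sum.inl p) =
    (if C.redEdge p ∈ σ then 1 else 0) + if C.greenEdge p ∈ σ then 1 else 0 := by
  rw [cycleOperator, Pauli.fst_sum, ← Finset.sum_boole_eq σ (C.redEdge p),
    ← Finset.sum_boole_eq σ (C.greenEdge p), ← Finset.sum_add_distrib]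
  refine Finset.sum_congr rfl fun e he => ?_
  rw [edgeOperator_fst]
  rcases hσ e he with (((⟨q, rfl⟩ | ⟨q, rfl⟩) | ⟨x, rfl⟩) | ⟨x, rfl⟩) | ⟨x, rfl⟩
  · simp [inl_mem_redEdge, redEdge_ne_greenEdge]; simp [redEdge]
  · simp [inl_mem_greenEdge, (redEdge_ne_greenEdge _ _ _).symm]; simp [greenEdge]
  · simp [(redEdge_ne_blueEdge _ _ _).symm, (greenEdge_ne_blueEdge _ _ _).symm]; simp [blueEdge]
  · simp [(redEdge_ne_tripleEdge _ _ _).symm, (greenEdge_ne_tripleEdge _ _ _).symm]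
    simp [tripleEdge]
  · simp [innerEdge_ne_redEdge, innerEdge_ne_greenEdge, mem_innerEdge]

open Classical in
theorem cycleOperator_snd_true (x : Φ) : (cycleOperator σ).2 (Sum.inl (x, true)) =
    (if C.greenEdge (x, true) ∈ σ then 1 else 0) + if C.tripleEdge x ∈ σ then 1 else 0 := by
  rw [cycleOperator, Pauli.snd_sum, ← Finset.sum_boole_eq σ (C.greenEdge (x, true)),
    ← Finset.sum_boole_eq σ (C.tripleEdge x), ← Finset.sum_add_distrib]
  refine Finset.sum_congr rfl fun e he => ?_
  rw [edgeOperator_snd]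
  rcases hσ e he with (((⟨q, rfl⟩ | ⟨q, rfl⟩) | ⟨x, rfl⟩) | ⟨x, rfl⟩) | ⟨x, rfl⟩
  · simp [redEdge_ne_greenEdge, redEdge_ne_tripleEdge]; simp [redEdge]
  · simp [inl_mem_greenEdge, greenEdge_ne_tripleEdge]; simp [greenEdge]
  · simp [(greenEdge_ne_blueEdge _ _ _).symm, blueEdge_ne_tripleEdge, inl_mem_blueEdge]
  · simp [(greenEdge_ne_tripleEdge _ _ _).symm, inl_mem_tripleEdge]
    simp [tripleEdge]
  · simp [innerEdge_ne_tripleEdge, innerEdge_ne_greenEdge, mem_innerEdge]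

open Classical in
theorem cycleOperator_snd_false (x : Φ) : (cycleOperator σ).2 (Sum.inl (x, false)) =
    (if C.greenEdge (x, false) ∈ σ then 1 else 0) + if C.blueEdge x ∈ σ then 1 else 0 := by
  rw [cycleOperator, Pauli.snd_sum, ← Finset.sum_boole_eq σ (C.greenEdge (x, false)),
    ← Finset.sum_boole_eq σ (C.blueEdge x), ← Finset.sum_add_distrib]
  refine Finset.sum_congr rfl fun e he => ?_
  rw [edgeOperator_snd]
  rcases hσ e he with (((⟨q, rfl⟩ | ⟨q, rfl⟩) | ⟨x, rfl⟩) | ⟨x, rfl⟩) | ⟨x, rfl⟩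
  · simp [redEdge_ne_greenEdge, redEdge_ne_blueEdge]; simp [redEdge]
  · simp [inl_mem_greenEdge, greenEdge_ne_blueEdge]; simp [greenEdge]
  · simp [(greenEdge_ne_blueEdge _ _ _).symm, inl_mem_blueEdge]; simp [blueEdge]
  · simp [(greenEdge_ne_tripleEdge _ _ _).symm, (blueEdge_ne_tripleEdge _ _ _).symm,
      inl_mem_tripleEdge]
  · simp [innerEdge_ne_blueEdge, innerEdge_ne_greenEdge, mem_innerEdge]

open Classical in
theorem cycleOperator_fst_inr (x : Φ) : (cycleOperator σ).1 (Sum.inr (C.Γ.halfEdgeOf x)) =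
    (if C.innerEdge x ∈ σ then 1 else 0) + if C.innerEdge (C.Γ.t2 x) ∈ σ then 1 else 0 := by
  rw [cycleOperator, Pauli.fst_sum, ← Finset.sum_boole_eq σ (C.innerEdge x),
    ← Finset.sum_boole_eq σ (C.innerEdge (C.Γ.t2 x)), ← Finset.sum_add_distrib]
  refine Finset.sum_congr rfl fun e he => ?_
  rw [edgeOperator_fst]
  rcases hσ e he with (((⟨q, rfl⟩ | ⟨q, rfl⟩) | ⟨y, rfl⟩) | ⟨y, rfl⟩) | ⟨y, rfl⟩
  · simp [(innerEdge_ne_redEdge _ _ _).symm, mem_redEdge]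
  · simp [(innerEdge_ne_greenEdge _ _ _).symm, mem_greenEdge]
  · simp [(innerEdge_ne_blueEdge _ _ _).symm, mem_blueEdge]
  · simp [(innerEdge_ne_tripleEdge _ _ _).symm]; simp [tripleEdge]
  · simp only [inr_mem_innerEdge, innerEdge_snd_ne_blue, ne_eq, not_false_eq_true, and_true]
    -- The two inner edges at a qubit are distinct, so the indicator of the disjunction is the sum
    -- of the indicators.
    by_cases h : C.innerEdge y = C.innerEdge x
    · simp [h, innerEdge_ne_innerEdge_t2]
    · simp [h]

open Classical in
-- The corners of `x` and `t2 x` have opposite colors; the inner conditional selects the green one,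
-- whose edge alone carries a `Z` part here.
theorem cycleOperator_snd_inr (x : Φ) : (cycleOperator σ).2 (Sum.inr (C.Γ.halfEdgeOf x)) =
    (if C.tripleEdge x ∈ σ then 1 else 0) +
      if C.innerEdge (if C.innerGreen (C.Γ.cornerOf x) = true then x else C.Γ.t2 x) ∈ σ
        then 1 else 0 := by
  rw [cycleOperator, Pauli.snd_sum, ← Finset.sum_boole_eq σ (C.tripleEdge x),
    ← Finset.sum_boole_eq σ (C.innerEdge _), ← Finset.sum_add_distrib]
  refine Finset.sum_congr rfl fun e he => ?_
  rw [edgeOperator_snd]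
  rcases hσ e he with (((⟨q, rfl⟩ | ⟨q, rfl⟩) | ⟨y, rfl⟩) | ⟨y, rfl⟩) | ⟨y, rfl⟩
  · simp [(innerEdge_ne_redEdge _ _ _).symm, mem_redEdge, redEdge_ne_tripleEdge]
  · simp [(innerEdge_ne_greenEdge _ _ _).symm, mem_greenEdge, greenEdge_ne_tripleEdge]
  · simp [(innerEdge_ne_blueEdge _ _ _).symm, mem_blueEdge, blueEdge_ne_tripleEdge]
  · simp [(innerEdge_ne_tripleEdge _ _ _).symm, inr_mem_tripleEdge]; simp [tripleEdge]
  · have hg : (C.innerEdge y).2 ≠ Color.red ↔ C.innerGreen (C.Γ.cornerOf y) = true := by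
      simp only [innerEdge]; split_ifs with h <;> simp [h]
    have hs : ∀ z, C.innerEdge y = C.innerEdge z →
        C.innerGreen (C.Γ.cornerOf y) = C.innerGreen (C.Γ.cornerOf z) := by
      intro z h
      rcases C.innerEdge_eq.1 h with rfl | rfl <;> simp
    have h2 := C.innerGreen_ne x
    simp only [hg, inr_mem_innerEdge, innerEdge_ne_tripleEdge, if_false, zero_add]
    refine if_congr ?_ rfl rfl
    constructor
    · rintro ⟨h | h, hy⟩
      · rw [if_pos (by rw [← hs x h, hy])]; exact h
      · rw [if_neg]
        · exact h
        · intro hx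
          rw [hx, ← hs _ h, hy] at h2
          exact h2 rfl
    · split_ifs with hx
      · exact fun h => ⟨Or.inl h, by rw [hs x h, hx]⟩
      · intro h
        refine ⟨Or.inr h, ?_⟩
        rw [hs _ h]
        rw [Bool.not_eq_true] at hx
        rw [hx] at h2
        simpa using h2

end

end FiveSquares

/-! ### The five types of checks as explicit Pauli operators -/

namespace FiveSquares

variable {Φ : Type} (C : FiveSquares Φ)

/-- A condition that is constant along an edge can be tested at either end. In this form, membership
in the images that define `cycle` becomes a condition on one flag. -/
theorem exists_redEdge {P : Φ × Bool → Prop} (hP : ∀ p : Φ × Bool, P (p.1, !p.2) → P p)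
    (q : Φ × Bool) : (∃ a, P a ∧ C.redEdge a = C.redEdge q) ↔ P q := by
  constructor
  · rintro ⟨a, ha, h⟩
    rcases C.redEdge_eq.1 h with rfl | rfl
    · exact ha
    · exact hP _ (by simpa using ha)
  · exact fun h => ⟨q, h, rfl⟩

theorem exists_greenEdge {P : Φ → Prop} (hP : ∀ x, P x → P (C.Γ.t1 x)) (b : Bool)
    (q : Φ × Bool) : (∃ a, P a ∧ C.greenEdge (a, b) = C.greenEdge q) ↔ P q.1 ∧ q.2 = b := by
  constructor
  · rintro ⟨a, ha, h⟩
    rcases C.greenEdge_eq.1 h with rfl | rfl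
    · exact ⟨ha, rfl⟩
    · exact ⟨hP _ ha, rfl⟩
  · rintro ⟨h, rfl⟩
    exact ⟨q.1, h, rfl⟩

theorem exists_blueEdge {P : Φ → Prop} (hP : ∀ x, P x → P (C.Γ.t0 x)) (x : Φ) :
    (∃ a, P a ∧ C.blueEdge a = C.blueEdge x) ↔ P x := by
  constructor
  · rintro ⟨a, ha, h⟩
    rcases C.blueEdge_eq.1 h with rfl | rfl
    · exact ha
    · exact hP _ ha
  · exact fun h => ⟨x, h, rfl⟩

theorem exists_innerEdge {P : Φ → Prop} (hP : ∀ x, P x → P (C.Γ.t1 x)) (x : Φ) :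
    (∃ a, P a ∧ C.innerEdge a = C.innerEdge x) ↔ P x := by
  constructor
  · rintro ⟨a, ha, h⟩
    rcases C.innerEdge_eq.1 h with rfl | rfl
    · exact ha
    · exact hP _ ha
  · exact fun h => ⟨x, h, rfl⟩

theorem exists_tripleEdge {P : Φ → Prop} (x : Φ) :
    (∃ a, P a ∧ C.tripleEdge a = C.tripleEdge x) ↔ P x ∨ P (C.Γ.t2 x) := by
  constructor
  · rintro ⟨a, ha, h⟩
    rcases C.tripleEdge_eq.1 h with rfl | rfl
    · exact Or.inl ha
    · right; rwa [C.Γ.t2_t2]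
  · rintro (h | h)
    · exact ⟨x, h, rfl⟩
    · exact ⟨_, h, C.tripleEdge_eq.2 (by simp [C.Γ.t2_t2])⟩

theorem exists_redEdge_t2 {P : Φ → Prop} (q : Φ × Bool) :
    (∃ a, P a ∧ C.redEdge (C.Γ.t2 a, true) = C.redEdge q) ↔ P (C.Γ.t2 q.1) := by
  constructor
  · rintro ⟨a, ha, h⟩
    rcases C.redEdge_eq.1 h with rfl | rfl <;> simpa [C.Γ.t2_t2] using ha
  · intro h
    refine ⟨_, h, C.redEdge_eq.2 ?_⟩
    rcases q with ⟨x, _ | _⟩ <;> simp [C.Γ.t2_t2]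

theorem exists_blueEdge_t2 {P : Φ → Prop} (hP : ∀ x, P x → P (C.Γ.t0 x)) (x : Φ) :
    (∃ a, P a ∧ C.blueEdge (C.Γ.t2 a) = C.blueEdge x) ↔ P (C.Γ.t2 x) := by
  constructor
  · rintro ⟨a, ha, h⟩
    rcases C.blueEdge_eq.1 h with rfl | rfl
    · simpa [C.Γ.t2_t2] using ha
    · rw [C.Γ.t0_t2, C.Γ.t2_t2]; exact hP _ ha
  · exact fun h => ⟨_, h, by rw [C.Γ.t2_t2]⟩

theorem face_ne_t2 (x : Φ) : C.Γ.faceOf (C.Γ.t2 x) ≠ C.Γ.faceOf x :=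
  fun h => C.side_ne x (by rw [h])

theorem base_edgeOf_not (x : Φ) (b : Bool) : C.base.edgeOf (x, !b) = C.base.edgeOf (x, b) :=
  C.base.edgeOf_t0 (x, b)

theorem base_edgeOf_t1 (x : Φ) (b : Bool) : C.base.edgeOf (C.Γ.t1 x, b) = C.base.edgeOf (x, b) :=
  C.base.edgeOf_t2 (x, b)

theorem base_edgeOf (p : Φ × Bool) : C.base.edgeOf p = C.base.edgeOf (p.1, true) := by
  rcases p with ⟨x, _ | _⟩
  · exact C.base_edgeOf_not x true
  · rfl

theorem side_t2 (x : Φ) : C.side (C.Γ.faceOf (C.Γ.t2 x)) = !C.side (C.Γ.faceOf x) := by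
  have := C.side_ne x
  revert this
  cases C.side (C.Γ.faceOf (C.Γ.t2 x)) <;> cases C.side (C.Γ.faceOf x) <;> simp

/-- Among the four flags of an edge, `t2` changes the color of the face and `t0` keeps it. Thus an
edge has just two flags of each color, and their qubits form one blue edge. -/
theorem eq_or_eq_t0_of_edgeOf_eq {x y : Φ} (h : C.Γ.dual.edgeOf x = C.Γ.dual.edgeOf y)
    (hs : C.side (C.Γ.faceOf x) = C.side (C.Γ.faceOf y)) : y = x ∨ y = C.Γ.t0 x := by
  rcases C.Γ.dual.edgeOf_eq.1 h with h | h | h | h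
  · exact .inl h
  · exfalso
    rw [h, SurfaceMap.dual_t0, side_t2] at hs
    simp at hs
  · exact .inr h
  · exfalso
    rw [h, SurfaceMap.dual_t0, SurfaceMap.dual_t2, side_t2, C.Γ.faceOf_t0] at hs
    simp at hs

variable [Fintype Φ]

theorem cycle_subset (g : C.Check) : ∀ e ∈ C.cycle g, e ∈ C.edges := by
  intro e he
  cases g <;> simp only [cycle, Finset.mem_union, Finset.mem_image, Finset.mem_filter,
    Finset.mem_univ, true_and] at he
  · rcases he with ⟨x, -, rfl⟩ | ⟨x, -, rfl⟩
    exacts [C.greenEdge_mem _, C.blueEdge_mem _]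
  · rcases he with (⟨x, -, rfl⟩ | ⟨x, -, rfl⟩) | ⟨x, -, rfl⟩
    exacts [C.tripleEdge_mem _, C.greenEdge_mem _, C.innerEdge_mem _]
  · rcases he with (((⟨x, -, rfl⟩ | ⟨x, -, rfl⟩) | ⟨x, -, rfl⟩) | ⟨x, -, rfl⟩) | ⟨x, -, rfl⟩
    exacts [C.tripleEdge_mem _, C.greenEdge_mem _, C.innerEdge_mem _, C.redEdge_mem _,
      C.blueEdge_mem _]
  · obtain ⟨x, -, rfl⟩ := he
    exact C.innerEdge_mem _
  · rcases he with ⟨x, -, rfl⟩ | ⟨x, -, rfl⟩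
    exacts [C.redEdge_mem _, C.greenEdge_mem _]

open Classical in
-- Around the boundary of a `v`-face each vertex meets one green and one blue edge, and `Y · Z = X`.
theorem checkOperator_s1 (f : C.Γ.Face) :
    (∀ p, (C.checkOperator (.s1 f)).1 (Sum.inl p) =
      if C.Γ.faceOf p.1 = f ∧ p.2 = false then 1 else 0) ∧
    (∀ h, (C.checkOperator (.s1 f)).1 (Sum.inr h) = 0) ∧
    ∀ q, (C.checkOperator (.s1 f)).2 q = 0 := by
  have hf : ∀ x, C.Γ.faceOf x = f → C.Γ.faceOf (C.Γ.t1 x) = f := by simp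
  have hf' : ∀ x, C.Γ.faceOf x = f → C.Γ.faceOf (C.Γ.t0 x) = f := by simp
  have hr : ∀ p, C.redEdge p ∉ C.cycle (.s1 f) := fun p => by
    simp [cycle, (redEdge_ne_greenEdge _ _ _).symm, (redEdge_ne_blueEdge _ _ _).symm]
  have hg : ∀ p, C.greenEdge p ∈ C.cycle (.s1 f) ↔ C.Γ.faceOf p.1 = f ∧ p.2 = false := fun p => by
    simp [cycle, exists_greenEdge C hf, (greenEdge_ne_blueEdge _ _ _).symm]
  have hb : ∀ x, C.blueEdge x ∈ C.cycle (.s1 f) ↔ C.Γ.faceOf x = f := fun x => by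
    simp [cycle, exists_blueEdge C hf', greenEdge_ne_blueEdge]
  have ht : ∀ x, C.tripleEdge x ∉ C.cycle (.s1 f) := fun x => by
    simp [cycle, greenEdge_ne_tripleEdge, blueEdge_ne_tripleEdge]
  have hi : ∀ x, C.innerEdge x ∉ C.cycle (.s1 f) := fun x => by
    simp [cycle, (innerEdge_ne_greenEdge _ _ _).symm, (innerEdge_ne_blueEdge _ _ _).symm]
  have hσ := C.cycle_subset (.s1 f)
  refine ⟨fun p => ?_, fun h => ?_, fun q => ?_⟩
  · simp [checkOperator, cycleOperator_fst_inl hσ, hr, hg]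
  · obtain ⟨x, rfl⟩ : ∃ x, C.Γ.halfEdgeOf x = h := Quot.exists_rep h
    simp [checkOperator, cycleOperator_fst_inr hσ, hi]
  · rcases q with ⟨x, _ | _⟩ | h
    · simp [checkOperator, cycleOperator_snd_false hσ, hg, hb, ZMod.two_add_self]
    · simp [checkOperator, cycleOperator_snd_true hσ, hg, ht]
    · obtain ⟨x, rfl⟩ : ∃ x, C.Γ.halfEdgeOf x = h := Quot.exists_rep h
      simp [checkOperator, cycleOperator_snd_inr hσ, hi, ht]

open Classical in
-- Every qubit of the unit cell, outer or inner, meets one green edge and one rank-3 edge of the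
-- cycle, and `Y · Z = X`.
theorem checkOperator_s2 (v : C.Γ.Vertex) :
    (∀ p, (C.checkOperator (.s2 v)).1 (Sum.inl p) =
      if C.Γ.vertexOf p.1 = v ∧ p.2 = true then 1 else 0) ∧
    (∀ x, (C.checkOperator (.s2 v)).1 (Sum.inr (C.Γ.halfEdgeOf x)) =
      if C.Γ.vertexOf x = v then 1 else 0) ∧
    ∀ q, (C.checkOperator (.s2 v)).2 q = 0 := by
  have hv : ∀ x, C.Γ.vertexOf x = v → C.Γ.vertexOf (C.Γ.t1 x) = v := by simp
  have hv' : ∀ x, C.Γ.vertexOf x = v ∧ C.innerGreen (C.Γ.cornerOf x) = true →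
    C.Γ.vertexOf (C.Γ.t1 x) = v ∧ C.innerGreen (C.Γ.cornerOf (C.Γ.t1 x)) = true := by simp
  have hr : ∀ p, C.redEdge p ∉ C.cycle (.s2 v) := fun p => by
    simp [cycle, (redEdge_ne_greenEdge _ _ _).symm, (redEdge_ne_tripleEdge _ _ _).symm,
      innerEdge_ne_redEdge]
  have hg : ∀ p, C.greenEdge p ∈ C.cycle (.s2 v) ↔ C.Γ.vertexOf p.1 = v ∧ p.2 = true := fun p => by
    simp [cycle, exists_greenEdge C hv, (greenEdge_ne_tripleEdge _ _ _).symm,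
      innerEdge_ne_greenEdge]
  have ht : ∀ x, C.tripleEdge x ∈ C.cycle (.s2 v) ↔ C.Γ.vertexOf x = v := fun x => by
    simp [cycle, greenEdge_ne_tripleEdge, innerEdge_ne_tripleEdge,
      exists_tripleEdge C (P := fun x => C.Γ.vertexOf x = v)]
  have hi : ∀ x, C.innerEdge x ∈ C.cycle (.s2 v) ↔
      C.Γ.vertexOf x = v ∧ C.innerGreen (C.Γ.cornerOf x) = true := fun x => by
    simp only [cycle, Finset.mem_union, Finset.mem_image, Finset.mem_filter,
      Finset.mem_univ, true_and, (innerEdge_ne_greenEdge _ _ _).symm,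
      (innerEdge_ne_tripleEdge _ _ _).symm, and_false, exists_false, false_or]
    exact exists_innerEdge C hv' x
  have hσ := C.cycle_subset (.s2 v)
  refine ⟨fun p => ?_, fun x => ?_, fun q => ?_⟩
  · simp [checkOperator, cycleOperator_fst_inl hσ, hr, hg]
  · have h2 := C.innerGreen_ne x
    simp only [checkOperator, cycleOperator_fst_inr hσ, hi, C.Γ.vertexOf_t2]
    cases hx : C.innerGreen (C.Γ.cornerOf x) <;> rw [hx] at h2 <;> simp at h2 <;> simp [h2]
  · rcases q with ⟨x, _ | _⟩ | h
    · have hb : C.blueEdge x ∉ C.cycle (.s2 v) := by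
        simp [cycle, greenEdge_ne_blueEdge, (blueEdge_ne_tripleEdge _ _ _).symm,
          innerEdge_ne_blueEdge]
      simp [checkOperator, cycleOperator_snd_false hσ, hg, hb]
    · simp [checkOperator, cycleOperator_snd_true hσ, hg, ht, ZMod.two_add_self]
    · obtain ⟨x, rfl⟩ : ∃ x, C.Γ.halfEdgeOf x = h := Quot.exists_rep h
      have h2 := C.innerGreen_ne x
      simp only [checkOperator, cycleOperator_snd_inr hσ, hi, ht]
      cases hx : C.innerGreen (C.Γ.cornerOf x) <;> rw [hx] at h2 <;> simp at h2 <;>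
        simp [h2, hx, ZMod.two_add_self]

open Classical in
-- On the side of `f`, green and rank-3 edges give `X`; on the far side, red with rank-3 or blue
-- edges gives `Y`. At an inner qubit the rank-3 edge meets the one inner edge on the side of `f`,
-- which gives `X` or `Y` according as that edge is green or red. The proper face coloring keeps the
-- two sides disjoint.
theorem checkOperator_s3 (f : C.Γ.Face) :
    (∀ p, (C.checkOperator (.s3 f)).1 (Sum.inl p) =
      (if C.Γ.faceOf p.1 = f ∧ p.2 = true then 1 else 0) +
        if C.Γ.faceOf (C.Γ.t2 p.1) = f then 1 else 0) ∧
    (∀ x, (C.checkOperator (.s3 f)).1 (Sum.inr (C.Γ.halfEdgeOf x)) =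
      (if C.Γ.faceOf x = f then 1 else 0) + if C.Γ.faceOf (C.Γ.t2 x) = f then 1 else 0) ∧
    (∀ p, (C.checkOperator (.s3 f)).2 (Sum.inl p) =
      if C.Γ.faceOf (C.Γ.t2 p.1) = f then 1 else 0) ∧
    (∀ x, (C.checkOperator (.s3 f)).2 (Sum.inr (C.Γ.halfEdgeOf x)) =
      (if C.Γ.faceOf x = f ∧ C.innerGreen (C.Γ.cornerOf x) = false then 1 else 0) +
      if C.Γ.faceOf (C.Γ.t2 x) = f ∧ C.innerGreen (C.Γ.cornerOf (C.Γ.t2 x)) = false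
        then 1 else 0) := by
  have hf : ∀ x, C.Γ.faceOf x = f → C.Γ.faceOf (C.Γ.t1 x) = f := by simp
  have hf' : ∀ x, C.Γ.faceOf x = f → C.Γ.faceOf (C.Γ.t0 x) = f := by simp
  have hff : ∀ x, C.Γ.faceOf x = f → C.Γ.faceOf (C.Γ.t2 x) ≠ f := fun x h h' =>
    C.face_ne_t2 x (by rw [h, h'])
  have hr : ∀ p, C.redEdge p ∈ C.cycle (.s3 f) ↔ C.Γ.faceOf (C.Γ.t2 p.1) = f := fun p => by
    simp only [cycle, Finset.mem_union, Finset.mem_image, Finset.mem_filter,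
      Finset.mem_univ, true_and, (redEdge_ne_greenEdge _ _ _).symm,
      (redEdge_ne_tripleEdge _ _ _).symm, innerEdge_ne_redEdge, (redEdge_ne_blueEdge _ _ _).symm,
      and_false, exists_false, false_or, or_false]
    exact exists_redEdge_t2 C (P := fun x => C.Γ.faceOf x = f) p
  have hg : ∀ p, C.greenEdge p ∈ C.cycle (.s3 f) ↔ C.Γ.faceOf p.1 = f ∧ p.2 = true := fun p => by
    simp [cycle, exists_greenEdge C hf, (greenEdge_ne_tripleEdge _ _ _).symm,
      innerEdge_ne_greenEdge, redEdge_ne_greenEdge, (greenEdge_ne_blueEdge _ _ _).symm]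
  have hb : ∀ x, C.blueEdge x ∈ C.cycle (.s3 f) ↔ C.Γ.faceOf (C.Γ.t2 x) = f := fun x => by
    simp only [cycle, Finset.mem_union, Finset.mem_image, Finset.mem_filter,
      Finset.mem_univ, true_and, greenEdge_ne_blueEdge, redEdge_ne_blueEdge, innerEdge_ne_blueEdge,
      (blueEdge_ne_tripleEdge _ _ _).symm, and_false, exists_false, false_or, or_false]
    exact exists_blueEdge_t2 C hf' x
  have ht : ∀ x, C.tripleEdge x ∈ C.cycle (.s3 f) ↔
      C.Γ.faceOf x = f ∨ C.Γ.faceOf (C.Γ.t2 x) = f := fun x => by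
    simp only [cycle, Finset.mem_union, Finset.mem_image, Finset.mem_filter,
      Finset.mem_univ, true_and, greenEdge_ne_tripleEdge, redEdge_ne_tripleEdge,
      innerEdge_ne_tripleEdge, blueEdge_ne_tripleEdge, and_false, exists_false, or_false]
    exact exists_tripleEdge C (P := fun x => C.Γ.faceOf x = f) x
  have hi : ∀ x, C.innerEdge x ∈ C.cycle (.s3 f) ↔ C.Γ.faceOf x = f := fun x => by
    simp only [cycle, Finset.mem_union, Finset.mem_image, Finset.mem_filter,
      Finset.mem_univ, true_and, (innerEdge_ne_greenEdge _ _ _).symm,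
      (innerEdge_ne_tripleEdge _ _ _).symm, (innerEdge_ne_redEdge _ _ _).symm,
      (innerEdge_ne_blueEdge _ _ _).symm, and_false, exists_false, false_or, or_false]
    exact exists_innerEdge C hf x
  have hσ := C.cycle_subset (.s3 f)
  refine ⟨fun p => ?_, fun x => ?_, fun p => ?_, fun x => ?_⟩
  · simp only [checkOperator, cycleOperator_fst_inl hσ, hr, hg]
    rw [add_comm]
  · simp only [checkOperator, cycleOperator_fst_inr hσ, hi]
  · rcases p with ⟨x, _ | _⟩
    · simp [checkOperator, cycleOperator_snd_false hσ, hg, hb]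
    · simp only [checkOperator, cycleOperator_snd_true hσ, hg, ht]
      by_cases h : C.Γ.faceOf x = f
      · simp [h, hff x h, ZMod.two_add_self]
      · simp [h]
  · have h2 := C.innerGreen_ne x
    simp only [checkOperator, cycleOperator_snd_inr hσ, hi, ht]
    by_cases h : C.Γ.faceOf x = f
    · cases hx : C.innerGreen (C.Γ.cornerOf x) <;> simp [h, hff x h, ZMod.two_add_self]
    · by_cases h' : C.Γ.faceOf (C.Γ.t2 x) = f <;>
      cases hx : C.innerGreen (C.Γ.cornerOf x) <;> rw [hx] at h2 <;> simp at h2 <;>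
        simp [h, h', h2, ZMod.two_add_self]

open Classical in
-- Each inner qubit meets one red and one green inner edge, and `X · Y = Z`; S5 works the same way
-- on an `e`-face.
theorem checkOperator_s4 (v : C.Γ.Vertex) :
    (∀ q, (C.checkOperator (.s4 v)).1 q = 0) ∧
    (∀ p, (C.checkOperator (.s4 v)).2 (Sum.inl p) = 0) ∧
    ∀ x, (C.checkOperator (.s4 v)).2 (Sum.inr (C.Γ.halfEdgeOf x)) =
      if C.Γ.vertexOf x = v then 1 else 0 := by
  have hv : ∀ x, C.Γ.vertexOf x = v → C.Γ.vertexOf (C.Γ.t1 x) = v := by simp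
  have hr : ∀ p, C.redEdge p ∉ C.cycle (.s4 v) := fun p => by simp [cycle, innerEdge_ne_redEdge]
  have hg : ∀ p, C.greenEdge p ∉ C.cycle (.s4 v) := fun p => by
    simp [cycle, innerEdge_ne_greenEdge]
  have hb : ∀ p, C.blueEdge p ∉ C.cycle (.s4 v) := fun p => by simp [cycle, innerEdge_ne_blueEdge]
  have ht : ∀ x, C.tripleEdge x ∉ C.cycle (.s4 v) := fun x => by
    simp [cycle, innerEdge_ne_tripleEdge]
  have hi : ∀ x, C.innerEdge x ∈ C.cycle (.s4 v) ↔ C.Γ.vertexOf x = v := fun x => by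
    simp [cycle, exists_innerEdge C hv]
  have hσ := C.cycle_subset (.s4 v)
  refine ⟨fun q => ?_, fun p => ?_, fun x => ?_⟩
  · rcases q with p | h
    · simp [checkOperator, cycleOperator_fst_inl hσ, hr, hg]
    · obtain ⟨x, rfl⟩ : ∃ x, C.Γ.halfEdgeOf x = h := Quot.exists_rep h
      simp [checkOperator, cycleOperator_fst_inr hσ, hi, ZMod.two_add_self]
  · rcases p with ⟨x, _ | _⟩
    · simp [checkOperator, cycleOperator_snd_false hσ, hg, hb]
    · simp [checkOperator, cycleOperator_snd_true hσ, hg, ht]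
  · simp only [checkOperator, cycleOperator_snd_inr hσ, hi, ht]
    split_ifs <;> simp_all

open Classical in
theorem checkOperator_s5 (c : C.base.Edge) :
    (∀ q, (C.checkOperator (.s5 c)).1 q = 0) ∧
    (∀ p, (C.checkOperator (.s5 c)).2 (Sum.inl p) = if C.base.edgeOf p = c then 1 else 0) ∧
    ∀ h, (C.checkOperator (.s5 c)).2 (Sum.inr h) = 0 := by
  have hr : ∀ p, C.redEdge p ∈ C.cycle (.s5 c) ↔ C.base.edgeOf p = c := fun p => by
    simp only [cycle, Finset.mem_union, Finset.mem_image, Finset.mem_filter,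
      Finset.mem_univ, true_and, (redEdge_ne_greenEdge _ _ _).symm,
      and_false, exists_false, or_false]
    exact exists_redEdge C (P := fun p => C.base.edgeOf p = c)
      (fun p h => by rw [← h, base_edgeOf_not]) p
  have hg : ∀ p, C.greenEdge p ∈ C.cycle (.s5 c) ↔ C.base.edgeOf p = c := fun p => by
    simp only [cycle, Finset.mem_union, Finset.mem_image, Finset.mem_filter,
      Finset.mem_univ, true_and, redEdge_ne_greenEdge,
      and_false, exists_false, false_or]
    constructor
    · rintro ⟨a, rfl, h⟩
      rcases C.greenEdge_eq.1 h with rfl | rfl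
      · rfl
      · exact C.base_edgeOf_t1 _ _
    · exact fun h => ⟨p, h, rfl⟩
  have hb : ∀ p, C.blueEdge p ∉ C.cycle (.s5 c) := fun p => by
    simp [cycle, greenEdge_ne_blueEdge, redEdge_ne_blueEdge]
  have ht : ∀ x, C.tripleEdge x ∉ C.cycle (.s5 c) := fun x => by
    simp [cycle, greenEdge_ne_tripleEdge, redEdge_ne_tripleEdge]
  have hi : ∀ x, C.innerEdge x ∉ C.cycle (.s5 c) := fun x => by
    simp [cycle, (innerEdge_ne_greenEdge _ _ _).symm, (innerEdge_ne_redEdge _ _ _).symm]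
  have hσ := C.cycle_subset (.s5 c)
  refine ⟨fun q => ?_, fun p => ?_, fun h => ?_⟩
  · rcases q with p | h
    · simp [checkOperator, cycleOperator_fst_inl hσ, hr, hg, ZMod.two_add_self]
    · obtain ⟨x, rfl⟩ : ∃ x, C.Γ.halfEdgeOf x = h := Quot.exists_rep h
      simp [checkOperator, cycleOperator_fst_inr hσ, hi]
  · rcases p with ⟨x, _ | _⟩
    · simp [checkOperator, cycleOperator_snd_false hσ, hg, hb]
    · simp [checkOperator, cycleOperator_snd_true hσ, hg, ht]
  · obtain ⟨x, rfl⟩ : ∃ x, C.Γ.halfEdgeOf x = h := Quot.exists_rep h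
    simp [checkOperator, cycleOperator_snd_inr hσ, hi, ht]

end FiveSquares

/-! ### Surface codes -/

namespace SurfaceMap

variable {Φ : Type} [Finite Φ] (M : SurfaceMap Φ)

/-- Each edge has two ends, represented by `rep e` and `t0 (rep e)`. They remain distinct even for a
loop because `t0` is neither the identity nor `t2` at any flag. -/
theorem sum_halfEdge {rep : M.Edge → Φ} (hrep : ∀ e, M.edgeOf (rep e) = e)
    (F : M.HalfEdge → ZMod 2) : ∑ h, F h =
      ∑ e, (F (M.halfEdgeOf (rep e)) + F (M.halfEdgeOf (M.t0 (rep e)))) := by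
  have hb : Function.Bijective (Sum.elim (fun e => M.halfEdgeOf (rep e))
      (fun e => M.halfEdgeOf (M.t0 (rep e)))) := by
    -- The edge of a half-edge recovers the index, so for injectivity only the two ends of one edge
    -- must be told apart.
    have he : ∀ z, (Sum.elim (fun e => M.halfEdgeOf (rep e))
      (fun e => M.halfEdgeOf (M.t0 (rep e))) z).edge = z.elim id id := by
      rintro (e | e)
      · exact hrep e
      · exact (M.edgeOf_t0 _).trans (hrep e)
    have hd : ∀ e, M.halfEdgeOf (rep e) ≠ M.halfEdgeOf (M.t0 (rep e)) := fun e h => by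
      rcases M.halfEdgeOf_eq.1 h with h | h
      · exact M.t0_ne _ h
      · exact M.t0_ne_t2 _ h
    constructor
    · intro z w h
      have h' := (he z).symm.trans ((congrArg HalfEdge.edge h).trans (he w))
      rcases z with e | e <;> rcases w with e' | e' <;> simp only [Sum.elim_inl, Sum.elim_inr,
        id] at h' <;> subst h'
      · rfl
      · exact absurd h (hd e)
      · exact absurd h.symm (hd e)
      · rfl
    · intro h
      obtain ⟨x, rfl⟩ : ∃ x, M.halfEdgeOf x = h := Quot.exists_rep h
      rcases M.edgeOf_eq.1 (hrep (M.edgeOf x)) with h | h | h | h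
      · exact ⟨.inl (M.edgeOf x), M.halfEdgeOf_eq.2 (.inl h)⟩
      · exact ⟨.inr (M.edgeOf x), M.halfEdgeOf_eq.2 (.inl h)⟩
      · exact ⟨.inl (M.edgeOf x), M.halfEdgeOf_eq.2 (.inr h)⟩
      · exact ⟨.inr (M.edgeOf x), M.halfEdgeOf_eq.2 (.inr (h.trans (M.t0_t2 _)))⟩
  rw [Finset.sum_add_distrib, ← hb.sum_comp, Fintype.sum_sum_type]
  rfl

open Classical in
-- The syndrome is the mod 2 boundary of the chain `c`; for a loop the two indicators cancel.
theorem zSyndrome_eq_sum {rep : M.Edge → Φ} (hrep : ∀ e, M.edgeOf (rep e) = e)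
    (c : M.Edge → ZMod 2) (v : M.Vertex) : M.zSyndrome c v =
      ∑ e, c e * ((if M.vertexOf (rep e) = v then 1 else 0) +
        if M.vertexOf (M.t0 (rep e)) = v then 1 else 0) := by
  have h1 : M.zSyndrome c v = ∑ h : M.HalfEdge, if h.vertex = v then c h.edge else 0 := by
    rw [zSyndrome, Pauli.comm_symm, vertexOperator, Pauli.comm_sum_right, ← Finset.sum_filter]
    exact Finset.sum_congr rfl fun h _ => by simp [zError]
  rw [h1, M.sum_halfEdge hrep]
  refine Finset.sum_congr rfl fun e _ => ?_
  have h2 : (M.halfEdgeOf (rep e)).edge = e := hrep e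
  have h3 : (M.halfEdgeOf (M.t0 (rep e))).edge = e := (M.edgeOf_t0 _).trans (hrep e)
  rw [h2, h3, mul_add, mul_ite, mul_one, mul_zero, mul_ite, mul_one, mul_zero]
  rfl

theorem zSyndrome_add (c d : M.Edge → ZMod 2) :
    M.zSyndrome (c + d) = M.zSyndrome c + M.zSyndrome d := by
  funext v
  rw [Pi.add_apply, zSyndrome, zSyndrome, zSyndrome, ← Pauli.comm_add_right]
  simp [zError]

open Classical in
-- Sides are the half-edges of the dual graph, so `sum_halfEdge` for `M.dual` applies, and only the
-- two sides of the edge of `x` contribute.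
theorem plaquetteOperator_snd (f : M.Face) (x : Φ) : (M.plaquetteOperator f).2 (M.edgeOf x) =
    (if M.faceOf x = f then 1 else 0) + if M.faceOf (M.t2 x) = f then 1 else 0 := by
  have h1 : (M.plaquetteOperator f).2 (M.edgeOf x) =
      ∑ s : M.Side, if s.face = f ∧ s.edge = M.edgeOf x then 1 else 0 := by
    rw [plaquetteOperator, Pauli.snd_sum, Finset.sum_filter]
    refine Finset.sum_congr rfl fun s _ => ?_
    by_cases h : s.face = f <;> simp [h, Pauli.Z_snd, eq_comm]
  have hrep : ∀ e, M.dual.edgeOf (Quot.out e) = e := fun e => Quot.out_eq e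
  -- Edges of `M` and of its dual are quotients by the same relation up to the order of a
  -- disjunction; the types differ and must be compared through flags.
  have hE : ∀ y, M.dual.edgeOf y = M.dual.edgeOf x ↔ M.edgeOf y = M.edgeOf x := fun y => by
    rw [SurfaceMap.edgeOf_eq, SurfaceMap.edgeOf_eq, dual_t0, dual_t2, M.t0_t2]; tauto
  have h2 := M.dual.sum_halfEdge hrep fun s : M.Side =>
    if s.face = f ∧ s.edge = M.edgeOf x then 1 else 0
  have h3 : ∀ y, ((M.sideOf y).face = f ∧ (M.sideOf y).edge = M.edgeOf x) ↔
      (M.faceOf y = f ∧ M.edgeOf y = M.edgeOf x) := fun _ => Iff.rfl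
  refine h1.trans (h2.trans ?_)
  rw [Finset.sum_eq_single (M.dual.edgeOf x)]
  · set y := Quot.out (M.dual.edgeOf x) with hy
    have h4 : M.dual.edgeOf y = M.dual.edgeOf x := hrep _
    have h5 := (hE y).1 h4
    change (if (M.sideOf y).face = f ∧ (M.sideOf y).edge = M.edgeOf x then 1 else 0) +
      (if (M.sideOf (M.t2 y)).face = f ∧ (M.sideOf (M.t2 y)).edge = M.edgeOf x then 1 else 0) = _
    simp only [h3, h5, M.edgeOf_t2, and_true]
    rcases M.edgeOf_eq.1 h5 with h | h | h | h <;> rw [h]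
    · rw [M.faceOf_t0, ← M.t0_t2, M.faceOf_t0]
    · rw [M.t2_t2, add_comm]
    · rw [M.faceOf_t0, ← M.t0_t2, M.t2_t2, M.faceOf_t0, add_comm]
  · intro e _ he
    set y := Quot.out e with hy
    have h4 : M.edgeOf y ≠ M.edgeOf x := fun h => he (by rw [← hrep e]; exact (hE _).2 h)
    change (if (M.sideOf y).face = f ∧ (M.sideOf y).edge = M.edgeOf x then 1 else 0) +
      (if (M.sideOf (M.t2 y)).face = f ∧ (M.sideOf (M.t2 y)).edge = M.edgeOf x then 1 else 0) = _
    simp [h3, h4]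
  · simp

/-- Vertex operators have no `Z` part, so the `Z` parts of stabilizers are the sums of plaquettes;
`y` records which plaquettes are taken. -/
theorem zError_mem_surfaceStabilizer {c : M.Edge → ZMod 2} :
    M.zError c ∈ M.surfaceStabilizer ↔
      ∃ y : M.Face → ZMod 2, ∀ x, c (M.edgeOf x) = y (M.faceOf x) + y (M.faceOf (M.t2 x)) := by
  classical
  constructor
  · intro h
    have key : ∀ p ∈ M.surfaceStabilizer, ∃ y : M.Face → ZMod 2, ∀ x,
        p.2 (M.edgeOf x) = y (M.faceOf x) + y (M.faceOf (M.t2 x)) := by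
      intro p hp
      induction hp using AddSubgroup.closure_induction with
      | mem p hp =>
        rcases hp with ⟨v, rfl⟩ | ⟨f, rfl⟩
        · exact ⟨0, fun x => by simp [vertexOperator, Pauli.snd_sum]⟩
        · exact ⟨fun g => if g = f then 1 else 0, fun x => M.plaquetteOperator_snd f x⟩
      | zero => exact ⟨0, by simp⟩
      | add p q _ _ hp hq =>
        obtain ⟨y, hy⟩ := hp
        obtain ⟨z, hz⟩ := hq
        exact ⟨y + z, fun x => by simp [hy, hz]; ring⟩
      | neg p _ hp => rwa [Pauli.neg_eq]
    exact key _ h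
  · rintro ⟨y, hy⟩
    have h : M.zError c = ∑ f, y f • M.plaquetteOperator f := by
      refine Prod.ext (funext fun e => ?_) (funext fun e => ?_)
      · rw [Pauli.fst_sum]
        simp [zError, plaquetteOperator, Pauli.fst_sum]
      · obtain ⟨x, rfl⟩ : ∃ x, M.edgeOf x = e := Quot.exists_rep e
        rw [Pauli.snd_sum]
        simp [zError, plaquetteOperator_snd, mul_add, Finset.sum_add_distrib, hy]
    rw [h]
    refine sum_mem fun f _ => ?_
    have hc : y f = 0 ∨ y f = 1 := by generalize y f = z; revert z; decide
    rcases hc with hc | hc <;> rw [hc]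
    · rw [zero_smul]; exact zero_mem _
    · rw [one_smul]; exact AddSubgroup.subset_closure (Or.inr ⟨f, rfl⟩)

end SurfaceMap

namespace FiveSquares

variable {Φ : Type} [Fintype Φ] (C : FiveSquares Φ)

/-! ### The measured operators are stabilizers -/

theorem checkOperator_mem_centralizer (g : C.Check) :
    C.checkOperator g ∈ Pauli.centralizer C.gauge := by
  classical
  rw [mem_centralizer_gauge]
  rcases g with f | v | f | v | c
  · obtain ⟨h1, h2, h3⟩ := C.checkOperator_s1 f
    constructor <;> simp [h1, h2, h3]
  · obtain ⟨h1, h2, h3⟩ := C.checkOperator_s2 v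
    constructor <;> simp [h1, h2, h3]
  · obtain ⟨h1, h2, h3, h4⟩ := C.checkOperator_s3 f
    have hi : ∀ x, C.innerGreen (C.Γ.cornerOf (C.Γ.t2 (C.Γ.t1 x))) ≠
        C.innerGreen (C.Γ.cornerOf x) := fun x => by
      have := C.innerGreen_ne (C.Γ.t1 x)
      rwa [C.Γ.cornerOf_t1] at this
    constructor
    · simp [h3]
    · rintro x (_ | _) <;> simp [h1, h3, ZMod.two_add_self, add_assoc]
    · simp [h1, ← C.Γ.t0_t2]
    · simp [h1, h2]
    · intro x hx
      have h5 := hi x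
      have h6 := C.innerGreen_ne x
      rw [hx] at h5 h6
      simp only [ne_eq, Bool.not_eq_false] at h5 h6
      simp [h4, h5, h6, hx]
    · intro x hx
      have h5 := hi x
      have h6 := C.innerGreen_ne x
      rw [hx] at h5 h6
      simp only [ne_eq, Bool.not_eq_true] at h5 h6
      simp [h2, h4, h5, h6, hx, add_assoc, ZMod.two_add_self]
  · obtain ⟨h1, h2, h3⟩ := C.checkOperator_s4 v
    constructor <;> simp [h1, h2, h3]
  · obtain ⟨h1, h2, h3⟩ := C.checkOperator_s5 c
    constructor <;> simp [h1, h2, h3, base_edgeOf_t1, base_edgeOf C (_, false)]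

/-- The operators `ZZZ` of rank-3 edges are not among the generators, so S2 and S3 need a
factorization into link operators that differs from their defining cycles. -/
theorem checkOperator_mem_gauge (g : C.Check) : C.checkOperator g ∈ C.gauge := by
  classical
  rcases g with f | v | f | v | c
  · obtain ⟨h1, h2, h3⟩ := C.checkOperator_s1 f
    refine IsForm.mem_gauge (r := 0) (gT := 0) (gF := fun x => if C.Γ.faceOf x = f then 1 else 0)
      (b := fun x => if C.Γ.faceOf x = f then 1 else 0) (k := 0) (i := 0) ?_
    constructor <;> simp [h1, h2, h3, ZMod.two_add_self]
  · obtain ⟨h1, h2, h3⟩ := C.checkOperator_s2 v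
    -- Taking both spokes of every half-edge gives `ZZ` on the outer pair and nothing on the inner
    -- qubit; the `X` needed there comes from the red inner edges.
    refine IsForm.mem_gauge (r := 0) (gT := fun x => if C.Γ.vertexOf x = v then 1 else 0) (gF := 0)
      (b := 0) (k := fun x => if C.Γ.vertexOf x = v then 1 else 0)
      (i := fun x => if C.Γ.vertexOf x = v ∧ C.innerGreen (C.Γ.cornerOf x) = false
        then 1 else 0) ?_
    constructor <;> try simp [h1, h2, h3, ZMod.two_add_self]
    · intro x
      have h6 := C.innerGreen_ne x
      cases hx : C.innerGreen (C.Γ.cornerOf x) <;> rw [hx] at h6 <;> simp at h6 <;>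
        simp [h6]
    · intro x
      have h6 := C.innerGreen_ne x
      cases hx : C.innerGreen (C.Γ.cornerOf x) <;> rw [hx] at h6 <;> simp at h6 <;>
        simp [h6]
  · obtain ⟨h1, h2, h3, h4⟩ := C.checkOperator_s3 f
    -- Here the factorization uses the green edges on the boundary of the `v`-face of `f`, red and
    -- blue edges on both sides, and a single spoke per half-edge, from the far side.
    refine IsForm.mem_gauge (gT := 0) (gF := fun x => if C.Γ.faceOf x = f then 1 else 0)
      (r := fun x => (if C.Γ.faceOf x = f then 1 else 0) +
        if C.Γ.faceOf (C.Γ.t2 x) = f then 1 else 0)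
      (b := fun x => (if C.Γ.faceOf x = f then 1 else 0) +
        if C.Γ.faceOf (C.Γ.t2 x) = f then 1 else 0)
      (k := fun x => if C.Γ.faceOf (C.Γ.t2 x) = f then 1 else 0)
      (i := fun x => if C.Γ.faceOf x = f then 1 else 0) ?_
    constructor
    · simp
    · simp
    · simp [← C.Γ.t0_t2]
    · simp
    · simp [h1]
    · intro x
      simp only [h1, reduceCtorEq, and_false, if_false, zero_add]
      rw [add_comm, ← add_assoc, ZMod.two_add_self, zero_add]
    · exact h2
    · simp [h3]
    · intro x
      simp only [h3]
      rw [← add_assoc, ZMod.two_add_self, zero_add]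
    · intro x
      have h6 := C.innerGreen_ne x
      cases hx : C.innerGreen (C.Γ.cornerOf x) <;> rw [hx] at h6 <;> simp at h6 <;>
        simp [h4, h6, hx, C.Γ.t2_t2]
      · rw [add_comm (if C.Γ.faceOf (C.Γ.t2 x) = f then (1 : ZMod 2) else 0), add_assoc,
          ZMod.two_add_self, add_zero]
      · rw [add_assoc, ZMod.two_add_self, add_zero]
  · obtain ⟨h1, h2, h3⟩ := C.checkOperator_s4 v
    refine IsForm.mem_gauge (r := 0) (gT := 0) (gF := 0) (b := 0) (k := 0)
      (i := fun x => if C.Γ.vertexOf x = v then 1 else 0) ?_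
    constructor <;> simp [h1, h2, h3, ZMod.two_add_self]
  · obtain ⟨h1, h2, h3⟩ := C.checkOperator_s5 c
    refine IsForm.mem_gauge (r := fun x => if C.base.edgeOf (x, true) = c then 1 else 0)
      (gT := fun x => if C.base.edgeOf (x, true) = c then 1 else 0)
      (gF := fun x => if C.base.edgeOf (x, true) = c then 1 else 0) (b := 0) (k := 0) (i := 0) ?_
    constructor <;> simp [h1, h2, h3, ZMod.two_add_self, base_edgeOf_t1,
      base_edgeOf C (_, false)]

theorem checkOperator_mem_stabilizer (g : C.Check) : C.checkOperator g ∈ C.stabilizer :=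
  ⟨C.checkOperator_mem_gauge g, C.checkOperator_mem_centralizer g⟩

end FiveSquares

/-! ### The flags that represent an edge of `Γ*` -/

namespace FiveSquares

variable {Φ : Type} {C : FiveSquares Φ} (ch : C.Choices)

/-- Crossing the edge from the chosen `F_a` flag leads to the chosen `F_b` flag or to its image
under `t0`, hence to the same face whatever the choices were. -/
theorem faceOf_t2_qubitA (e : C.Γ.dual.Edge) :
    C.Γ.faceOf (C.Γ.t2 (ch.qubitA e)) = C.Γ.faceOf (ch.qubitB e) := by
  have h := eq_or_eq_t0_of_edgeOf_eq (C := C) (x := C.Γ.t2 (ch.qubitA e)) (y := ch.qubitB e)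
    (by rw [C.Γ.dual_edgeOf_t2, ch.qubitA_mem, ch.qubitB_mem])
    (by rw [side_t2, ch.qubitA_side, ch.qubitB_side]; rfl)
  rcases h with h | h <;> rw [h]
  rw [C.Γ.faceOf_t0]

theorem faceOf_t2_qubitB (e : C.Γ.dual.Edge) :
    C.Γ.faceOf (C.Γ.t2 (ch.qubitB e)) = C.Γ.faceOf (ch.qubitA e) := by
  have h := eq_or_eq_t0_of_edgeOf_eq (C := C) (x := C.Γ.t2 (ch.qubitB e)) (y := ch.qubitA e)
    (by rw [C.Γ.dual_edgeOf_t2, ch.qubitA_mem, ch.qubitB_mem])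
    (by rw [side_t2, ch.qubitA_side, ch.qubitB_side]; rfl)
  rcases h with h | h <;> rw [h]
  rw [C.Γ.faceOf_t0]

variable [Fintype Φ]

/-! ### The local corrections, qubit by qubit -/

theorem eq_choice_iff {α β : Type*} {π : α → β} {c : β → α} (hc : ∀ b, π (c b) = b) {a : α}
    {b : β} : a = c b ↔ π a = b ∧ c (π a) = a :=
  ⟨fun h => by subst h; rw [hc]; exact ⟨rfl, rfl⟩, fun ⟨h, h'⟩ => by rw [← h, h']⟩

/-- Since `c` is a section of `π`, only the index `π a` can contribute. This evaluates all
corrections of the algorithm at a given qubit. -/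
theorem sum_choice {α β : Type*} [Fintype β] [DecidableEq α] {π : α → β} {c : β → α} (hc : ∀ b, π (c b) = b)
    (s : β → ZMod 2) (a : α) : (∑ b, s b * if a = c b then 1 else 0) =
      if c (π a) = a then s (π a) else 0 := by
  classical
  simp [eq_choice_iff hc, ite_and]

open Classical in
theorem correctX_fst_inl (s : C.Check → ZMod 2) (p : Φ × Bool) :
    (correctX ch s).1 (Sum.inl p) =
      if ch.eQubit (C.base.edgeOf p) = p then s (.s5 (C.base.edgeOf p)) else 0 := by
  rw [← sum_choice ch.eQubit_mem (fun c => s (.s5 c))]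
  simp [correctX, Pauli.fst_sum, Pauli.X_fst]

open Classical in
theorem correctX_fst_inr (s : C.Check → ZMod 2) (h : C.Γ.HalfEdge) :
    (correctX ch s).1 (Sum.inr h) =
      if ch.innerQubit h.vertex = h then s (.s4 h.vertex) else 0 := by
  rw [← sum_choice ch.innerQubit_mem (fun c => s (.s4 c))]
  simp [correctX, Pauli.fst_sum, Pauli.X_fst]

theorem correctX_snd (s : C.Check → ZMod 2) : (correctX ch s).2 = 0 := by
  simp [correctX, Prod.snd_sum]

theorem syndrome_add (E F : Pauli C.Qubit) (g : C.Check) :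
    C.syndrome (E + F) g = C.syndrome E g + C.syndrome F g := Pauli.comm_add_right _ _ _

theorem updated_syndrome (E F : Pauli C.Qubit) : updated (C.syndrome E) F = C.syndrome (E + F) :=
  funext fun g => (syndrome_add E F g).symm

theorem comm_eq_zero_of_snd {Q : Type} [Fintype Q] {p r : Pauli Q} (hp : ∀ q, p.2 q = 0)
    (hr : r.2 = 0) : Pauli.comm p r = 0 := by
  simp [Pauli.comm, hp, hr]

/-- S2 consists of `X` operators and commutes with the first loop's corrections, so the remeasured
bit is the original one. -/
theorem updated_correctX_s2 (s : C.Check → ZMod 2) (v : C.Γ.Vertex) :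
    updated s (correctX ch s) (.s2 v) = s (.s2 v) := by
  rw [updated, syndrome, comm_eq_zero_of_snd (C.checkOperator_s2 v).2.2 (correctX_snd ch s),
    add_zero]

theorem correctLocal_eq (s : C.Check → ZMod 2) : correctLocal ch s = correctX ch s +
    ∑ v : C.Γ.Vertex, s (.s2 v) • Pauli.Z (Sum.inl (ch.vQubit v, true)) := by
  simp only [correctLocal, updated_correctX_s2]

theorem correctLocal_fst (s : C.Check → ZMod 2) : (correctLocal ch s).1 = (correctX ch s).1 := by
  simp [correctLocal_eq, Prod.fst_sum]

open Classical in
theorem correctLocal_snd_true (s : C.Check → ZMod 2) (x : Φ) :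
    (correctLocal ch s).2 (Sum.inl (x, true)) =
      if ch.vQubit (C.Γ.vertexOf x) = x then s (.s2 (C.Γ.vertexOf x)) else 0 := by
  rw [← sum_choice ch.vQubit_mem (fun c => s (.s2 c))]
  simp [correctLocal_eq, Pauli.snd_sum, Pauli.Z_snd, correctX_snd]

theorem correctLocal_snd_false (s : C.Check → ZMod 2) (x : Φ) :
    (correctLocal ch s).2 (Sum.inl (x, false)) = 0 := by
  classical
  simp [correctLocal_eq, Pauli.snd_sum, Pauli.Z_snd, correctX_snd]

theorem correctLocal_snd_inr (s : C.Check → ZMod 2) (h : C.Γ.HalfEdge) :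
    (correctLocal ch s).2 (Sum.inr h) = 0 := by
  classical
  simp [correctLocal_eq, Pauli.snd_sum, Pauli.Z_snd, correctX_snd]

/-- The S5 operators are `Z` on disjoint `e`-faces, so of all local corrections only the `X` chosen
on this face can anticommute with it. S4 and S2 are handled by the same disjointness. -/
theorem syndrome_correctLocal_s5 (s : C.Check → ZMod 2) (c : C.base.Edge) :
    C.syndrome (correctLocal ch s) (.s5 c) = s (.s5 c) := by
  classical
  obtain ⟨h1, h2, h3⟩ := C.checkOperator_s5 c
  simp [syndrome, correctLocal_eq, correctX, Pauli.comm_add_right, Pauli.comm_sum_right,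
    Pauli.comm_smul_right, h1, h2, h3, ch.eQubit_mem]

theorem syndrome_correctLocal_s4 (s : C.Check → ZMod 2) (v : C.Γ.Vertex) :
    C.syndrome (correctLocal ch s) (.s4 v) = s (.s4 v) := by
  classical
  obtain ⟨h1, h2, h3⟩ := C.checkOperator_s4 v
  have h4 : ∀ h : C.Γ.HalfEdge, (C.checkOperator (.s4 v)).2 (Sum.inr h) =
      if h.vertex = v then 1 else 0 := by
    intro h
    obtain ⟨x, rfl⟩ : ∃ x, C.Γ.halfEdgeOf x = h := Quot.exists_rep h
    rw [h3]; rfl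
  simp [syndrome, correctLocal_eq, correctX, Pauli.comm_add_right, Pauli.comm_sum_right,
    Pauli.comm_smul_right, h1, h2, h4, ch.innerQubit_mem]

theorem syndrome_correctLocal_s2 (s : C.Check → ZMod 2) (v : C.Γ.Vertex) :
    C.syndrome (correctLocal ch s) (.s2 v) = s (.s2 v) := by
  classical
  obtain ⟨h1, h2, h3⟩ := C.checkOperator_s2 v
  simp [syndrome, correctLocal_eq, correctX, Pauli.comm_add_right, Pauli.comm_sum_right,
    Pauli.comm_smul_right, h1, h3, ch.vQubit_mem]

/-! ### The lift -/

theorem lift_add (a b a' b' : C.Γ.dual.Edge → ZMod 2) :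
    lift ch (a + a') (b + b') = lift ch a b + lift ch a' b' := by
  simp only [lift, Pi.add_apply, add_smul, Finset.sum_add_distrib]
  abel

theorem lift_fst (a b : C.Γ.dual.Edge → ZMod 2) : (lift ch a b).1 = 0 := by
  simp [lift, Prod.fst_sum]

open Classical in
theorem lift_snd_false (a b : C.Γ.dual.Edge → ZMod 2) (x : Φ) :
    (lift ch a b).2 (Sum.inl (x, false)) =
      (if ch.qubitA (C.Γ.dual.edgeOf x) = x then a (C.Γ.dual.edgeOf x) else 0) +
      if ch.qubitB (C.Γ.dual.edgeOf x) = x then b (C.Γ.dual.edgeOf x) else 0 := by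
  rw [← sum_choice ch.qubitA_mem a, ← sum_choice ch.qubitB_mem b]
  simp [lift, Pauli.snd_sum, Pauli.Z_snd]

theorem lift_snd_true (a b : C.Γ.dual.Edge → ZMod 2) (x : Φ) :
    (lift ch a b).2 (Sum.inl (x, true)) = 0 := by
  classical
  simp [lift, Pauli.snd_sum, Pauli.Z_snd]

theorem lift_snd_inr (a b : C.Γ.dual.Edge → ZMod 2) (h : C.Γ.HalfEdge) :
    (lift ch a b).2 (Sum.inr h) = 0 := by
  classical
  simp [lift, Pauli.snd_sum, Pauli.Z_snd]

theorem comm_lift (p : Pauli C.Qubit) (a b : C.Γ.dual.Edge → ZMod 2) :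
    Pauli.comm p (lift ch a b) = ∑ e, a e * p.1 (Sum.inl (ch.qubitA e, false)) +
      ∑ e, b e * p.1 (Sum.inl (ch.qubitB e, false)) := by
  simp [lift, Pauli.comm_add_right, Pauli.comm_sum_right, Pauli.comm_smul_right]

open Classical in
-- The endpoints of a dual edge are the two faces of `Γ` beside it, represented by the two chosen
-- flags.
theorem zSyndrome_dual (c : C.Γ.dual.Edge → ZMod 2) (f : C.Γ.Face) :
    C.Γ.dual.zSyndrome c f = ∑ e, c e * ((if C.Γ.faceOf (ch.qubitA e) = f then 1 else 0) +
      if C.Γ.faceOf (ch.qubitB e) = f then 1 else 0) := by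
  refine (C.Γ.dual.zSyndrome_eq_sum ch.qubitA_mem c f).trans ?_
  refine Finset.sum_congr rfl fun e _ => ?_
  rw [← faceOf_t2_qubitA]
  rfl

/-- S1 at `f` sees only the flags of `f`: the qubits of the first copy if `f` is in `F_a`, those of
the second otherwise. In the boundary sum the endpoint of the other color never equals `f`. -/
theorem syndrome_lift_s1 (a b : C.Γ.dual.Edge → ZMod 2) (f : C.Γ.Face) :
    C.syndrome (lift ch a b) (.s1 f) =
      if C.side f = true then C.Γ.dual.zSyndrome a f else C.Γ.dual.zSyndrome b f := by
  classical
  have hA : C.side f = false → ∀ e, C.Γ.faceOf (ch.qubitA e) ≠ f := fun h e h' => by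
    rw [← h', ch.qubitA_side] at h; simp at h
  have hB : C.side f = true → ∀ e, C.Γ.faceOf (ch.qubitB e) ≠ f := fun h e h' => by
    rw [← h', ch.qubitB_side] at h; simp at h
  obtain ⟨h1, -, -⟩ := C.checkOperator_s1 f
  simp only [syndrome, comm_lift, h1, zSyndrome_dual ch]
  cases hf : C.side f
  · simp [hA hf]
  · simp [hB hf]

/-- S3 at `f` has its `X` part on those qubits `(x, false)` that lie across an edge from `f`, hence
in faces of the other color; this exchanges the two copies compared with S1. -/
theorem syndrome_lift_s3 (a b : C.Γ.dual.Edge → ZMod 2) (f : C.Γ.Face) :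
    C.syndrome (lift ch a b) (.s3 f) =
      if C.side f = true then C.Γ.dual.zSyndrome b f else C.Γ.dual.zSyndrome a f := by
  classical
  have hA : C.side f = false → ∀ e, C.Γ.faceOf (ch.qubitA e) ≠ f := fun h e h' => by
    rw [← h', ch.qubitA_side] at h; simp at h
  have hB : C.side f = true → ∀ e, C.Γ.faceOf (ch.qubitB e) ≠ f := fun h e h' => by
    rw [← h', ch.qubitB_side] at h; simp at h
  obtain ⟨h1, -, -⟩ := C.checkOperator_s3 f
  simp only [syndrome, comm_lift, h1, zSyndrome_dual ch, faceOf_t2_qubitA, faceOf_t2_qubitB]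
  cases hf : C.side f
  · simp [hA hf]
  · simp [hB hf]

/-! ### Correctness -/

/-- For a `Z` operator supported on the `(x, false)` qubits the normal form collapses: the red,
green and spoke multiplicities are one function `g`, and `i` is constant around each vertex and is
the jump of `g` across `t2`. Such a `g` amounts to two functions on the vertices of `Γ`, whose
coboundaries are `c` and `d`. -/
theorem lift_mem_gauge {c d : C.Γ.dual.Edge → ZMod 2} :
    lift ch c d ∈ C.gauge ↔ C.Γ.dual.zError c ∈ C.Γ.dual.surfaceStabilizer ∧
      C.Γ.dual.zError d ∈ C.Γ.dual.surfaceStabilizer := by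
  classical
  have hAB : ∀ x, C.side (C.Γ.faceOf x) = true → ch.qubitB (C.Γ.dual.edgeOf x) ≠ x := fun x h h' => by
    have := ch.qubitB_side (C.Γ.dual.edgeOf x)
    rw [h', h] at this; simp at this
  have hBA : ∀ x, C.side (C.Γ.faceOf x) = false → ch.qubitA (C.Γ.dual.edgeOf x) ≠ x := fun x h h' => by
    have := ch.qubitA_side (C.Γ.dual.edgeOf x)
    rw [h', h] at this; simp at this
  -- the value of the lift on the two flags of a side
  have hval : ∀ x, (lift ch c d).2 (Sum.inl (x, false)) +
      (lift ch c d).2 (Sum.inl (C.Γ.t0 x, false)) =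
      if C.side (C.Γ.faceOf x) = true then c (C.Γ.dual.edgeOf x) else d (C.Γ.dual.edgeOf x) := by
    intro x
    simp only [lift_snd_false, C.Γ.dual_edgeOf_t0]
    cases hx : C.side (C.Γ.faceOf x)
    · have h0 := hBA (C.Γ.t0 x) (by rw [C.Γ.faceOf_t0, hx])
      rw [C.Γ.dual_edgeOf_t0] at h0
      rcases eq_or_eq_t0_of_edgeOf_eq (C := C) (x := x) (ch.qubitB_mem _).symm
        (by rw [ch.qubitB_side, hx]) with h | h
      · simp [h, hBA x hx, h0, (C.Γ.t0_ne x).symm]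
      · simp [h, hBA x hx, h0, C.Γ.t0_ne x]
    · have h0 := hAB (C.Γ.t0 x) (by rw [C.Γ.faceOf_t0, hx])
      rw [C.Γ.dual_edgeOf_t0] at h0
      rcases eq_or_eq_t0_of_edgeOf_eq (C := C) (x := x) (ch.qubitA_mem _).symm
        (by rw [ch.qubitA_side, hx]) with h | h
      · simp [h, hAB x hx, h0, (C.Γ.t0_ne x).symm]
      · simp [h, hAB x hx, h0, C.Γ.t0_ne x]
  rw [SurfaceMap.zError_mem_surfaceStabilizer, SurfaceMap.zError_mem_surfaceStabilizer]
  constructor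
  · intro h
    obtain ⟨r, gT, gF, b, k, i, h⟩ := exists_isForm C h
    have e1 : ∀ x, r x = gT x := fun x => by
      have := h.fst_true x
      rw [lift_fst, Pi.zero_apply, eq_comm, CharTwo.add_eq_zero] at this
      exact this
    have e2 : ∀ x, r x = gF x := fun x => by
      have := h.fst_false x
      rw [lift_fst, Pi.zero_apply, eq_comm, CharTwo.add_eq_zero] at this
      exact this
    have e3 : ∀ x, i x = i (C.Γ.t2 x) := fun x => by
      have := h.fst_inr x
      rw [lift_fst, Pi.zero_apply, eq_comm, CharTwo.add_eq_zero] at this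
      exact this
    have e4 : ∀ x, gT x = k x := fun x => by
      have := h.snd_true x
      rw [lift_snd_true, eq_comm, CharTwo.add_eq_zero] at this
      exact this
    have e5 : ∀ x, gT (C.Γ.t2 x) = gT x + i x := fun x => by
      have := h.snd_inr x
      rw [lift_snd_inr, ← e3, ite_self, ← e4, ← e4, eq_comm] at this
      rw [← sub_eq_zero, ← this, CharTwo.sub_eq_add]; ring
    have e6 : ∀ x, gT x + gT (C.Γ.t0 x) = if C.side (C.Γ.faceOf x) = true
        then c (C.Γ.dual.edgeOf x) else d (C.Γ.dual.edgeOf x) := fun x => by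
      rw [← hval, h.snd_false, h.snd_false, h.b_t0, ← e2, ← e2, e1, e1]
      rw [add_add_add_comm, ZMod.two_add_self, add_zero]
    have hss : ∀ x, C.side (C.Γ.faceOf (C.Γ.t2 x)) = !C.side (C.Γ.faceOf x) := C.side_t2
    -- Adding `i` on the flags of `F_b` compensates the jump `e5`, so the values on `F_a` flags
    -- extend to a function on vertices. The function `z` below starts from `F_b` instead.
    obtain ⟨y, hy⟩ := C.Γ.vertexOf_lift
      (f := fun x => if C.side (C.Γ.faceOf x) = true then gT x else gT x + i x)
      (fun x => by simp [h.gT_t1, h.i_t1])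
      (fun x => by
        cases hx : C.side (C.Γ.faceOf x) <;> simp [hss, hx, e5, ← e3, add_assoc, ZMod.two_add_self])
    obtain ⟨z, hz⟩ := C.Γ.vertexOf_lift
      (f := fun x => if C.side (C.Γ.faceOf x) = true then gT x + i x else gT x)
      (fun x => by simp [h.gT_t1, h.i_t1])
      (fun x => by
        cases hx : C.side (C.Γ.faceOf x) <;> simp [hss, hx, e5, ← e3, add_assoc, ZMod.two_add_self])
    constructor
    · refine ⟨y, fun x => ?_⟩
      change _ = y (C.Γ.vertexOf x) + y (C.Γ.vertexOf (C.Γ.t0 x))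
      cases hx : C.side (C.Γ.faceOf x)
      -- The relation `e6` determines `c` only at flags of `F_a`; a flag of `F_b` is first moved
      -- across its edge.
      · rw [← C.Γ.vertexOf_t2 x, ← C.Γ.vertexOf_t2 (C.Γ.t0 x), ← C.Γ.t0_t2, hy, hy]
        have h6 := e6 (C.Γ.t2 x)
        simp only [hss, hx, Bool.not_false, if_true, C.Γ.faceOf_t0, C.Γ.dual_edgeOf_t2] at h6 ⊢
        rw [h6]
      · have h6 := e6 x
        simp only [hx, if_true] at h6
        rw [hy, hy]
        simp only [hx, if_true, C.Γ.faceOf_t0]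
        rw [h6]
    · refine ⟨z, fun x => ?_⟩
      change _ = z (C.Γ.vertexOf x) + z (C.Γ.vertexOf (C.Γ.t0 x))
      cases hx : C.side (C.Γ.faceOf x)
      · have h6 := e6 x
        simp only [hx, Bool.false_eq_true, if_false] at h6
        rw [hz, hz]
        simp only [hx, Bool.false_eq_true, if_false, C.Γ.faceOf_t0]
        rw [h6]
      · rw [← C.Γ.vertexOf_t2 x, ← C.Γ.vertexOf_t2 (C.Γ.t0 x), ← C.Γ.t0_t2, hz, hz]
        have h6 := e6 (C.Γ.t2 x)
        simp only [hss, hx, Bool.not_true, Bool.false_eq_true, if_false, C.Γ.faceOf_t0,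
          C.Γ.dual_edgeOf_t2] at h6 ⊢
        rw [h6]
  · rintro ⟨⟨y, hy⟩, ⟨z, hz⟩⟩
    have hy' : ∀ x, c (C.Γ.dual.edgeOf x) = y (C.Γ.vertexOf x) + y (C.Γ.vertexOf (C.Γ.t0 x)) := hy
    have hz' : ∀ x, d (C.Γ.dual.edgeOf x) = z (C.Γ.vertexOf x) + z (C.Γ.vertexOf (C.Γ.t0 x)) := hz
    -- The inverse construction: `g` takes its values from `y` on `F_a` and from `z` on `F_b`, so
    -- its jump across an edge is `y + z`. The blue multiplicity is forced by the `Z` part, and its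
    -- invariance under `t0` is the coboundary condition on `c` and `d`.
    let g : Φ → ZMod 2 := fun x =>
      if C.side (C.Γ.faceOf x) = true then y (C.Γ.vertexOf x) else z (C.Γ.vertexOf x)
    have g_t1 : ∀ x, g (C.Γ.t1 x) = g x := fun x => by simp [g]
    refine IsForm.mem_gauge (r := g) (gT := g) (gF := g) (k := g)
      (b := fun x => g x + (lift ch c d).2 (Sum.inl (x, false)))
      (i := fun x => y (C.Γ.vertexOf x) + z (C.Γ.vertexOf x)) ?_
    constructor
    · exact g_t1
    · exact g_t1
    · intro x
      have h1 := hval x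
      have h2 : g x + g (C.Γ.t0 x) = if C.side (C.Γ.faceOf x) = true
          then c (C.Γ.dual.edgeOf x) else d (C.Γ.dual.edgeOf x) := by
        simp only [g, C.Γ.faceOf_t0]
        split_ifs
        · rw [hy']
        · rw [hz']
      rw [← h1] at h2
      rw [ZMod.two_eq_iff_add_eq_zero]
      rw [ZMod.two_eq_iff_add_eq_zero] at h2
      rw [← h2]; ring
    · intro x; simp
    · intro x; rw [lift_fst, ZMod.two_add_self]; rfl
    · intro x; rw [lift_fst, ZMod.two_add_self]; rfl
    · intro x; rw [lift_fst, C.Γ.vertexOf_t2, ZMod.two_add_self]; rfl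
    · intro x; rw [lift_snd_true, ZMod.two_add_self]
    · intro x; rw [← add_assoc, ZMod.two_add_self, zero_add]
    · intro x
      rw [lift_snd_inr, C.Γ.vertexOf_t2, ite_self]
      have := C.side_t2 x
      cases hx : C.side (C.Γ.faceOf x) <;> rw [hx] at this <;>
        simp only [g, hx, this, Bool.not_true, Bool.not_false, Bool.false_eq_true, if_true,
          if_false, C.Γ.vertexOf_t2]
      · have h0 : ∀ a b : ZMod 2, 0 = b + a + (a + b) := by decide
        exact h0 _ _
      · have h0 : ∀ a b : ZMod 2, 0 = a + b + (a + b) := by decide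
        exact h0 _ _

/-- Modulo the gauge group, an error with trivial S2, S4 and S5 syndromes is a lift. -/
theorem exists_lift {E : Pauli C.Qubit} (h2 : ∀ v, C.syndrome E (.s2 v) = 0)
    (h4 : ∀ v, C.syndrome E (.s4 v) = 0) (h5 : ∀ c, C.syndrome E (.s5 c) = 0) :
    ∃ a b, E + lift ch a b ∈ C.gauge := by
  classical
  let L : AddSubgroup (Pauli C.Qubit) :=
    { carrier := {p | ∃ a b, p = lift ch a b}
      zero_mem' := ⟨0, 0, by simp [lift]⟩
      add_mem' := by
        rintro _ _ ⟨a, b, rfl⟩ ⟨a', b', rfl⟩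
        exact ⟨a + a', b + b', (lift_add ch a b a' b').symm⟩
      neg_mem' := by
        rintro _ ⟨a, b, rfl⟩
        exact ⟨a, b, Pauli.neg_eq _⟩ }
  -- By the double centralizer theorem it suffices that `E` commutes with every `r` that commutes
  -- with the gauge group and with all lifts.
  have hE : E ∈ C.gauge ⊔ L := by
    refine Pauli.mem_of_comm_eq_zero fun r hr => ?_
    have hc : IsCentral r := mem_centralizer_gauge.1 fun g hg => hr g (le_sup_left (a := C.gauge) hg)
    have hl : ∀ a b, Pauli.comm r (lift ch a b) = 0 := fun a b => by
      rw [Pauli.comm_symm]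
      exact hr _ (le_sup_right (a := C.gauge) (b := L) ⟨a, b, rfl⟩)
    have hA : ∀ e, r.1 (Sum.inl (ch.qubitA e, false)) = 0 := fun e => by
      simpa [comm_lift, Pi.single_apply] using hl (Pi.single e 1) 0
    have hB : ∀ e, r.1 (Sum.inl (ch.qubitB e, false)) = 0 := fun e => by
      simpa [comm_lift, Pi.single_apply] using hl 0 (Pi.single e 1)
    -- Single-edge lifts test one chosen qubit of each blue edge; the blue equation of the
    -- centralizer transfers the result to the other qubit.
    have hF : ∀ x, r.1 (Sum.inl (x, false)) = 0 := by
      intro x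
      cases hx : C.side (C.Γ.faceOf x)
      · rcases eq_or_eq_t0_of_edgeOf_eq (C := C) (ch.qubitB_mem (C.Γ.dual.edgeOf x))
          (by rw [ch.qubitB_side, hx]) with h | h <;> rw [h]
        · exact hB _
        · rw [hc.blue]; exact hB _
      · rcases eq_or_eq_t0_of_edgeOf_eq (C := C) (ch.qubitA_mem (C.Γ.dual.edgeOf x))
          (by rw [ch.qubitA_side, hx]) with h | h <;> rw [h]
        · exact hA _
        · rw [hc.blue]; exact hA _
    have hsF : ∀ x, r.2 (Sum.inl (C.Γ.t1 x, false)) = r.2 (Sum.inl (x, false)) := fun x => by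
      simpa [hF] using hc.green x false
    have hT : ∀ x, r.1 (Sum.inl (C.Γ.t1 x, true)) = r.1 (Sum.inl (x, true)) := fun x => by
      simpa [hc.red, hsF] using hc.green x true
    -- With the `X` part gone on `(x, false)`, the remaining data of `r` are constant on vertices
    -- and on `e`-faces: `A`, `B`, `Z` are the exponents of S2, S5 and S4.
    obtain ⟨A, hA⟩ := C.Γ.vertexOf_lift (f := fun x => r.1 (Sum.inl (x, true))) hT hc.outer
    obtain ⟨B, hB⟩ := C.base.edgeOf_lift (f := fun p => r.2 (Sum.inl p))
      (by
        rintro ⟨x, _ | _⟩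
        · exact hc.red x
        · exact (hc.red x).symm)
      (by
        rintro ⟨x, _ | _⟩
        · exact hsF x
        · exact (hc.red _).trans ((hsF x).trans (hc.red x).symm))
    obtain ⟨Z, hZ⟩ := C.Γ.vertexOf_lift (f := fun x => r.2 (Sum.inr (C.Γ.halfEdgeOf x)))
      (by
        intro x
        cases hx : C.innerGreen (C.Γ.cornerOf x)
        · exact hc.innerRed x hx
        · have := hc.innerGreen x hx
          rw [hc.spoke, hc.spoke, hT] at this
          exact add_left_cancel this)
      (by simp)
    have key : r = ∑ v, A v • C.checkOperator (.s2 v) + ∑ c, B c • C.checkOperator (.s5 c) +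
        ∑ v, Z v • C.checkOperator (.s4 v) := by
      refine Prod.ext (funext fun q => ?_) (funext fun q => ?_)
      · rcases q with ⟨x, _ | _⟩ | h
        · simp [Prod.fst_sum, (C.checkOperator_s2 _).1, (C.checkOperator_s5 _).1,
            (C.checkOperator_s4 _).1, hF]
        · simp [Prod.fst_sum, (C.checkOperator_s2 _).1, (C.checkOperator_s5 _).1,
            (C.checkOperator_s4 _).1, hA]
        · obtain ⟨x, rfl⟩ : ∃ x, C.Γ.halfEdgeOf x = h := Quot.exists_rep h
          simp [Prod.fst_sum, (C.checkOperator_s2 _).2.1, (C.checkOperator_s5 _).1,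
            (C.checkOperator_s4 _).1, hA, hc.spoke]
      · rcases q with p | h
        · simp [Prod.snd_sum, (C.checkOperator_s2 _).2.2, (C.checkOperator_s5 _).2.1,
            (C.checkOperator_s4 _).2.1, hB]
        · obtain ⟨x, rfl⟩ : ∃ x, C.Γ.halfEdgeOf x = h := Quot.exists_rep h
          simp [Prod.snd_sum, (C.checkOperator_s2 _).2.2, (C.checkOperator_s5 _).2.2,
            (C.checkOperator_s4 _).2.2, hZ]
    rw [Pauli.comm_symm, key]
    have h2' : ∀ v, Pauli.comm E (C.checkOperator (.s2 v)) = 0 := fun v => by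
      rw [Pauli.comm_symm]; exact h2 v
    have h4' : ∀ v, Pauli.comm E (C.checkOperator (.s4 v)) = 0 := fun v => by
      rw [Pauli.comm_symm]; exact h4 v
    have h5' : ∀ v, Pauli.comm E (C.checkOperator (.s5 v)) = 0 := fun v => by
      rw [Pauli.comm_symm]; exact h5 v
    simp [Pauli.comm_add_right, Pauli.comm_sum_right, Pauli.comm_smul_right, h2', h4', h5']
  obtain ⟨g, hg, l, ⟨a, b, rfl⟩, h⟩ := AddSubgroup.mem_sup.1 hE
  refine ⟨a, b, ?_⟩
  rw [← h, add_assoc, Pauli.add_self, add_zero]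
  exact hg

/-- The lifts of cycles of the dual graph commute with the stabilizer. -/
theorem lift_mem_centralizer {c d : C.Γ.dual.Edge → ZMod 2} (hc : C.Γ.dual.zSyndrome c = 0)
    (hd : C.Γ.dual.zSyndrome d = 0) : lift ch c d ∈ Pauli.centralizer C.stabilizer := by
  classical
  rintro p ⟨hpg, hpc⟩
  obtain ⟨r, gT, gF, b, k, i, h⟩ := exists_isForm C hpg
  have hz := mem_centralizer_gauge.1 hpc
  let β : Φ → ZMod 2 := fun x => p.1 (Sum.inl (x, false))
  let κ : Φ → ZMod 2 := fun x => k x + k (C.Γ.t2 x)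
  have κ_t2 : ∀ x, κ (C.Γ.t2 x) = κ x := fun x => by simp only [κ, C.Γ.t2_t2]; ring
  have β_t0 : ∀ x, β (C.Γ.t0 x) = β x := hz.blue
  have hα : ∀ x, r x + gT x = i x + i (C.Γ.t2 x) := fun x => by
    rw [← h.fst_true, ← h.fst_inr, hz.spoke]
  have hγ : ∀ x, gT x + k x = gF x + b x := fun x => by
    rw [← h.snd_true, ← h.snd_false, hz.red]
  have hβ : ∀ x, β x = r x + gF x := h.fst_false
  -- `b + β` is constant on faces
  have θ_t1 : ∀ x, b (C.Γ.t1 x) + β (C.Γ.t1 x) = b x + β x := fun x => by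
    have h1 := hz.green x false
    rw [h.snd_false, h.snd_false, h.gF_t1] at h1
    change β (C.Γ.t1 x) + _ = β x + _ at h1
    linear_combination h1
  obtain ⟨θ, hθ⟩ := C.Γ.faceOf_lift (f := fun x => b x + β x)
    (fun x => by simp only [h.b_t0, β_t0]) θ_t1
  -- the spokes form the boundary of `θ`
  have hδ : ∀ x, κ x = b x + β x + (b (C.Γ.t2 x) + β (C.Γ.t2 x)) := fun x => by
    have h1 := hγ x
    have h2 := hγ (C.Γ.t2 x)
    have h3 := hα x
    have h4 := hα (C.Γ.t2 x)
    rw [C.Γ.t2_t2] at h4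
    have two : (2 : ZMod 2) = 0 := rfl
    simp only [κ, hβ]
    linear_combination h1 + h2 - h3 - h4 - (i x + i (C.Γ.t2 x)) * two
  have κ_t0 : ∀ x, κ (C.Γ.t0 x) = κ x := fun x => by
    rw [hδ, hδ, ← C.Γ.t0_t2, h.b_t0, β_t0, h.b_t0, β_t0]
  have hζ : ∀ x, κ (C.Γ.t1 x) + i (C.Γ.t2 (C.Γ.t1 x)) = κ x + i (C.Γ.t2 x) := fun x => by
    cases hx : C.innerGreen (C.Γ.cornerOf x)
    · have h1 := hz.innerRed x hx
      rw [h.snd_inr, h.snd_inr, C.Γ.cornerOf_t1, hx] at h1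
      simpa [κ] using h1
    · have h1 := hz.innerGreen x hx
      rw [h.snd_inr, h.snd_inr, h.fst_inr, h.fst_inr, C.Γ.cornerOf_t1, hx, h.i_t1] at h1
      simp only [if_true] at h1
      linear_combination h1
  have hν : ∀ x, β (C.Γ.t1 x) + κ (C.Γ.t1 x) = β x + κ x := fun x => by
    have h1 := hζ x
    have h2 := hα x
    have h3 := hα (C.Γ.t1 x)
    rw [h.i_t1, h.gT_t1] at h3
    rw [hβ, hβ, h.gF_t1]
    linear_combination h1 - h2 + h3
  obtain ⟨ν, hν⟩ := C.Γ.faceOf_lift (f := fun x => β x + κ x)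
    (fun x => by simp only [κ_t0, β_t0]) hν
  -- On the qubits `(x, false)` the stabilizer element thus has the `X` part of a product of S1
  -- operators with exponents `ν + θ` and S3 operators with exponents `θ`.
  have hβ' : ∀ x, β x = ν (C.Γ.faceOf x) + (θ (C.Γ.faceOf x) + θ (C.Γ.faceOf (C.Γ.t2 x))) :=
    fun x => by
      rw [hν, hθ, hθ, ← hδ, add_assoc, ZMod.two_add_self, add_zero]
  -- Summation by parts: a cycle pairs to zero with the coboundary of any function on the vertices
  -- of `Γ*`.
  have key : ∀ (c : C.Γ.dual.Edge → ZMod 2) (u : C.Γ.Face → ZMod 2),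
      C.Γ.dual.zSyndrome c = 0 →
      ∑ e, c e * (u (C.Γ.faceOf (ch.qubitA e)) + u (C.Γ.faceOf (ch.qubitB e))) = 0 := by
    intro c u hc
    have h1 : ∀ f, u f * C.Γ.dual.zSyndrome c f = 0 := fun f => by rw [hc]; exact mul_zero _
    have h2 : ∑ f, u f * C.Γ.dual.zSyndrome c f = 0 := Finset.sum_eq_zero fun f _ => h1 f
    rw [← h2]
    simp only [zSyndrome_dual ch, Finset.mul_sum]
    rw [Finset.sum_comm]
    refine Finset.sum_congr rfl fun e _ => ?_
    simp only [mul_left_comm, ← Finset.mul_sum, mul_add, Finset.sum_add_distrib]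
    simp
  rw [comm_lift]
  -- For the first copy the S1 exponents are used on `F_a` and the S3 exponents on `F_b`; for the
  -- second copy the roles are exchanged.
  have k1 := key c (fun f => if C.side f = true then ν f + θ f else θ f) hc
  have k2 := key d (fun f => if C.side f = true then θ f else ν f + θ f) hd
  simp only [ch.qubitA_side, ch.qubitB_side, if_true, Bool.false_eq_true, if_false] at k1 k2
  rw [← add_zero (0 : ZMod 2)]
  congr 1
  · rw [← k1]
    refine Finset.sum_congr rfl fun e _ => ?_
    change c e * β _ = _
    rw [hβ', faceOf_t2_qubitA]; ring
  · rw [← k2]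
    refine Finset.sum_congr rfl fun e _ => ?_
    change d e * β _ = _
    rw [hβ', faceOf_t2_qubitB]; ring

/-- The checks commute with the gauge group, so the residual error and its lift have equal
syndromes; the S1 and S3 bits of the lift are the boundaries of `a` and `b`. -/
theorem exists_lift_correctLocal (E : Pauli C.Qubit) : ∃ a b : C.Γ.dual.Edge → ZMod 2,
    E + correctLocal ch (C.syndrome E) + lift ch a b ∈ C.gauge ∧
    projectA ch (C.syndrome E) = C.Γ.dual.zSyndrome a ∧
    projectB ch (C.syndrome E) = C.Γ.dual.zSyndrome b := by
  obtain ⟨a, b, h⟩ := exists_lift ch (E := E + correctLocal ch (C.syndrome E))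
    (fun v => by rw [syndrome_add, syndrome_correctLocal_s2, ZMod.two_add_self])
    (fun v => by rw [syndrome_add, syndrome_correctLocal_s4, ZMod.two_add_self])
    (fun v => by rw [syndrome_add, syndrome_correctLocal_s5, ZMod.two_add_self])
  have hs : ∀ g, C.syndrome (E + correctLocal ch (C.syndrome E)) g =
      C.syndrome (lift ch a b) g := fun g => by
    rw [ZMod.two_eq_iff_add_eq_zero, ← syndrome_add, syndrome, Pauli.comm_symm]
    exact C.checkOperator_mem_centralizer g _ h
  refine ⟨a, b, h, funext fun f => ?_, funext fun f => ?_⟩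
  · simp only [projectA, updated_syndrome, hs]
    split_ifs with hf
    · exact (syndrome_lift_s1 ch a b f).trans (if_pos hf)
    · exact (syndrome_lift_s3 ch a b f).trans (if_neg hf)
  · simp only [projectB, updated_syndrome, hs]
    split_ifs with hf
    · exact (syndrome_lift_s3 ch a b f).trans (if_pos hf)
    · exact (syndrome_lift_s1 ch a b f).trans (if_neg hf)

theorem decode_correct (E : Pauli C.Qubit) : ∃ a b : C.Γ.dual.Edge → ZMod 2,
    E + correctLocal ch (C.syndrome E) + lift ch a b ∈ C.gauge ∧
    projectA ch (C.syndrome E) = C.Γ.dual.zSyndrome a ∧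
    projectB ch (C.syndrome E) = C.Γ.dual.zSyndrome b ∧
    ∀ D₁ D₂ : (C.Γ.dual.Vertex → ZMod 2) → (C.Γ.dual.Edge → ZMod 2),
      C.Γ.dual.IsZDecoder D₁ → C.Γ.dual.IsZDecoder D₂ →
        E + decode ch D₁ D₂ (C.syndrome E) ∈ Pauli.centralizer C.stabilizer ∧
        (E + decode ch D₁ D₂ (C.syndrome E) ∈ C.gauge ↔
          C.Γ.dual.zError (a + D₁ (C.Γ.dual.zSyndrome a)) ∈ C.Γ.dual.surfaceStabilizer ∧
          C.Γ.dual.zError (b + D₂ (C.Γ.dual.zSyndrome b)) ∈ C.Γ.dual.surfaceStabilizer) := by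
  obtain ⟨a, b, hg, ha, hb⟩ := exists_lift_correctLocal ch E
  refine ⟨a, b, hg, ha, hb, fun D₁ D₂ h₁ h₂ => ?_⟩
  -- Inserting `lift ch a b` twice changes nothing modulo phases; it splits the residual error into
  -- a gauge element and the lift of two cycles.
  have key : E + decode ch D₁ D₂ (C.syndrome E) =
      (E + correctLocal ch (C.syndrome E) + lift ch a b) +
      lift ch (a + D₁ (C.Γ.dual.zSyndrome a)) (b + D₂ (C.Γ.dual.zSyndrome b)) := by
    rw [lift_add, decode, ha, hb, add_assoc (E + _), ← add_assoc (lift ch a b), Pauli.add_self,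
      zero_add, add_assoc]
  have hd : ∀ (D : (C.Γ.dual.Vertex → ZMod 2) → (C.Γ.dual.Edge → ZMod 2)),
      C.Γ.dual.IsZDecoder D → ∀ c, C.Γ.dual.zSyndrome (c + D (C.Γ.dual.zSyndrome c)) = 0 := by
    intro D hD c
    rw [SurfaceMap.zSyndrome_add, hD c]
    exact funext fun _ => ZMod.two_add_self _
  rw [key]
  constructor
  · refine add_mem ?_ (lift_mem_centralizer ch (hd D₁ h₁ a) (hd D₂ h₂ b))
    intro p hp
    rw [Pauli.comm_symm]
    exact hp.2 _ hg
  · rw [AddSubgroup.add_mem_cancel_left _ hg]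
    exact lift_mem_gauge ch

end FiveSquares

/-! ### Polynomially bounded functions -/

/-- `T` is bounded by a polynomial in `n`. -/
def PolyBdd {ι : Type} (n T : ι → ℕ) : Prop := ∃ K k : ℕ, ∀ i, T i ≤ K * (n i + 1) ^ k

namespace PolyBdd

variable {ι : Type} {n T U : ι → ℕ}

theorem mono (h : PolyBdd n T) (hU : ∀ i, U i ≤ T i) : PolyBdd n U := by
  obtain ⟨K, k, h⟩ := h
  exact ⟨K, k, fun i => (hU i).trans (h i)⟩

theorem const (c : ℕ) : PolyBdd n fun _ => c := ⟨c, 0, fun i => by simp⟩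

theorem self : PolyBdd n n := ⟨1, 1, fun i => by simp⟩

theorem add (h : PolyBdd n T) (h' : PolyBdd n U) : PolyBdd n fun i => T i + U i := by
  obtain ⟨K, k, h⟩ := h
  obtain ⟨K', k', h'⟩ := h'
  refine ⟨K + K', k + k', fun i => ?_⟩
  have h1 : (n i + 1) ^ k ≤ (n i + 1) ^ (k + k') := Nat.pow_le_pow_right (by omega) (by omega)
  have h2 : (n i + 1) ^ k' ≤ (n i + 1) ^ (k + k') := Nat.pow_le_pow_right (by omega) (by omega)
  calc T i + U i ≤ K * (n i + 1) ^ k + K' * (n i + 1) ^ k' := add_le_add (h i) (h' i)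
    _ ≤ K * (n i + 1) ^ (k + k') + K' * (n i + 1) ^ (k + k') := by gcongr
    _ = _ := by ring

theorem mul (h : PolyBdd n T) (h' : PolyBdd n U) : PolyBdd n fun i => T i * U i := by
  obtain ⟨K, k, h⟩ := h
  obtain ⟨K', k', h'⟩ := h'
  refine ⟨K * K', k + k', fun i => ?_⟩
  calc T i * U i ≤ (K * (n i + 1) ^ k) * (K' * (n i + 1) ^ k') := Nat.mul_le_mul (h i) (h' i)
    _ = _ := by ring

theorem reindex {κ : Type} (φ : κ → ι) (h : PolyBdd n T) :
    PolyBdd (fun j => n (φ j)) fun j => T (φ j) := by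
  obtain ⟨K, k, h⟩ := h
  exact ⟨K, k, fun j => h (φ j)⟩

theorem trans {m : ι → ℕ} (h : PolyBdd m T) (hm : PolyBdd n m) : PolyBdd n T := by
  obtain ⟨K, k, h⟩ := h
  obtain ⟨K', k', hm⟩ := hm
  refine ⟨K * (K' + 1) ^ k, k' * k, fun i => (h i).trans ?_⟩
  have h1 : m i + 1 ≤ (K' + 1) * (n i + 1) ^ k' := by
    have := Nat.one_le_pow k' (n i + 1) (by omega)
    have := hm i
    nlinarith
  calc K * (m i + 1) ^ k ≤ K * ((K' + 1) * (n i + 1) ^ k') ^ k := by gcongr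
    _ = _ := by rw [mul_pow, ← pow_mul, mul_assoc]

end PolyBdd

/-! ### Functions computed in polynomial time -/

/-- Some program maps `inp i` to `out i` in time polynomial in `n i`. -/
def PolyTime {ι : Type} (n : ι → ℕ) (inp out : ι → Data) : Prop :=
  ∃ p : Prog, ∃ T : ι → ℕ, PolyBdd n T ∧ ∀ i, ∃ t ≤ T i, Run p (inp i) (out i) t

namespace PolyTime

variable {ι : Type} {n : ι → ℕ} {inp mid out out₁ out₂ : ι → Data}

theorem exists_runsInPolyTime {size : ι → ℕ} (hs : PolyBdd size n) (h : PolyTime n inp out) :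
    ∃ p, RunsInPolyTime p (fun _ => True) size inp out := by
  obtain ⟨p, T, hT, h⟩ := h
  obtain ⟨K, k, hT⟩ := hT.trans hs
  refine ⟨p, K, k, fun i _ => ?_⟩
  obtain ⟨t, ht, hr⟩ := h i
  exact ⟨t, ht.trans (hT i), hr⟩

theorem reindex {κ : Type} (φ : κ → ι) (h : PolyTime n inp out) :
    PolyTime (fun j => n (φ j)) (fun j => inp (φ j)) fun j => out (φ j) := by
  obtain ⟨p, T, hT, h⟩ := h
  exact ⟨p, _, hT.reindex φ, fun j => h (φ j)⟩

theorem congr (h : PolyTime n inp out) (ho : ∀ i, out i = out₁ i) : PolyTime n inp out₁ := by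
  rwa [show out₁ = out from funext fun i => (ho i).symm]

theorem id : PolyTime n inp inp := ⟨.id, _, .const 1, fun _ => ⟨1, le_rfl, .id _⟩⟩

theorem nil : PolyTime n inp fun _ => Data.nil := ⟨.nil, _, .const 1, fun _ => ⟨1, le_rfl, .nil _⟩⟩

theorem comp (h : PolyTime n inp mid) (h' : PolyTime n mid out) : PolyTime n inp out := by
  obtain ⟨p, T, hT, h⟩ := h
  obtain ⟨q, U, hU, h'⟩ := h'
  refine ⟨.comp q p, _, (hT.add hU).add (.const 1), fun i => ?_⟩
  obtain ⟨s, hs, hr⟩ := h i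
  obtain ⟨t, ht, hr'⟩ := h' i
  exact ⟨_, by omega, .comp hr hr'⟩

theorem cons (h : PolyTime n inp out₁) (h' : PolyTime n inp out₂) :
    PolyTime n inp fun i => Data.cons (out₁ i) (out₂ i) := by
  obtain ⟨p, T, hT, h⟩ := h
  obtain ⟨q, U, hU, h'⟩ := h'
  refine ⟨.cons p q, _, (hT.add hU).add (.const 1), fun i => ?_⟩
  obtain ⟨s, hs, hr⟩ := h i
  obtain ⟨t, ht, hr'⟩ := h' i
  exact ⟨_, by omega, .cons hr hr'⟩

theorem hd (h : PolyTime n inp fun i => Data.cons (out₁ i) (out₂ i)) : PolyTime n inp out₁ :=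
  h.comp ⟨.hd, _, .const 1, fun _ => ⟨1, le_rfl, .hd_cons _ _⟩⟩

theorem tl (h : PolyTime n inp fun i => Data.cons (out₁ i) (out₂ i)) : PolyTime n inp out₂ :=
  h.comp ⟨.tl, _, .const 1, fun _ => ⟨1, le_rfl, .tl_cons _ _⟩⟩

/-- Each branch has to be right only on the instances that reach it, which lets correctness
arguments use the outcome of the test. -/
theorem ite_data {c : ι → Data} (hc : PolyTime n inp c)
    (h : PolyTime (ι := {i // c i ≠ Data.nil}) (fun i => n i) (fun i => inp i) fun i => out i)
    (h' : PolyTime (ι := {i // c i = Data.nil}) (fun i => n i) (fun i => inp i) fun i => out i) :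
    PolyTime n inp out := by
  classical
  obtain ⟨r, S, hS, hc⟩ := hc
  obtain ⟨p, T, ⟨K, k, hT⟩, h⟩ := h
  obtain ⟨q, U, ⟨K', k', hU⟩, h'⟩ := h'
  -- The time bounds of the branches are defined only on subtypes, so their polynomial bounds, which
  -- make sense for every `i`, take their place.
  refine ⟨.ite r p q, fun i => S i + (K * (n i + 1) ^ k + K' * (n i + 1) ^ k') + 1,
    (hS.add (.add ⟨K, k, fun _ => le_rfl⟩ ⟨K', k', fun _ => le_rfl⟩)).add (.const 1), fun i => ?_⟩
  obtain ⟨s, hs, hr⟩ := hc i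
  by_cases hi : c i = Data.nil
  · obtain ⟨t, ht, hr'⟩ := h' ⟨i, hi⟩
    have := hU ⟨i, hi⟩
    rw [hi] at hr
    refine ⟨_, ?_, .ite_else hr hr'⟩
    dsimp only at this ⊢
    omega
  · obtain ⟨t, ht, hr'⟩ := h ⟨i, hi⟩
    have := hT ⟨i, hi⟩
    obtain ⟨a, b, hab⟩ : ∃ a b, c i = Data.cons a b := by
      cases hci : c i with
      | nil => exact absurd hci hi
      | cons a b => exact ⟨a, b, rfl⟩
    rw [hab] at hr
    refine ⟨_, ?_, .ite_then hr hr'⟩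
    dsimp only at this ⊢
    omega

open Classical in
theorem ite {c : ι → Prop} (hc : PolyTime n inp fun i => Data.ofProp (c i))
    (h : PolyTime n inp out₁) (h' : PolyTime n inp out₂) :
    PolyTime n inp fun i => if c i then out₁ i else out₂ i := by
  refine ite_data hc ?_ ?_
  · refine (h.reindex Subtype.val).congr fun i => ?_
    have := i.2
    rw [if_pos]
    by_contra hi
    simp [Data.ofProp, hi] at this
  · refine (h'.reindex Subtype.val).congr fun i => ?_
    have := i.2
    rw [if_neg]
    intro hi
    simp [Data.ofProp, hi] at this

/-! ### Contexts -/

variable {β : ι → Type}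

/-- A value computed from the context can be computed from an extended context. -/
theorem weaken {e : (Σ i, β i) → Data} (h : PolyTime n inp out) :
    PolyTime (fun q : Σ i, β i => n q.1) (fun q => Data.cons (inp q.1) (e q)) fun q => out q.1 :=
  (hd id).comp (h.reindex (Sigma.fst (β := β)))

/-- The value by which a context is extended. -/
theorem new {e : (Σ i, β i) → Data} :
    PolyTime (fun q : Σ i, β i => n q.1) (fun q => Data.cons (inp q.1) (e q)) e := tl id

/-! ### Loops -/

variable {α : ι → Type} {encα : ∀ i, α i → Data} {encβ : ∀ i, β i → Data}

/-- The body is required to work for all accumulator values, within a time depending on `n` alone.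
The total is then the list length times one polynomial, without any control on the size of the
accumulator. -/
theorem foldl {L : ∀ i, List (β i)} {a : ∀ i, α i} {f : ∀ i, α i → β i → α i}
    (hl : PolyBdd n fun i => (L i).length)
    (hL : PolyTime n inp fun i => Data.ofList ((L i).map (encβ i)))
    (ha : PolyTime n inp fun i => encα i (a i))
    (hf : PolyTime (ι := Σ i, β i × α i) (fun q => n q.1)
      (fun q => Data.cons (inp q.1) (Data.cons (encβ q.1 q.2.1) (encα q.1 q.2.2)))
      fun q => encα q.1 (f q.1 q.2.2 q.2.1)) :
    PolyTime n inp fun i => encα i ((L i).foldl (f i) (a i)) := by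
  -- The loop state is the context, the remaining list and the accumulator; when the list is `nil`,
  -- two tails leave the accumulator.
  refine tl (out₁ := fun _ => Data.nil) (tl (out₁ := inp) ?_)
  refine comp (cons id (cons hL ha)) ?_
  obtain ⟨p, T, ⟨K, k, hT⟩, h⟩ := hf
  let c : Prog := .comp .hd .tl
  let body : Prog := .cons .hd (.cons (.comp .tl (.comp .hd .tl))
    (.comp p (.cons .hd (.cons (.comp .hd (.comp .hd .tl)) (.comp .tl .tl)))))
  -- Besides the call of `p`, one round takes 24 steps, covered by `30`; the final failing test
  -- takes `4`.
  refine ⟨.loop c body, _, ((hl.mul (U := fun i => K * (n i + 1) ^ k + 30)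
    (.add ⟨K, k, fun _ => le_rfl⟩ (.const _))).add (.const 4)), fun i => ?_⟩
  dsimp only
  generalize a i = x
  induction L i generalizing x with
  | nil =>
    refine ⟨4, by simp, ?_⟩
    constructor
    exact .comp (.tl_cons _ _) (.hd_cons _ _)
  | cons b l ih =>
    obtain ⟨t, ht, hr⟩ := ih (f i x b)
    obtain ⟨s, hs, hr'⟩ := h ⟨i, b, x⟩
    have hT' := hT ⟨i, b, x⟩
    dsimp only at hs hr' hT'
    have hc : Run c (Data.cons (inp i) (Data.cons (Data.ofList ((b :: l).map (encβ i))) (encα i x)))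
        (Data.cons (encβ i b) (Data.ofList (l.map (encβ i)))) 3 :=
      .comp (.tl_cons _ _) (.hd_cons _ _)
    have hb : Run body
        (Data.cons (inp i) (Data.cons (Data.ofList ((b :: l).map (encβ i))) (encα i x)))
        (Data.cons (inp i) (Data.cons (Data.ofList (l.map (encβ i))) (encα i (f i x b)))) _ :=
      .cons (.hd_cons _ _) (.cons (.comp hc (.tl_cons _ _))
        (.comp (.cons (.hd_cons _ _) (.cons (.comp hc (.hd_cons _ _))
          (.comp (.tl_cons _ _) (.tl_cons _ _)))) hr'))
    refine ⟨_, ?_, .loop_step hc hb hr⟩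
    simp only [List.length_cons]
    have e : (l.length + 1) * (K * (n i + 1) ^ k + 30) =
      l.length * (K * (n i + 1) ^ k + 30) + K * (n i + 1) ^ k + 30 := by ring
    omega

theorem reverse {L : ι → List Data} (hl : PolyBdd n fun i => (L i).length)
    (hL : PolyTime n inp fun i => Data.ofList (L i)) :
    PolyTime n inp fun i => Data.ofList (L i).reverse := by
  have h := foldl (n := n) (inp := inp) (α := fun _ => List Data) (β := fun _ => Data)
    (encα := fun _ => Data.ofList) (encβ := fun _ d => d) (L := L) (a := fun _ => [])
    (f := fun _ l d => d :: l) hl (by simpa using hL) nil (cons (hd (tl id)) (tl (tl id)))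
  refine h.congr fun i => ?_
  rw [← List.foldr_reverse]
  congr 1
  simp

theorem map {γ : ι → Type} {encγ : ∀ i, γ i → Data} {L : ∀ i, List (β i)} {g : ∀ i, β i → γ i}
    (hl : PolyBdd n fun i => (L i).length)
    (hL : PolyTime n inp fun i => Data.ofList ((L i).map (encβ i)))
    (hg : PolyTime (ι := Σ i, β i) (fun q => n q.1)
      (fun q => Data.cons (inp q.1) (encβ q.1 q.2)) fun q => encγ q.1 (g q.1 q.2)) :
    PolyTime n inp fun i => Data.ofList ((L i).map fun b => encγ i (g i b)) := by
  have h := foldl (n := n) (inp := inp) (α := fun _ => List Data) (β := β)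
    (encα := fun _ => Data.ofList) (encβ := encβ) (L := L) (a := fun _ => [])
    (f := fun i l b => encγ i (g i b) :: l) hl hL nil
    (cons ((cons (hd id) (hd (tl id))).comp
      (hg.reindex (κ := Σ i, β i × List Data) fun q => ⟨q.1, q.2.1⟩)) (tl (tl id)))
  have e : ∀ i, (L i).foldl (fun l b => encγ i (g i b) :: l) [] =
      ((L i).map fun b => encγ i (g i b)).reverse := by
    intro i
    rw [← List.foldl_map (f := fun b => encγ i (g i b)) (g := fun l d => d :: l),
      ← List.foldr_reverse]
    simp
  have h2 := reverse (hl.mono fun i => by simp [e]) h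
  exact h2.congr fun i => by rw [e, List.reverse_reverse]

end PolyTime

/-- A bit, as a tree. -/
noncomputable def Data.bit (a : ZMod 2) : Data := Data.ofProp (a = 1)

theorem Data.table_eq {N : ℕ} (f : Fin N → Data) :
    Data.table f = Data.ofList ((List.finRange N).map f) := by
  rw [Data.table, List.ofFn_eq_map]

theorem ZMod.two_cases (a : ZMod 2) : a = 0 ∨ a = 1 := by revert a; decide

namespace PolyTime

variable {ι : Type} {n : ι → ℕ} {inp : ι → Data}

/-! ### Truth values and bits -/

theorem true_ : PolyTime n inp fun _ => Data.ofProp True :=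
  (cons nil nil).congr fun i => by simp [Data.ofProp]

theorem false_ : PolyTime n inp fun _ => Data.ofProp False := nil.congr fun i => by simp [Data.ofProp]

theorem not {P : ι → Prop} (hP : PolyTime n inp fun i => Data.ofProp (P i)) :
    PolyTime n inp fun i => Data.ofProp (¬ P i) :=
  (ite hP false_ true_).congr fun i => by by_cases h : P i <;> simp [h]

theorem and {P Q : ι → Prop} (hP : PolyTime n inp fun i => Data.ofProp (P i))
    (hQ : PolyTime n inp fun i => Data.ofProp (Q i)) :
    PolyTime n inp fun i => Data.ofProp (P i ∧ Q i) :=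
  (ite hP hQ false_).congr fun i => by by_cases h : P i <;> simp [h]

theorem zero : PolyTime n inp fun _ => Data.bit 0 := false_.congr fun i => by simp [Data.bit]

theorem one : PolyTime n inp fun _ => Data.bit 1 := true_.congr fun i => by simp [Data.bit]

open Classical in
theorem ite_bit {c : ι → Prop} {a b : ι → ZMod 2} (hc : PolyTime n inp fun i => Data.ofProp (c i))
    (ha : PolyTime n inp fun i => Data.bit (a i)) (hb : PolyTime n inp fun i => Data.bit (b i)) :
    PolyTime n inp fun i => Data.bit (if c i then a i else b i) :=
  (ite hc ha hb).congr fun i => by by_cases h : c i <;> simp [h]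

theorem add {a b : ι → ZMod 2} (ha : PolyTime n inp fun i => Data.bit (a i))
    (hb : PolyTime n inp fun i => Data.bit (b i)) :
    PolyTime n inp fun i => Data.bit (a i + b i) :=
  (ite ha (not hb) hb).congr fun i => by
    rcases ZMod.two_cases (a i) with h | h <;> rcases ZMod.two_cases (b i) with h' | h' <;>
      simp [h, h', Data.bit, ZMod.two_add_self]

/-! ### Lists and numbers -/

theorem tail {l : ι → List Data} (h : PolyTime n inp fun i => Data.ofList (l i)) :
    PolyTime n inp fun i => Data.ofList (l i).tail := by
  refine h.comp ⟨.tl, _, .const 1, fun i => ⟨1, le_rfl, ?_⟩⟩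
  dsimp only
  cases l i with
  | nil => exact .tl_nil
  | cons a l => exact .tl_cons _ _

theorem ofNat_eq (k : ℕ) : Data.ofNat k =
    Data.ofList ((List.replicate k ()).map fun _ => Data.nil) := by
  simp [Data.ofNat]

/-- A unary number is a list, so it can drive a loop that takes tails. Table lookup, subtraction and
comparison are all derived from this. -/
theorem drop {k : ι → ℕ} {l : ι → List Data} (hb : PolyBdd n k)
    (hk : PolyTime n inp fun i => Data.ofNat (k i))
    (h : PolyTime n inp fun i => Data.ofList (l i)) :
    PolyTime n inp fun i => Data.ofList ((l i).drop (k i)) := by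
  have := foldl (n := n) (inp := inp) (α := fun _ => List Data) (β := fun _ => Unit)
    (encα := fun _ => Data.ofList) (encβ := fun _ _ => Data.nil)
    (L := fun i => List.replicate (k i) ()) (a := l) (f := fun _ l _ => l.tail)
    (hb.mono fun i => by simp) (hk.congr fun i => ofNat_eq _) h (tail (tl (tl id)))
  refine this.congr fun i => congrArg _ ?_
  generalize l i = l
  induction k i generalizing l with
  | zero => simp
  | succ k ih => rw [List.replicate_succ, List.foldl_cons, ih]; simp

theorem lookup {f : ∀ i, Fin (n i) → Data} {k : ∀ i, Fin (n i)}
    (hf : PolyTime n inp fun i => Data.table (f i))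
    (hk : PolyTime n inp fun i => Data.ofNat (k i)) :
    PolyTime n inp fun i => f i (k i) := by
  have h := drop (PolyBdd.self.mono fun i => (k i).2.le) hk hf
  refine hd (out₂ := fun i => Data.ofList ((List.ofFn (f i)).drop (k i + 1))) (h.congr fun i => ?_)
  rw [List.drop_eq_getElem_cons (by simp)]
  simp [Data.ofList]

theorem sub {a b : ι → ℕ} (hb : PolyBdd n b) (h : PolyTime n inp fun i => Data.ofNat (a i))
    (h' : PolyTime n inp fun i => Data.ofNat (b i)) :
    PolyTime n inp fun i => Data.ofNat (a i - b i) :=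
  (drop hb h' h).congr fun i => by simp [Data.ofNat]

theorem le {a b : ι → ℕ} (hb : PolyBdd n b) (h : PolyTime n inp fun i => Data.ofNat (a i))
    (h' : PolyTime n inp fun i => Data.ofNat (b i)) :
    PolyTime n inp fun i => Data.ofProp (a i ≤ b i) := by
  refine ite_data (sub hb h h') ?_ ?_
  · refine (false_.congr fun i => ?_)
    have hi := i.2
    congr 1
    rw [eq_iff_iff, false_iff, ← Nat.sub_eq_zero_iff_le]
    intro h0
    simp [h0, Data.ofNat, Data.ofList] at hi
  · refine (true_.congr fun i => ?_)
    have hi := i.2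
    congr 1
    rw [eq_iff_iff, true_iff, ← Nat.sub_eq_zero_iff_le]
    cases h0 : a i.1 - b i.1 with
    | zero => rfl
    | succ k => simp [h0, Data.ofNat, List.replicate_succ, Data.ofList] at hi

theorem eq {a b : ∀ i, Fin (n i)} (h : PolyTime n inp fun i => Data.ofNat (a i))
    (h' : PolyTime n inp fun i => Data.ofNat (b i)) :
    PolyTime n inp fun i => Data.ofProp (a i = b i) :=
  (and (le (PolyBdd.self.mono fun i => (b i).2.le) h h')
    (le (PolyBdd.self.mono fun i => (a i).2.le) h' h)).congr fun i => by
      rw [← le_antisymm_iff, Fin.val_inj]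

/-! ### Tables -/

theorem map_table {β : ι → Type} {encβ : ∀ i, β i → Data} {f : ∀ i, Fin (n i) → β i}
    {g : ∀ i, β i → Data}
    (hf : PolyTime n inp fun i => Data.table fun x => encβ i (f i x))
    (hg : PolyTime (ι := Σ i, β i) (fun q => n q.1)
      (fun q => Data.cons (inp q.1) (encβ q.1 q.2)) fun q => g q.1 q.2) :
    PolyTime n inp fun i => Data.table fun x => g i (f i x) := by
  have := map (n := n) (inp := inp) (encβ := encβ) (encγ := fun _ d => d)
    (L := fun i => (List.finRange (n i)).map (f i)) (g := g) (PolyBdd.self.mono fun i => by simp)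
    (hf.congr fun i => by rw [Data.table_eq, List.map_map]; rfl) hg
  exact this.congr fun i => by rw [Data.table_eq, List.map_map]; rfl

/-- The table of the identity can be computed from the input. -/
def HasIndices (n : ι → ℕ) (inp : ι → Data) : Prop :=
  PolyTime n inp fun i => Data.table fun x : Fin (n i) => Data.ofNat x

theorem HasIndices.weaken {β : ι → Type} {e : (Σ i, β i) → Data} (h : HasIndices n inp) :
    HasIndices (fun q : Σ i, β i => n q.1) (fun q => Data.cons (inp q.1) (e q)) :=
  PolyTime.weaken h

/-- The input contains no list of indices, but looking up each entry of the table of an involution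
in that same table produces one. -/
theorem hasIndices_of_involutive {t : ∀ i, Fin (n i) → Fin (n i)} (ht : ∀ i x, t i (t i x) = x)
    (h : PolyTime n inp fun i => Data.table fun x => Data.ofNat (t i x)) : HasIndices n inp := by
  have := map_table (n := n) (inp := inp) (β := fun i => Fin (n i)) (encβ := fun _ x => Data.ofNat x)
    (f := t) (g := fun i x => Data.ofNat (t i x)) h
    (lookup (n := fun q : Σ i, Fin (n i) => n q.1) (f := fun q x => Data.ofNat (t q.1 x)) h.weaken new)
  exact this.congr fun i => by simp only [ht]

theorem tabulate (hi : HasIndices n inp) {g : ∀ i, Fin (n i) → Data}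
    (hg : PolyTime (ι := Σ i, Fin (n i)) (fun q => n q.1)
      (fun q => Data.cons (inp q.1) (Data.ofNat q.2)) fun q => g q.1 q.2) :
    PolyTime n inp fun i => Data.table (g i) :=
  map_table (β := fun i => Fin (n i)) (encβ := fun _ x => Data.ofNat x) (f := fun _ x => x) hi hg

theorem foldl_table {α : ι → Type} {encα : ∀ i, α i → Data}
    {β : ι → Type} {encβ : ∀ i, β i → Data} {b : ∀ i, Fin (n i) → β i}
    {a : ∀ i, α i} {f : ∀ i, α i → β i → α i}
    (hb : PolyTime n inp fun i => Data.table fun x => encβ i (b i x))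
    (ha : PolyTime n inp fun i => encα i (a i))
    (hf : PolyTime (ι := Σ i, β i × α i) (fun q => n q.1)
      (fun q => Data.cons (inp q.1) (Data.cons (encβ q.1 q.2.1) (encα q.1 q.2.2)))
      fun q => encα q.1 (f q.1 q.2.2 q.2.1)) :
    PolyTime n inp fun i =>
      encα i ((List.finRange (n i)).foldl (fun s x => f i s (b i x)) (a i)) := by
  have := foldl (n := n) (inp := inp) (L := fun i => (List.finRange (n i)).map (b i))
    (PolyBdd.self.mono fun i => by simp)
    (hb.congr fun i => by rw [Data.table_eq, List.map_map]; rfl) ha hf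
  exact this.congr fun i => by rw [List.foldl_map]

theorem sum {g : ∀ i, Fin (n i) → ZMod 2} (hi : HasIndices n inp)
    (hg : PolyTime (ι := Σ i, Fin (n i)) (fun q => n q.1)
      (fun q => Data.cons (inp q.1) (Data.ofNat q.2)) fun q => Data.bit (g q.1 q.2)) :
    PolyTime n inp fun i => Data.bit (∑ x, g i x) := by
  have h := foldl_table (n := n) (inp := inp) (α := fun _ => ZMod 2) (β := fun _ => ZMod 2)
    (encα := fun _ => Data.bit) (encβ := fun _ => Data.bit) (b := g) (a := fun _ => 0)
    (f := fun _ s c => s + c) (tabulate hi hg) zero (add (tl (tl id)) (hd (tl id)))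
  refine h.congr fun i => congrArg _ ?_
  rw [Fin.sum_univ_def, List.sum_eq_foldl, List.foldl_map]

end PolyTime

/-! ### Orbits -/

/-- Give all flags with the label of `x` the label of `t x`. -/
def relabel {N : ℕ} (t L : Fin N → Fin N) (x : Fin N) : Fin N → Fin N :=
  fun y => if L y = L x then L (t x) else L y

/-- Labels of the orbits of `a` and `b`. -/
def orbitLabel {N : ℕ} (a b : Fin N → Fin N) : Fin N → Fin N :=
  (List.finRange N).foldl (relabel b) ((List.finRange N).foldl (relabel a) fun x => x)

theorem relabel_eq_of_eq {N : ℕ} {t L : Fin N → Fin N} {x y z : Fin N} (h : L y = L z) :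
    relabel t L x y = relabel t L x z := by simp only [relabel, h]

theorem foldl_relabel_eq_of_eq {N : ℕ} {t : Fin N → Fin N} {l : List (Fin N)} {L : Fin N → Fin N}
    {y z : Fin N} (h : L y = L z) : l.foldl (relabel t) L y = l.foldl (relabel t) L z := by
  induction l generalizing L with
  | nil => exact h
  | cons x l ih => exact ih (relabel_eq_of_eq h)

/-- Processing `x` makes the labels of `x` and `t x` equal, and later mergings never separate equal
labels. -/
theorem foldl_relabel_apply {N : ℕ} {t : Fin N → Fin N} {l : List (Fin N)} {L : Fin N → Fin N}
    {x : Fin N} (hx : x ∈ l) : l.foldl (relabel t) L (t x) = l.foldl (relabel t) L x := by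
  induction l generalizing L with
  | nil => simp at hx
  | cons y l ih =>
    rcases List.mem_cons.1 hx with h | hx
    · have h' : relabel t L y (t x) = relabel t L y x := by rw [h]; simp [relabel]
      exact foldl_relabel_eq_of_eq (l := l) h'
    · exact ih hx

theorem foldl_relabel_invariant {N : ℕ} {t : Fin N → Fin N} {β : Type*} {π : Fin N → β}
    (ht : ∀ x, π (t x) = π x) {l : List (Fin N)} {L : Fin N → Fin N} (hL : ∀ x, π (L x) = π x)
    (x : Fin N) : π (l.foldl (relabel t) L x) = π x := by
  induction l generalizing L with
  | nil => exact hL x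
  | cons y l ih =>
    refine ih fun z => ?_
    simp only [relabel]
    split_ifs with h
    · rw [hL, ht, ← hL y, ← h, hL]
    · exact hL z

/-- Labels are flags that never leave the class of their flag, so equal labels imply equal classes.
Conversely the final labels are invariant under both maps, and `h` says that such functions are
constant on classes. -/
theorem orbitLabel_eq_iff {N : ℕ} {a b : Fin N → Fin N} {β : Type*} {π : Fin N → β}
    (ha : ∀ x, π (a x) = π x) (hb : ∀ x, π (b x) = π x)
    (h : ∀ L : Fin N → Fin N, (∀ x, L (a x) = L x) → (∀ x, L (b x) = L x) →
      ∀ x y, π x = π y → L x = L y) (x y : Fin N) :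
    orbitLabel a b x = orbitLabel a b y ↔ π x = π y := by
  constructor
  · intro hxy
    have key : ∀ z, π (orbitLabel a b z) = π z :=
      foldl_relabel_invariant hb (foldl_relabel_invariant ha fun _ => rfl)
    rw [← key x, hxy, key]
  · exact h _ (fun x => foldl_relabel_eq_of_eq (foldl_relabel_apply (List.mem_finRange x)))
      (fun x => foldl_relabel_apply (List.mem_finRange x)) x y

/-! ### Orbit labels as a program -/

namespace PolyTime

variable {ι : Type} {n : ι → ℕ} {inp : ι → Data}

theorem foldl_relabel (hi : HasIndices n inp) {t L : ∀ i, Fin (n i) → Fin (n i)}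
    (ht : PolyTime n inp fun i => Data.table fun x => Data.ofNat (t i x))
    (hL : PolyTime n inp fun i => Data.table fun x => Data.ofNat (L i x)) :
    PolyTime n inp fun i => Data.table fun y =>
      Data.ofNat ((List.finRange (n i)).foldl (relabel (t i)) (L i) y) := by
  refine foldl_table (n := n) (inp := inp) (α := fun i => Fin (n i) → Fin (n i))
    (encα := fun i L => Data.table fun y => Data.ofNat (L y)) (β := fun i => Fin (n i))
    (encβ := fun i x => Data.ofNat x) (b := fun _ x => x) (a := L) (f := fun i => relabel (t i))
    hi hL ?_
  have hx : PolyTime (ι := Σ i, Fin (n i) × (Fin (n i) → Fin (n i))) (fun q => n q.1)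
      (fun q => Data.cons (inp q.1) (Data.cons (Data.ofNat q.2.1)
        (Data.table fun y => Data.ofNat (q.2.2 y)))) fun q => Data.ofNat q.2.1 := hd (tl id)
  have hL' : PolyTime (ι := Σ i, Fin (n i) × (Fin (n i) → Fin (n i))) (fun q => n q.1)
      (fun q => Data.cons (inp q.1) (Data.cons (Data.ofNat q.2.1)
        (Data.table fun y => Data.ofNat (q.2.2 y)))) fun q =>
        Data.table fun y => Data.ofNat (q.2.2 y) := tl (tl id)
  have ht' := ht.weaken (β := fun i => Fin (n i) × (Fin (n i) → Fin (n i)))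
    (e := fun q => Data.cons (Data.ofNat q.2.1) (Data.table fun y => Data.ofNat (q.2.2 y)))
  have hLx := lookup (n := fun q : Σ i, Fin (n i) × (Fin (n i) → Fin (n i)) => n q.1)
    (f := fun q y => Data.ofNat (q.2.2 y)) (k := fun q => q.2.1) hL' hx
  have htx := lookup (n := fun q : Σ i, Fin (n i) × (Fin (n i) → Fin (n i)) => n q.1)
    (f := fun q y => Data.ofNat (t q.1 y)) (k := fun q => q.2.1) ht' hx
  have hLtx := lookup (n := fun q : Σ i, Fin (n i) × (Fin (n i) → Fin (n i)) => n q.1)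
    (f := fun q y => Data.ofNat (q.2.2 y)) (k := fun q => t q.1 q.2.1) hL' htx
  refine tabulate hi.weaken ?_
  have hLy := lookup (n := fun r : Σ q : (Σ i, Fin (n i) × (Fin (n i) → Fin (n i))), Fin (n q.1) =>
      n r.1.1) (f := fun r y => Data.ofNat (r.1.2.2 y)) (k := fun r => r.2)
    (hL'.weaken (e := fun r => Data.ofNat r.2)) (tl id)
  refine (ite (eq (n := fun r : Σ q : (Σ i, Fin (n i) × (Fin (n i) → Fin (n i))), Fin (n q.1) =>
      n r.1.1) (a := fun r => r.1.2.2 r.2) (b := fun r => r.1.2.2 r.1.2.1)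
      hLy hLx.weaken) hLtx.weaken hLy).congr fun r => ?_
  simp only [relabel]
  split_ifs <;> rfl

theorem orbitLabel (hi : HasIndices n inp) {a b : ∀ i, Fin (n i) → Fin (n i)}
    (ha : PolyTime n inp fun i => Data.table fun x => Data.ofNat (a i x))
    (hb : PolyTime n inp fun i => Data.table fun x => Data.ofNat (b i x)) :
    PolyTime n inp fun i => Data.table fun x => Data.ofNat (orbitLabel (a i) (b i) x) :=
  foldl_relabel hi hb (foldl_relabel hi ha hi)

end PolyTime

namespace SurfaceMap

variable {N : ℕ} (M : SurfaceMap (Fin N))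

theorem vertexOf_eq_iff (x y : Fin N) :
    orbitLabel M.t1 M.t2 x = orbitLabel M.t1 M.t2 y ↔ M.vertexOf x = M.vertexOf y :=
  orbitLabel_eq_iff M.vertexOf_t1 M.vertexOf_t2 (fun L h1 h2 x y h => by
    obtain ⟨F, hF⟩ := M.vertexOf_lift h1 h2
    rw [← hF, ← hF, h]) x y

theorem edgeOf_eq_iff (x y : Fin N) :
    orbitLabel M.t0 M.t2 x = orbitLabel M.t0 M.t2 y ↔ M.edgeOf x = M.edgeOf y :=
  orbitLabel_eq_iff M.edgeOf_t0 M.edgeOf_t2 (fun L h1 h2 x y h => by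
    obtain ⟨F, hF⟩ := M.edgeOf_lift h1 h2
    rw [← hF, ← hF, h]) x y

theorem faceOf_eq_iff (x y : Fin N) :
    orbitLabel M.t0 M.t1 x = orbitLabel M.t0 M.t1 y ↔ M.faceOf x = M.faceOf y :=
  orbitLabel_eq_iff M.faceOf_t0 M.faceOf_t1 (fun L h1 h2 x y h => by
    obtain ⟨F, hF⟩ := M.faceOf_lift h1 h2
    rw [← hF, ← hF, h]) x y

end SurfaceMap

/-! ### Gaussian elimination -/

section Elimination

variable {N : ℕ}

/-- A row with a `1` at `y`, if there is one. -/
def pivot (R : Fin N → Pauli (Fin N)) (y : Fin N) : Pauli (Fin N) :=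
  (List.finRange N).foldl (fun p x => if (R x).1 y = 1 then R x else p) 0

/-- Clear the entry `y` of a row with the row `p`. -/
def reduceRow (p : Pauli (Fin N)) (y : Fin N) (r : Pauli (Fin N)) : Pauli (Fin N) :=
  if r.1 y = 1 then r + p else r

/-- Clear the entry `y` of all rows and of the target. -/
def eliminateAt (S : (Fin N → Pauli (Fin N)) × Pauli (Fin N)) (y : Fin N) :
    (Fin N → Pauli (Fin N)) × Pauli (Fin N) :=
  (fun x => reduceRow (pivot S.1 y) y (S.1 x), reduceRow (pivot S.1 y) y S.2)

/-- Clear all entries. -/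
def eliminate (S : (Fin N → Pauli (Fin N)) × Pauli (Fin N)) :
    (Fin N → Pauli (Fin N)) × Pauli (Fin N) :=
  (List.finRange N).foldl eliminateAt S

theorem foldl_pivot (R : Fin N → Pauli (Fin N)) (y : Fin N) (l : List (Fin N))
    (p : Pauli (Fin N)) (hp : p = 0 ∨ ∃ x, p = R x ∧ (R x).1 y = 1) :
    (l.foldl (fun p x => if (R x).1 y = 1 then R x else p) p = 0 ∧ ∀ x ∈ l, (R x).1 y = 0) ∨
      ∃ x, l.foldl (fun p x => if (R x).1 y = 1 then R x else p) p = R x ∧ (R x).1 y = 1 := by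
  induction l generalizing p with
  | nil => simpa using hp
  | cons z l ih =>
    rw [List.foldl_cons]
    rcases ZMod.two_cases ((R z).1 y) with h | h
    · simp only [h, zero_ne_one, if_false, List.mem_cons, forall_eq_or_imp, true_and]
      exact ih p hp
    · rw [if_pos h]
      rcases ih (R z) (Or.inr ⟨z, rfl, h⟩) with ⟨h1, h2⟩ | h'
      · exfalso
        -- Once a row with a `1` at `y` is held, it is replaced only by another such row, so the
        -- outcome cannot be zero.
        have key : ∀ (l : List (Fin N)) (p : Pauli (Fin N)), p.1 y = 1 →
            (l.foldl (fun p x => if (R x).1 y = 1 then R x else p) p).1 y = 1 := by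
          intro l
          induction l with
          | nil => exact fun p hp => hp
          | cons w l ih =>
            intro p hp
            refine ih _ ?_
            beta_reduce
            split_ifs with hw
            · exact hw
            · exact hp
        have := key l (R z) h
        rw [h1] at this
        simp at this
      · exact Or.inr h'

theorem pivot_spec (R : Fin N → Pauli (Fin N)) (y : Fin N) :
    (pivot R y = 0 ∧ ∀ x, (R x).1 y = 0) ∨ ∃ x, pivot R y = R x ∧ (R x).1 y = 1 := by
  simpa [pivot] using foldl_pivot R y (List.finRange N) 0 (Or.inl rfl)

theorem reduceRow_eq (p r : Pauli (Fin N)) (y : Fin N) : reduceRow p y r = r + r.1 y • p := by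
  rcases ZMod.two_cases (r.1 y) with h | h <;> simp [reduceRow, h]

/-- The target changes only by adding pivots, and these are zero or current rows, which stay in any
group containing the original rows. -/
theorem foldl_eliminateAt_mem {G : AddSubgroup (Pauli (Fin N))} (l : List (Fin N))
    {S : (Fin N → Pauli (Fin N)) × Pauli (Fin N)} (hS : ∀ x, S.1 x ∈ G) :
    (l.foldl eliminateAt S).2 - S.2 ∈ G := by
  induction l generalizing S with
  | nil => simp
  | cons y l ih =>
    have hp : pivot S.1 y ∈ G := by
      rcases pivot_spec S.1 y with h | ⟨x, h, -⟩
      · rw [h.1]; exact G.zero_mem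
      · rw [h]; exact hS x
    have hr : ∀ r, reduceRow (pivot S.1 y) y r - r ∈ G := fun r => by
      unfold reduceRow
      split_ifs
      · simpa using hp
      · simp
    have h := ih (S := eliminateAt S y) fun x => by
      have := G.add_mem (hr (S.1 x)) (hS x)
      rwa [sub_add_cancel] at this
    have := G.add_mem h (hr S.2)
    rwa [eliminateAt, sub_add_sub_cancel] at this

/-- The pivot is added to every row with a `1` at `y`, itself included, so the column `y` disappears
altogether. Cleared columns remain zero, and the target stays in the span of the rows in the first
component. -/
theorem foldl_eliminateAt_spec (l : List (Fin N)) {S : (Fin N → Pauli (Fin N)) × Pauli (Fin N)}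
    (done : Fin N → Prop) (hd : ∀ z, done z → ∀ x, (S.1 x).1 z = 0)
    (hS : S.2.1 ∈ AddSubgroup.closure (Set.range fun x => (S.1 x).1)) :
    (∀ z, done z ∨ z ∈ l → ∀ x, ((l.foldl eliminateAt S).1 x).1 z = 0) ∧
      (l.foldl eliminateAt S).2.1 ∈
        AddSubgroup.closure (Set.range fun x => ((l.foldl eliminateAt S).1 x).1) := by
  induction l generalizing S done with
  | nil => exact ⟨fun z hz => hd z (by simpa using hz), hS⟩
  | cons y l ih =>
    have hrow : ∀ r : Pauli (Fin N), (reduceRow (pivot S.1 y) y r).1 =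
        r.1 + r.1 y • (pivot S.1 y).1 := fun r => by rw [reduceRow_eq]; rfl
    -- Clearing is the same linear map on all rows and on the target, hence it carries the old span
    -- into the new one.
    let φ : (Fin N → ZMod 2) →+ (Fin N → ZMod 2) :=
      { toFun := fun v => v + v y • (pivot S.1 y).1
        map_zero' := by simp
        map_add' := fun v w => by rw [Pi.add_apply, add_smul]; abel }
    have h := ih (S := eliminateAt S y) (fun z => done z ∨ z = y) (fun z hz x => ?_) ?_
    · refine ⟨fun z hz => h.1 z ?_, h.2⟩
      simpa [or_assoc] using hz
    · simp only [eliminateAt, hrow, Pi.add_apply, Pi.smul_apply, smul_eq_mul]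
      rcases hz with hz | rfl
      · rcases pivot_spec S.1 y with h | ⟨w, h, -⟩
        · simp [hd z hz, h.1]
        · simp [hd z hz, h]
      · rcases pivot_spec S.1 z with h | ⟨w, h, h'⟩
        · simp [h.2]
        · rw [h, h', mul_one]
          exact ZMod.two_add_self _
    · have := AddSubgroup.mem_map_of_mem φ hS
      rw [AddMonoidHom.map_closure, ← Set.range_comp] at this
      simp only [eliminateAt, hrow]
      exact this

/-- When all columns are cleared, the span of the rows is zero, and the target lies in it. -/
theorem eliminate_fst {S : (Fin N → Pauli (Fin N)) × Pauli (Fin N)}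
    (hS : S.2.1 ∈ AddSubgroup.closure (Set.range fun x => (S.1 x).1)) :
    (eliminate S).2.1 = 0 := by
  obtain ⟨h1, h2⟩ := foldl_eliminateAt_spec (List.finRange N) (fun _ => False) (by simp) hS
  have h0 : AddSubgroup.closure (Set.range fun x => ((eliminate S).1 x).1) ≤ ⊥ := by
    rw [AddSubgroup.closure_le]
    rintro _ ⟨x, rfl⟩
    exact funext fun z => h1 z (Or.inr (List.mem_finRange z)) x
  exact h0 h2

/-- A row, as a tree. -/
noncomputable def Data.row (r : Pauli (Fin N)) : Data := Data.cons (Data.bits r.1) (Data.bits r.2)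

end Elimination

/-! ### Gaussian elimination as a program -/

namespace PolyTime

variable {ι : Type} {n : ι → ℕ} {inp : ι → Data}

theorem lookup_bits {f : ∀ i, Fin (n i) → ZMod 2} {k : ∀ i, Fin (n i)}
    (hf : PolyTime n inp fun i => Data.bits (f i))
    (hk : PolyTime n inp fun i => Data.ofNat (k i)) :
    PolyTime n inp fun i => Data.bit (f i (k i)) :=
  lookup (f := fun i x => Data.bit (f i x)) hf hk

theorem tabulate_bits (hi : HasIndices n inp) {g : ∀ i, Fin (n i) → ZMod 2}
    (hg : PolyTime (ι := Σ i, Fin (n i)) (fun q => n q.1)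
      (fun q => Data.cons (inp q.1) (Data.ofNat q.2)) fun q => Data.bit (g q.1 q.2)) :
    PolyTime n inp fun i => Data.bits (g i) :=
  tabulate (g := fun i x => Data.bit (g i x)) hi hg

theorem bits_add (hi : HasIndices n inp) {f g : ∀ i, Fin (n i) → ZMod 2}
    (hf : PolyTime n inp fun i => Data.bits (f i)) (hg : PolyTime n inp fun i => Data.bits (g i)) :
    PolyTime n inp fun i => Data.bits (f i + g i) := by
  refine tabulate_bits (g := fun i => f i + g i) hi ?_
  exact add (lookup_bits (n := fun q : Σ i, Fin (n i) => n q.1) (f := fun q => f q.1)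
    (k := fun q => q.2) hf.weaken (tl id)) (lookup_bits (n := fun q : Σ i, Fin (n i) => n q.1)
    (f := fun q => g q.1) (k := fun q => q.2) hg.weaken (tl id))

theorem reduceRow (hi : HasIndices n inp) {p r : ∀ i, Pauli (Fin (n i))} {y : ∀ i, Fin (n i)}
    (hp : PolyTime n inp fun i => Data.row (p i)) (hr : PolyTime n inp fun i => Data.row (r i))
    (hy : PolyTime n inp fun i => Data.ofNat (y i)) :
    PolyTime n inp fun i => Data.row (reduceRow (p i) (y i) (r i)) := by
  refine (ite (lookup_bits (hd hr) hy) (cons (bits_add hi (hd hr) (hd hp))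
    (bits_add hi (tl hr) (tl hp))) hr).congr fun i => ?_
  simp only [_root_.reduceRow]
  split_ifs <;> rfl

theorem pivot {R : ∀ i, Fin (n i) → Pauli (Fin (n i))} {y : ∀ i, Fin (n i)}
    (hi : HasIndices n inp) (hR : PolyTime n inp fun i => Data.table fun x => Data.row (R i x))
    (hy : PolyTime n inp fun i => Data.ofNat (y i)) :
    PolyTime n inp fun i => Data.row (pivot (R i) (y i)) := by
  have h0 : PolyTime n inp fun i => Data.bits (0 : Fin (n i) → ZMod 2) :=
    tabulate_bits (g := fun i => 0) hi zero
  refine foldl_table (α := fun i => Pauli (Fin (n i))) (β := fun i => Pauli (Fin (n i)))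
    (encα := fun i => Data.row) (encβ := fun i => Data.row) (b := R) (a := fun _ => 0)
    (f := fun i p r => if r.1 (y i) = 1 then r else p) hR (cons h0 h0) ?_
  have hr : PolyTime (ι := Σ i, Pauli (Fin (n i)) × Pauli (Fin (n i))) (fun q => n q.1)
      (fun q => Data.cons (inp q.1) (Data.cons (Data.row q.2.1) (Data.row q.2.2)))
      fun q => Data.row q.2.1 := hd (tl id)
  refine (ite (lookup_bits (n := fun q : Σ i, Pauli (Fin (n i)) × Pauli (Fin (n i)) => n q.1)
    (f := fun q => q.2.1.1) (k := fun q => y q.1) (hd hr) hy.weaken) hr (tl (tl id))).congr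
    fun q => ?_
  split_ifs <;> rfl

theorem eliminateAt (hi : HasIndices n inp)
    {S : ∀ i, (Fin (n i) → Pauli (Fin (n i))) × Pauli (Fin (n i))} {y : ∀ i, Fin (n i)}
    (hR : PolyTime n inp fun i => Data.table fun x => Data.row ((S i).1 x))
    (hr : PolyTime n inp fun i => Data.row (S i).2)
    (hy : PolyTime n inp fun i => Data.ofNat (y i)) :
    PolyTime n inp fun i => Data.cons
      (Data.table fun x => Data.row ((eliminateAt (S i) (y i)).1 x))
      (Data.row (eliminateAt (S i) (y i)).2) := by
  have hp := pivot hi hR hy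
  refine cons (map_table (β := fun i => Pauli (Fin (n i))) (encβ := fun _ => Data.row)
    (f := fun i => (S i).1) (g := fun i r =>
      Data.row (_root_.reduceRow (_root_.pivot (S i).1 (y i)) (y i) r)) hR ?_)
    (reduceRow hi hp hr hy)
  exact reduceRow (n := fun q : Σ i, Pauli (Fin (n i)) => n q.1) (r := fun q => q.2)
    (p := fun q => _root_.pivot (S q.1).1 (y q.1)) (y := fun q => y q.1)
    hi.weaken hp.weaken (tl id) hy.weaken

theorem eliminate (hi : HasIndices n inp) {R : ∀ i, Fin (n i) → Pauli (Fin (n i))}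
    {r : ∀ i, Pauli (Fin (n i))}
    (hR : PolyTime n inp fun i => Data.table fun x => Data.row (R i x))
    (hr : PolyTime n inp fun i => Data.row (r i)) :
    PolyTime n inp fun i => Data.row (eliminate (R i, r i)).2 := by
  refine tl (out₁ := fun i => Data.table fun x => Data.row ((_root_.eliminate (R i, r i)).1 x)) ?_
  refine foldl_table (α := fun i => (Fin (n i) → Pauli (Fin (n i))) × Pauli (Fin (n i)))
    (β := fun i => Fin (n i)) (b := fun i x => x)
    (encα := fun i S => Data.cons (Data.table fun x => Data.row (S.1 x)) (Data.row S.2))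
    (encβ := fun i y => Data.ofNat y) (a := fun i => (R i, r i))
    (f := fun i S y => _root_.eliminateAt S y) hi (cons hR hr) ?_
  exact eliminateAt (n := fun q : Σ i, Fin (n i) ×
    ((Fin (n i) → Pauli (Fin (n i))) × Pauli (Fin (n i))) => n q.1) (S := fun q => q.2.2)
    (y := fun q => q.2.1) hi.weaken (hd (tl (tl id))) (tl (tl (tl id))) (hd (tl id))

end PolyTime

/-! ### A surface code decoder by Gaussian elimination -/

namespace SurfaceMap

variable {N : ℕ} (M : SurfaceMap (Fin N))

/-- The syndrome of a `Z` error together with the error, as a row. -/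
noncomputable def syndromeRow : (M.Edge → ZMod 2) →+ Pauli (Fin N) :=
  AddMonoidHom.mk' (fun c => (fun x => M.zSyndrome c (M.vertexOf x), fun x => c (M.edgeOf x)))
    fun a b => by rw [zSyndrome_add]; rfl

open Classical in
/-- The row of the edge of the flag `x`. -/
noncomputable def edgeRow (x : Fin N) : Pauli (Fin N) := M.syndromeRow (Pi.single (M.edgeOf x) 1)

theorem syndromeRow_mem (c : M.Edge → ZMod 2) :
    M.syndromeRow c ∈ AddSubgroup.closure (Set.range M.edgeRow) := by
  classical
  rw [← Finset.univ_sum_single c, map_sum]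
  refine AddSubgroup.sum_mem _ fun e _ => ?_
  rcases ZMod.two_cases (c e) with h | h
  · simp [h]
  · obtain ⟨x, rfl⟩ := Quot.exists_rep e
    rw [h]
    exact AddSubgroup.subset_closure ⟨x, rfl⟩

/-- The error estimate for the syndrome `s`. -/
noncomputable def eliminationDecoder (s : M.Vertex → ZMod 2) : M.Edge → ZMod 2 :=
  fun e => (eliminate (M.edgeRow, (fun x => s (M.vertexOf x), 0))).2.2 e.out

/-- Every row is a syndrome together with an error causing it. Elimination preserves this relation,
so the second component of the target records the error whose syndrome has been added to the first.
-/
theorem exists_eliminate_eq (s : M.Vertex → ZMod 2) : ∃ c : M.Edge → ZMod 2,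
    (eliminate (M.edgeRow, (fun x => s (M.vertexOf x), 0))).2 =
      M.syndromeRow c + (fun x => s (M.vertexOf x), 0) := by
  obtain ⟨c, hc⟩ := foldl_eliminateAt_mem (G := M.syndromeRow.range) (List.finRange N)
    (S := (M.edgeRow, (fun x => s (M.vertexOf x), 0))) fun x => ⟨_, rfl⟩
  exact ⟨c, by rw [hc, sub_add_cancel]; rfl⟩

theorem eliminate_snd (s : M.Vertex → ZMod 2) (x : Fin N) :
    (eliminate (M.edgeRow, (fun x => s (M.vertexOf x), 0))).2.2 x =
      M.eliminationDecoder s (M.edgeOf x) := by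
  obtain ⟨c, hc⟩ := M.exists_eliminate_eq s
  have h : ∀ x, (eliminate (M.edgeRow, (fun x => s (M.vertexOf x), 0))).2.2 x = c (M.edgeOf x) :=
    fun x => by rw [hc]; simp [syndromeRow]
  rw [eliminationDecoder, h, h]
  exact congrArg c (Quot.out_eq (M.edgeOf x)).symm

/-- The syndrome of an actual error lies in the span of the edge rows, so elimination reduces it to
zero; the recorded error then has exactly that syndrome. -/
theorem isZDecoder_eliminationDecoder : M.IsZDecoder M.eliminationDecoder := by
  intro c
  obtain ⟨d, hd⟩ := M.exists_eliminate_eq (M.zSyndrome c)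
  have h0 := eliminate_fst (S := (M.edgeRow, (fun x => M.zSyndrome c (M.vertexOf x), 0))) (by
    have := AddSubgroup.mem_map_of_mem (AddMonoidHom.fst (Fin N → ZMod 2) (Fin N → ZMod 2))
      (M.syndromeRow_mem c)
    rwa [AddMonoidHom.map_closure, ← Set.range_comp] at this)
  have he : M.eliminationDecoder (M.zSyndrome c) = d := by
    funext e
    obtain ⟨x, rfl⟩ := Quot.exists_rep e
    have := M.eliminate_snd (M.zSyndrome c) x
    rw [hd] at this
    refine this.symm.trans ?_
    simp [syndromeRow]
    rfl
  rw [he]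
  funext v
  obtain ⟨x, rfl⟩ := Quot.exists_rep v
  rw [hd] at h0
  exact ZMod.two_eq_iff_add_eq_zero.2 (congrFun h0 x)

open Classical in
theorem edgeRow_fst (x y : Fin N) : (M.edgeRow x).1 y =
    (if M.vertexOf x = M.vertexOf y then 1 else 0) +
      if M.vertexOf (M.t0 x) = M.vertexOf y then 1 else 0 := by
  obtain ⟨rep, hrep⟩ : ∃ rep : M.Edge → Fin N, ∀ e, M.edgeOf (rep e) = e :=
    ⟨fun e => Quot.out e, fun e => Quot.out_eq e⟩
  -- The representative of the edge of `x` is replaced by `x` itself, which makes its two endpoints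
  -- explicit.
  have h := M.zSyndrome_eq_sum (rep := Function.update rep (M.edgeOf x) x) (fun e => by
    by_cases he : e = M.edgeOf x
    · rw [he, Function.update_self]
    · rw [Function.update_of_ne he]; exact hrep e) (Pi.single (M.edgeOf x) 1) (M.vertexOf y)
  refine h.trans ?_
  rw [Finset.sum_eq_single (M.edgeOf x)]
  · simp
  · intro e _ he; simp [Pi.single_eq_of_ne he]
  · simp

open Classical in
theorem edgeRow_snd (x y : Fin N) : (M.edgeRow x).2 y =
    if M.edgeOf y = M.edgeOf x then 1 else 0 := by
  rw [← Pi.single_apply]; rfl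

/-- An edge has at most four flags, so bounds in the number of flags are bounds in the number of
edges. -/
theorem le_four_mul_card_edge : N ≤ 4 * Nat.card M.Edge := by
  have h := Nat.card_le_card_of_surjective (α := M.Edge × Bool × Bool) (β := Fin N)
    (fun q => (if q.2.1 then M.t0 else _root_.id) ((if q.2.2 then M.t2 else _root_.id) q.1.out))
    fun x => by
      have h : M.edgeOf (M.edgeOf x).out = M.edgeOf x := Quot.out_eq _
      rcases M.edgeOf_eq.1 h with h | h | h | h
      · exact ⟨(M.edgeOf x, false, false), h.symm⟩
      · exact ⟨(M.edgeOf x, true, false), h.symm⟩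
      · exact ⟨(M.edgeOf x, false, true), h.symm⟩
      · exact ⟨(M.edgeOf x, true, true), h.symm⟩
  simpa [Nat.card_prod, mul_comm] using h

theorem card_edge_le : Nat.card M.Edge ≤ N := by
  simpa using Nat.card_le_card_of_surjective M.edgeOf Quot.mk_surjective

end SurfaceMap

/-! ### Incidence tests and the elimination decoder as programs -/

namespace PolyTime

variable {ι : Type} {n : ι → ℕ} {inp : ι → Data} {M : ∀ i, SurfaceMap (Fin (n i))}

theorem t0 (h : PolyTime n inp fun i => (M i).encode) :
    PolyTime n inp fun i => Data.table fun x => Data.ofNat ((M i).t0 x) := hd h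

theorem t1 (h : PolyTime n inp fun i => (M i).encode) :
    PolyTime n inp fun i => Data.table fun x => Data.ofNat ((M i).t1 x) := hd (tl h)

theorem t2 (h : PolyTime n inp fun i => (M i).encode) :
    PolyTime n inp fun i => Data.table fun x => Data.ofNat ((M i).t2 x) := hd (tl (tl h))

theorem hasIndices (h : PolyTime n inp fun i => (M i).encode) : HasIndices n inp :=
  hasIndices_of_involutive (fun i => (M i).t0_t0) (t0 h)

theorem vertexOf_eq {x y : ∀ i, Fin (n i)} (h : PolyTime n inp fun i =>
      Data.table fun x => Data.ofNat (_root_.orbitLabel (M i).t1 (M i).t2 x))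
    (hx : PolyTime n inp fun i => Data.ofNat (x i))
    (hy : PolyTime n inp fun i => Data.ofNat (y i)) :
    PolyTime n inp fun i => Data.ofProp ((M i).vertexOf (x i) = (M i).vertexOf (y i)) :=
  (eq (lookup h hx) (lookup h hy)).congr fun i => congrArg _ (propext ((M i).vertexOf_eq_iff _ _))

theorem edgeOf_eq {x y : ∀ i, Fin (n i)} (h : PolyTime n inp fun i =>
      Data.table fun x => Data.ofNat (_root_.orbitLabel (M i).t0 (M i).t2 x))
    (hx : PolyTime n inp fun i => Data.ofNat (x i))
    (hy : PolyTime n inp fun i => Data.ofNat (y i)) :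
    PolyTime n inp fun i => Data.ofProp ((M i).edgeOf (x i) = (M i).edgeOf (y i)) :=
  (eq (lookup h hx) (lookup h hy)).congr fun i => congrArg _ (propext ((M i).edgeOf_eq_iff _ _))

theorem faceOf_eq {x y : ∀ i, Fin (n i)} (h : PolyTime n inp fun i =>
      Data.table fun x => Data.ofNat (_root_.orbitLabel (M i).t0 (M i).t1 x))
    (hx : PolyTime n inp fun i => Data.ofNat (x i))
    (hy : PolyTime n inp fun i => Data.ofNat (y i)) :
    PolyTime n inp fun i => Data.ofProp ((M i).faceOf (x i) = (M i).faceOf (y i)) :=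
  (eq (lookup h hx) (lookup h hy)).congr fun i => congrArg _ (propext ((M i).faceOf_eq_iff _ _))

theorem edgeRow (h : PolyTime n inp fun i => (M i).encode) :
    PolyTime n inp fun i => Data.table fun x => Data.row ((M i).edgeRow x) := by
  have hi := hasIndices h
  have hx : PolyTime (ι := Σ i, Fin (n i)) (fun q => n q.1)
    (fun q => Data.cons (inp q.1) (Data.ofNat q.2)) fun q => Data.ofNat q.2 := tl id
  have ht := lookup (n := fun q : Σ i, Fin (n i) => n q.1) (k := fun q => q.2)
    (f := fun q x => Data.ofNat ((M q.1).t0 x)) (t0 h).weaken hx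
  have hV := ((orbitLabel hi (t1 h) (t2 h)).weaken (β := fun i => Fin (n i))
    (e := fun q => Data.ofNat q.2)).weaken (β := fun q => Fin (n q.1))
    (e := fun r => Data.ofNat r.2)
  have hE := ((orbitLabel hi (t0 h) (t2 h)).weaken (β := fun i => Fin (n i))
    (e := fun q => Data.ofNat q.2)).weaken (β := fun q => Fin (n q.1))
    (e := fun r => Data.ofNat r.2)
  refine tabulate hi (cons (tabulate_bits (n := fun q : Σ i, Fin (n i) => n q.1)
    (g := fun q y => ((M q.1).edgeRow q.2).1 y) hi.weaken ?_)
    (tabulate_bits (n := fun q : Σ i, Fin (n i) => n q.1)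
    (g := fun q y => ((M q.1).edgeRow q.2).2 y) hi.weaken ?_))
  · refine (add (ite_bit (vertexOf_eq (n := fun r : Σ q : (Σ i, Fin (n i)), Fin (n q.1) => n r.1.1)
      (M := fun r => M r.1.1) (x := fun r => r.1.2) (y := fun r => r.2) hV hx.weaken (tl id))
      one zero) (ite_bit
      (vertexOf_eq (n := fun r : Σ q : (Σ i, Fin (n i)), Fin (n q.1) => n r.1.1)
      (M := fun r => M r.1.1) (x := fun r => (M r.1.1).t0 r.1.2) (y := fun r => r.2)
      hV ht.weaken (tl id)) one zero)).congr fun r => ?_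
    rw [SurfaceMap.edgeRow_fst]
  · refine (ite_bit (edgeOf_eq (n := fun r : Σ q : (Σ i, Fin (n i)), Fin (n q.1) => n r.1.1)
      (M := fun r => M r.1.1) (x := fun r => r.2) (y := fun r => r.1.2)
      hE (tl id) hx.weaken) one zero).congr fun r => ?_
    rw [SurfaceMap.edgeRow_snd]

theorem eliminationDecoder {s : ∀ i, (M i).Vertex → ZMod 2}
    (h : PolyTime n inp fun i => (M i).encode)
    (hs : PolyTime n inp fun i => Data.bits fun x => s i ((M i).vertexOf x)) :
    PolyTime n inp fun i => (M i).encodeError ((M i).eliminationDecoder (s i)) := by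
  have h0 : PolyTime n inp fun i => Data.bits (0 : Fin (n i) → ZMod 2) :=
    tabulate_bits (g := fun i => 0) (hasIndices h) zero
  refine (tl (eliminate (r := fun i => (fun x => s i ((M i).vertexOf x), 0)) (hasIndices h)
    (edgeRow h) (cons hs h0))).congr fun i => ?_
  exact congrArg Data.bits (funext fun x => (M i).eliminate_snd (s i) x)

end PolyTime

/-- The decoder by Gaussian elimination, for all surface codes. -/
noncomputable def eliminationRule : ZRule := fun _ M => M.eliminationDecoder

theorem eliminationRule_isEfficientOn (𝒦 : ∀ N : ℕ, Set (SurfaceMap (Fin N))) :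
    eliminationRule.IsEfficientOn 𝒦 := by
  have h := PolyTime.eliminationDecoder
    (ι := Σ (N : ℕ) (M : SurfaceMap (Fin N)), (M.Edge → ZMod 2)) (n := fun i => i.1)
    (inp := fun i => i.2.1.encodeSyndrome (i.2.1.zSyndrome i.2.2)) (M := fun i => i.2.1)
    (s := fun i => i.2.1.zSyndrome i.2.2) (PolyTime.hd PolyTime.id)
    (PolyTime.hd (PolyTime.tl PolyTime.id))
  obtain ⟨p, K, k, hp⟩ := PolyTime.exists_runsInPolyTime
    (((PolyBdd.const 4).mul PolyBdd.self).mono fun i => i.2.1.le_four_mul_card_edge) h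
  exact ⟨p, K, k, fun i _ => hp i trivial⟩

/-! ### The syndromes after the local correction -/

/-- A half-edge has exactly the two flags `x` and `t2 x`. Programs index all tables by flags, so
sums over half-edges are rewritten this way. -/
theorem SurfaceMap.sum_halfEdge_eq_sum {Φ : Type} [Fintype Φ] (M : SurfaceMap Φ)
    {F : M.HalfEdge → ZMod 2} {g : Φ → ZMod 2} (h : ∀ x, F (M.halfEdgeOf x) = g x + g (M.t2 x)) :
    ∑ e, F e = ∑ x, g x := by
  classical
  rw [← Fintype.sum_fiberwise M.halfEdgeOf g]
  refine Finset.sum_congr rfl fun e _ => ?_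
  obtain ⟨x, rfl⟩ := Quot.exists_rep e
  change F (M.halfEdgeOf x) = ∑ y : {y // M.halfEdgeOf y = M.halfEdgeOf x}, g y
  rw [h, ← Finset.sum_subtype {x, M.t2 x} (fun y => ?_) g, Finset.sum_pair (M.t2_ne x).symm]
  rw [eq_comm (a := M.halfEdgeOf y), M.halfEdgeOf_eq, Finset.mem_insert, Finset.mem_singleton]

namespace FiveSquares

variable {Φ : Type} [Fintype Φ] {C : FiveSquares Φ} (ch : C.Choices)

/-- S1 is a product of `X` on qubits `(x, false)`, where the local correction has no `Z` part. -/
theorem updated_correctLocal_s1 (s : C.Check → ZMod 2) (f : C.Γ.Face) :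
    updated s (correctLocal ch s) (.s1 f) = s (.s1 f) := by
  obtain ⟨h1, h2, h3⟩ := C.checkOperator_s1 f
  rw [updated, syndrome, Pauli.comm, Fintype.sum_sum_type, Fintype.sum_prod_type]
  simp [h1, h2, h3, correctLocal_snd_false]

open Classical in
/-- The contribution of the half-edge at `x` to the syndrome of type 3 of the face of `x`. -/
noncomputable def sideWeight (F : Pauli C.Qubit) (x : Φ) : ZMod 2 :=
  F.2 (Sum.inl (x, true)) + F.2 (Sum.inl (C.Γ.t2 x, true)) + F.1 (Sum.inl (C.Γ.t2 x, true)) +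
    F.1 (Sum.inl (C.Γ.t2 x, false)) +
    if C.innerGreen (C.Γ.cornerOf x) = true then 0 else F.1 (Sum.inr (C.Γ.halfEdgeOf x))

open Classical in
-- Far-side terms are moved to flags of `f` by the substitution `x ↦ t2 x`, and inner qubits are
-- split over their two flags; what remains is one weight per flag, summed over the face.
theorem updated_correctLocal_s3 (s : C.Check → ZMod 2) (f : C.Γ.Face) :
    updated s (correctLocal ch s) (.s3 f) = s (.s3 f) +
      ∑ x, if C.Γ.faceOf x = f then sideWeight (correctLocal ch s) x else 0 := by
  obtain ⟨h1, h2, h3, h4⟩ := C.checkOperator_s3 f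
  set F := correctLocal ch s
  rw [updated, syndrome, Pauli.comm, Fintype.sum_sum_type, Fintype.sum_prod_type]
  have hi := C.Γ.sum_halfEdge_eq_sum (F := fun h => (C.checkOperator (.s3 f)).1 (Sum.inr h) *
      F.2 (Sum.inr h) + (C.checkOperator (.s3 f)).2 (Sum.inr h) * F.1 (Sum.inr h))
    (g := fun x => if C.Γ.faceOf x = f ∧ C.innerGreen (C.Γ.cornerOf x) = false then
      F.1 (Sum.inr (C.Γ.halfEdgeOf x)) else 0) fun x => by
    simp only [h4, F, correctLocal_snd_inr, C.Γ.halfEdgeOf_t2, mul_zero, zero_add, add_mul, ite_mul,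
      one_mul, zero_mul]
  rw [hi]
  have ht : ∀ g : Φ → ZMod 2, (∑ x, if C.Γ.faceOf (C.Γ.t2 x) = f then g x else 0) =
      ∑ x, if C.Γ.faceOf x = f then g (C.Γ.t2 x) else 0 := fun g =>
    Fintype.sum_equiv ⟨C.Γ.t2, C.Γ.t2, C.Γ.t2_t2, C.Γ.t2_t2⟩ _ _ fun x => by
      simp only [Equiv.coe_fn_mk, C.Γ.t2_t2]
  have hl : (∑ x, ∑ b, ((C.checkOperator (.s3 f)).1 (Sum.inl (x, b)) * F.2 (Sum.inl (x, b)) +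
      (C.checkOperator (.s3 f)).2 (Sum.inl (x, b)) * F.1 (Sum.inl (x, b)))) =
      (∑ x, if C.Γ.faceOf x = f then F.2 (Sum.inl (x, true)) else 0) +
      ∑ x, if C.Γ.faceOf (C.Γ.t2 x) = f then F.2 (Sum.inl (x, true)) + F.1 (Sum.inl (x, true)) +
        F.1 (Sum.inl (x, false)) else 0 := by
    rw [← Finset.sum_add_distrib]
    refine Finset.sum_congr rfl fun x _ => ?_
    rw [Fintype.sum_bool]
    have hF : F.2 (Sum.inl (x, false)) = 0 := correctLocal_snd_false ch s x
    by_cases ha : C.Γ.faceOf x = f <;> by_cases hb : C.Γ.faceOf (C.Γ.t2 x) = f <;>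
      (simp [h1, h3, hF, ha, hb]; try ring)
  rw [hl, ht, ← Finset.sum_add_distrib, ← Finset.sum_add_distrib]
  congr 1
  refine Finset.sum_congr rfl fun x _ => ?_
  by_cases ha : C.Γ.faceOf x = f <;> by_cases hb : C.innerGreen (C.Γ.cornerOf x) = true <;>
    simp [ha, hb, sideWeight] <;> ring

end FiveSquares

/-! ### The time of the algorithm -/

namespace PolyTime

variable {ι : Type} {n : ι → ℕ} {inp : ι → Data}

/-- The program for `D` is specified only on syndromes of `Z` errors, hence the hypothesis `hs`; its
bound in the number of edges becomes one in the number of flags. -/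
theorem ruleOutput {D : ZRule} {𝒦 : ∀ N : ℕ, Set (SurfaceMap (Fin N))} (hD : D.IsEfficientOn 𝒦)
    {M : ∀ i, SurfaceMap (Fin (n i))} {s : ∀ i, (M i).Vertex → ZMod 2} (hM : ∀ i, M i ∈ 𝒦 (n i))
    (hs : ∀ i, ∃ c, s i = (M i).zSyndrome c) (h : PolyTime n inp fun i => (M i).encode)
    (h' : PolyTime n inp fun i => Data.bits fun x => s i ((M i).vertexOf x)) :
    PolyTime n inp fun i => (M i).encodeError (D (n i) (M i) (s i)) := by
  choose c hc using hs
  obtain rfl : s = fun i => (M i).zSyndrome (c i) := funext hc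
  obtain ⟨p, K, k, hp⟩ := hD
  refine (cons h (cons h' nil)).comp ⟨p, fun i => K * (n i + 1) ^ k, ⟨K, k, fun _ => le_rfl⟩,
    fun i => ?_⟩
  obtain ⟨t, ht, hr⟩ := hp ⟨n i, M i, c i⟩ (hM i)
  refine ⟨t, ht.trans ?_, hr⟩
  have := (M i).card_edge_le
  dsimp only
  gcongr

theorem bits_ite (hi : HasIndices n inp) {P : ∀ i, Fin (n i) → Prop} [∀ i, DecidablePred (P i)]
    {f g : ∀ i, Fin (n i) → ZMod 2} (hP : PolyTime n inp fun i => Data.marks (P i))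
    (hf : PolyTime n inp fun i => Data.bits (f i)) (hg : PolyTime n inp fun i => Data.bits (g i)) :
    PolyTime n inp fun i => Data.bits fun x => if P i x then f i x else g i x := by
  refine tabulate_bits (g := fun i x => if P i x then f i x else g i x) hi
    ((ite_bit (c := fun q : Σ i, Fin (n i) => P q.1 q.2)
      (lookup (n := fun q : Σ i, Fin (n i) => n q.1) (f := fun q x => Data.ofProp (P q.1 x))
        (k := fun q => q.2) hP.weaken (tl id))
      (lookup_bits (n := fun q : Σ i, Fin (n i) => n q.1) (f := fun q => f q.1)
        (k := fun q => q.2) hf.weaken (tl id))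
      (lookup_bits (n := fun q : Σ i, Fin (n i) => n q.1) (f := fun q => g q.1)
        (k := fun q => q.2) hg.weaken (tl id))).congr fun q => ?_)
  split_ifs <;> rfl

theorem bits_comp (hi : HasIndices n inp) {f : ∀ i, Fin (n i) → ZMod 2}
    {t : ∀ i, Fin (n i) → Fin (n i)} (hf : PolyTime n inp fun i => Data.bits (f i))
    (ht : PolyTime n inp fun i => Data.table fun x => Data.ofNat (t i x)) :
    PolyTime n inp fun i => Data.bits fun x => f i (t i x) :=
  tabulate_bits (g := fun i x => f i (t i x)) hi
    (lookup_bits (n := fun q : Σ i, Fin (n i) => n q.1) (f := fun q => f q.1)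
      (k := fun q => t q.1 q.2) hf.weaken
      (lookup (n := fun q : Σ i, Fin (n i) => n q.1) (f := fun q x => Data.ofNat (t q.1 x))
        (k := fun q => q.2) ht.weaken (tl id)))

theorem bits_zero (hi : HasIndices n inp) :
    PolyTime n inp fun i => Data.bits fun _ : Fin (n i) => 0 :=
  tabulate_bits (g := fun _ _ => 0) hi zero

open Classical in
theorem bits_sum_face {M : ∀ i, SurfaceMap (Fin (n i))} {w : ∀ i, Fin (n i) → ZMod 2}
    (h : PolyTime n inp fun i => (M i).encode) (hw : PolyTime n inp fun i => Data.bits (w i)) :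
    PolyTime n inp fun i => Data.bits fun x =>
      ∑ y, if (M i).faceOf y = (M i).faceOf x then w i y else 0 := by
  have hi := hasIndices h
  have hL := ((orbitLabel hi (t0 h) (t1 h)).weaken (β := fun i => Fin (n i))
    (e := fun q => Data.ofNat q.2)).weaken (β := fun q => Fin (n q.1))
    (e := fun r => Data.ofNat r.2)
  have hw' := (hw.weaken (β := fun i => Fin (n i)) (e := fun q => Data.ofNat q.2)).weaken
    (β := fun q => Fin (n q.1)) (e := fun r => Data.ofNat r.2)
  have hx : PolyTime (ι := Σ i, Fin (n i)) (fun q => n q.1)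
    (fun q => Data.cons (inp q.1) (Data.ofNat q.2)) fun q => Data.ofNat q.2 := tl id
  refine tabulate_bits (g := fun i x => ∑ y, if (M i).faceOf y = (M i).faceOf x then w i y else 0)
    hi (sum (n := fun q : Σ i, Fin (n i) => n q.1) (g := fun q y =>
      if (M q.1).faceOf y = (M q.1).faceOf q.2 then w q.1 y else 0) hi.weaken ?_)
  exact ite_bit (faceOf_eq (n := fun r : Σ q : (Σ i, Fin (n i)), Fin (n q.1) => n r.1.1)
    (M := fun r => M r.1.1) (x := fun r => r.2) (y := fun r => r.1.2) hL (tl id) hx.weaken)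
    (lookup_bits (n := fun r : Σ q : (Σ i, Fin (n i)), Fin (n q.1) => n r.1.1)
      (f := fun r => w r.1.1) (k := fun r => r.2) hw' (tl id)) zero

theorem dual {M : ∀ i, SurfaceMap (Fin (n i))} (h : PolyTime n inp fun i => (M i).encode) :
    PolyTime n inp fun i => (M i).dual.encode :=
  (cons (t2 h) (cons (t1 h) (cons (t0 h) nil))).congr fun _ => rfl

variable {C : ∀ i, FiveSquares (Fin (n i))} {ch : ∀ i, (C i).Choices}
  {s : ∀ i, (C i).Check → ZMod 2}

theorem decode {D₁ D₂ : ZRule} {𝒦 : ∀ N : ℕ, Set (SurfaceMap (Fin N))} (h₁ : D₁.IsEfficientOn 𝒦)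
    (h₂ : D₂.IsEfficientOn 𝒦) (hC : ∀ i, (C i).Γ.dual ∈ 𝒦 (n i))
    (ha : ∀ i, ∃ a, FiveSquares.projectA (ch i) (s i) = (C i).Γ.dual.zSyndrome a)
    (hb : ∀ i, ∃ b, FiveSquares.projectB (ch i) (s i) = (C i).Γ.dual.zSyndrome b)
    (h : PolyTime n inp fun i => (C i).encodeInput (ch i) (s i)) :
    PolyTime n inp fun i => (C i).encodeOutput (FiveSquares.decode (ch i)
      (D₁ (n i) (C i).Γ.dual) (D₂ (n i) (C i).Γ.dual) (s i)) := by
  classical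
  have hΓ : PolyTime n inp fun i => (C i).Γ.encode := hd h
  have hi := hasIndices hΓ
  -- `g2`, `g3`, `g4`, `g5` are the input without its first 3, 6, 9 and 12 fields.
  have g2 := tl (tl (tl h))
  have g3 := tl (tl (tl g2))
  have g4 := tl (tl (tl g3))
  have g5 := tl (tl (tl g4))
  have hside : PolyTime n inp fun i =>
    Data.marks fun x => (C i).side ((C i).Γ.faceOf x) = true := hd (tl h)
  have hgreen : PolyTime n inp fun i =>
    Data.marks fun x => (C i).innerGreen ((C i).Γ.cornerOf x) = true := hd (tl (tl h))
  have heT : PolyTime n inp fun i => Data.marks fun x =>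
    (ch i).eQubit ((C i).base.edgeOf (x, true)) = (x, true) := hd g2
  have heF : PolyTime n inp fun i => Data.marks fun x =>
    (ch i).eQubit ((C i).base.edgeOf (x, false)) = (x, false) := hd (tl g2)
  have hinner : PolyTime n inp fun i => Data.marks fun x =>
    (ch i).innerQubit ((C i).Γ.vertexOf x) = (C i).Γ.halfEdgeOf x := hd (tl (tl g2))
  have hv : PolyTime n inp fun i => Data.marks fun x =>
    (ch i).vQubit ((C i).Γ.vertexOf x) = x := hd g3
  have hqA : PolyTime n inp fun i => Data.marks fun x =>
    (ch i).qubitA ((C i).Γ.dual.edgeOf x) = x := hd (tl g3)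
  have hqB : PolyTime n inp fun i => Data.marks fun x =>
    (ch i).qubitB ((C i).Γ.dual.edgeOf x) = x := hd (tl (tl g3))
  have hs1 : PolyTime n inp fun i => Data.bits fun x => s i (.s1 ((C i).Γ.faceOf x)) := hd g4
  have hs2 : PolyTime n inp fun i => Data.bits fun x => s i (.s2 ((C i).Γ.vertexOf x)) :=
    hd (tl g4)
  have hs3 : PolyTime n inp fun i => Data.bits fun x => s i (.s3 ((C i).Γ.faceOf x)) :=
    hd (tl (tl g4))
  have hs4 : PolyTime n inp fun i => Data.bits fun x => s i (.s4 ((C i).Γ.vertexOf x)) := hd g5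
  have hs5 : PolyTime n inp fun i => Data.bits fun x => s i (.s5 ((C i).base.edgeOf (x, true))) :=
    hd (tl g5)
  let F := fun i => FiveSquares.correctLocal (ch i) (s i)
  have hF1 : PolyTime n inp fun i => Data.bits fun x => (F i).1 (Sum.inl (x, true)) :=
    (bits_ite hi heT hs5 (bits_zero hi)).congr fun i => congrArg _ <| funext fun x => by
      simp only [F, FiveSquares.correctLocal_fst, FiveSquares.correctX_fst_inl]
      congr
  have hF2 : PolyTime n inp fun i => Data.bits fun x => (F i).1 (Sum.inl (x, false)) :=
    (bits_ite hi heF hs5 (bits_zero hi)).congr fun i => congrArg _ <| funext fun x => by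
      -- Both copies of a flag lie on the same `e`-face, so one table of S5 bits serves for both.
      have he : (C i).base.edgeOf (x, false) = (C i).base.edgeOf (x, true) :=
        (C i).base.edgeOf_t0 (x, true)
      simp only [F, FiveSquares.correctLocal_fst, FiveSquares.correctX_fst_inl, he]
  have hF3 : PolyTime n inp fun i =>
      Data.bits fun x => (F i).1 (Sum.inr ((C i).Γ.halfEdgeOf x)) :=
    (bits_ite hi hinner hs4 (bits_zero hi)).congr fun i => congrArg _ <| funext fun x => by
      simp only [F, FiveSquares.correctLocal_fst, FiveSquares.correctX_fst_inr]
      congr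
  have hF4 : PolyTime n inp fun i => Data.bits fun x => (F i).2 (Sum.inl (x, true)) :=
    (bits_ite hi hv hs2 (bits_zero hi)).congr fun i => congrArg _ <| funext fun x => by
      simp only [F, FiveSquares.correctLocal_snd_true]
      congr
  have hw : PolyTime n inp fun i => Data.bits (FiveSquares.sideWeight (F i)) :=
    bits_add hi (bits_add hi (bits_add hi (bits_add hi hF4 (bits_comp hi hF4 (t2 hΓ)))
      (bits_comp hi hF1 (t2 hΓ))) (bits_comp hi hF2 (t2 hΓ)))
      (bits_ite hi hgreen (bits_zero hi) hF3)
  have hu3 : PolyTime n inp fun i => Data.bits fun x =>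
      FiveSquares.updated (s i) (F i) (.s3 ((C i).Γ.faceOf x)) :=
    (bits_add hi hs3 (bits_sum_face hΓ hw)).congr fun i => congrArg _ <| funext fun x => by
      rw [FiveSquares.updated_correctLocal_s3]; rfl
  have hu1 : PolyTime n inp fun i => Data.bits fun x =>
      FiveSquares.updated (s i) (F i) (.s1 ((C i).Γ.faceOf x)) :=
    hs1.congr fun i => congrArg _ <| funext fun x => by
      rw [FiveSquares.updated_correctLocal_s1]
  -- The vertices of `Γ*` are the faces of `Γ` by definition, so selecting between the S1 and S3
  -- tables by color is literally the table of `projectA`.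
  have hA := ruleOutput h₁ hC ha (dual hΓ) (bits_ite hi hside hu1 hu3)
  have hB := ruleOutput h₂ hC hb (dual hΓ) (bits_ite hi hside hu3 hu1)
  have hL : PolyTime n inp fun i => Data.bits fun x => (FiveSquares.lift (ch i)
      (D₁ (n i) (C i).Γ.dual (FiveSquares.projectA (ch i) (s i)))
      (D₂ (n i) (C i).Γ.dual (FiveSquares.projectB (ch i) (s i)))).2 (Sum.inl (x, false)) :=
    (bits_add hi (bits_ite hi hqA hA (bits_zero hi)) (bits_ite hi hqB hB (bits_zero hi))).congr
      fun i => congrArg _ <| funext fun x => by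
        rw [FiveSquares.lift_snd_false, Pi.add_apply]
        congr
  refine (cons hF1 (cons hF2 (cons hF3 (cons hF4 (cons hL (cons (bits_zero hi) nil)))))).congr
    fun i => ?_
  simp only [FiveSquares.encodeOutput, FiveSquares.decode, Prod.fst_add, Prod.snd_add, Pi.add_apply,
    FiveSquares.lift_fst, Pi.zero_apply, add_zero, FiveSquares.lift_snd_true,
    FiveSquares.lift_snd_inr, FiveSquares.correctLocal_snd_inr,
    FiveSquares.correctLocal_snd_false, zero_add]
  rfl

end PolyTime

theorem decodesEfficientlyOn {D₁ D₂ : ZRule} {𝒦 : ∀ N : ℕ, Set (SurfaceMap (Fin N))}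
    (h₁ : D₁.IsEfficientOn 𝒦) (h₂ : D₂.IsEfficientOn 𝒦) : DecodesEfficientlyOn D₁ D₂ 𝒦 := by
  have h := PolyTime.decode
    (ι := {i : Σ (N : ℕ) (C : FiveSquares (Fin N)), C.Choices × Pauli C.Qubit //
      i.2.1.Γ.dual ∈ 𝒦 i.1}) (n := fun i => i.1.1)
    (inp := fun i => i.1.2.1.encodeInput i.1.2.2.1 (i.1.2.1.syndrome i.1.2.2.2))
    (C := fun i => i.1.2.1) (ch := fun i => i.1.2.2.1)
    (s := fun i => i.1.2.1.syndrome i.1.2.2.2) h₁ h₂ (fun i => i.2)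
    (fun i => by
      obtain ⟨a, b, -, h, -⟩ := FiveSquares.exists_lift_correctLocal i.1.2.2.1 i.1.2.2.2
      exact ⟨a, h⟩)
    (fun i => by
      obtain ⟨a, b, -, -, h⟩ := FiveSquares.exists_lift_correctLocal i.1.2.2.1 i.1.2.2.2
      exact ⟨b, h⟩) PolyTime.id
  obtain ⟨p, K, k, hp⟩ := PolyTime.exists_runsInPolyTime (size := fun i => Nat.card i.1.2.1.Qubit)
    -- Two qubits for every flag already bound the number of flags by the number of qubits.
    (PolyBdd.self.mono fun i => by
      rw [Nat.card_sum, Nat.card_prod]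
      simp only [Nat.card_eq_fintype_card, Fintype.card_fin, Fintype.card_bool]
      omega) h
  exact ⟨p, K, k, fun i hi => hp ⟨i, hi⟩ trivial⟩

theorem mainTheorem9 :
    -- Correctness: for every code, all choices, every error and all surface code decoders.
    (∀ (Φ : Type) [Fintype Φ] (C : FiveSquares Φ) (ch : C.Choices),
      (∀ g : C.Check, C.checkOperator g ∈ C.stabilizer) ∧
      ∀ E : Pauli C.Qubit, ∃ a b : C.Γ.dual.Edge → ZMod 2,
        E + FiveSquares.correctLocal ch (C.syndrome E) + FiveSquares.lift ch a b ∈ C.gauge ∧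
        FiveSquares.projectA ch (C.syndrome E) = C.Γ.dual.zSyndrome a ∧
        FiveSquares.projectB ch (C.syndrome E) = C.Γ.dual.zSyndrome b ∧
        ∀ D₁ D₂ : (C.Γ.dual.Vertex → ZMod 2) → (C.Γ.dual.Edge → ZMod 2),
          C.Γ.dual.IsZDecoder D₁ → C.Γ.dual.IsZDecoder D₂ →
            E + FiveSquares.decode ch D₁ D₂ (C.syndrome E) ∈ Pauli.centralizer C.stabilizer ∧
            (E + FiveSquares.decode ch D₁ D₂ (C.syndrome E) ∈ C.gauge ↔
              C.Γ.dual.zError (a + D₁ (C.Γ.dual.zSyndrome a)) ∈ C.Γ.dual.surfaceStabilizer ∧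
              C.Γ.dual.zError (b + D₂ (C.Γ.dual.zSyndrome b)) ∈ C.Γ.dual.surfaceStabilizer)) ∧
    -- Efficiency: with efficient surface code decoders the algorithm is efficient.
    (∀ (𝒦 : ∀ N : ℕ, Set (SurfaceMap (Fin N))) (D₁ D₂ : ZRule),
      D₁.IsEfficientOn 𝒦 → D₂.IsEfficientOn 𝒦 → DecodesEfficientlyOn D₁ D₂ 𝒦) ∧
    -- There are efficient surface code decoders.
    (∃ D : ZRule, (∀ (N : ℕ) (M : SurfaceMap (Fin N)), M.IsZDecoder (D N M)) ∧
      D.IsEfficientOn fun _ => Set.univ) := by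
  refine ⟨fun Φ _ C ch => ⟨C.checkOperator_mem_stabilizer, FiveSquares.decode_correct ch⟩,
    fun _ _ _ => decodesEfficientlyOn, eliminationRule, fun N M => M.isZDecoder_eliminationDecoder,
    eliminationRule_isEfficientOn _⟩
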